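/- Fix $\mu\in\mathbb C$. For $n=0,1,2,\dots$ let $$Y_n^\mu(z)=\sum_{k=0}^n\binom nk (n+\mu+1)_k\left(\tfrac12 z\right)^k$$ be the generalized Bessel polynomials, where $(p)_k=p(p+1)\cdots(p+k-1)$, and for $\Re z>0$ put $$F_n^\mu(1/z)=\frac{n!\,(2z)^{n+\mu+1}e^{-2z}}{\Gamma(2n+\mu+2)}\,{}_1F_1(n+1;2n+\mu+2;2z),\qquad U_n^\mu(1/z)=\frac{(-1)^n n!\,(2z)^{n+\mu+1}e^{-2z}}{\Gamma(n+\mu+1)}\,U(n+1,2n+\mu+2,2z),$$ with the Kummer functions ${}_1F_1(a;c;x)=\sum_{k\ge0}\frac{(a)_k}{(c)_k}\frac{x^k}{k!}$ and, for $\Re a>0$ and $\Re x>0$, $U(a,c,x)=\frac1{\Gamma(a)}\int_0^\infty t^{a-1}(1+t)^{c-a-1}e^{-xt}\,dt$. All powers, roots and logarithms have their principal values. Then $$Y_n^\mu(-1/z)=F_n^\mu(1/z)+U_n^\mu(1/z)\qquad(\Re z>0)$$ for every $n$ such that $n+\mu+1\notin\{0,-1,-2,\dots\}$. Moreover, with $$\nu=n+\tfrac12,\qquad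 \zeta=\frac1{\nu z},\qquad t=\frac1{\sqrt{1+z^2}},\qquad \eta=\sqrt{1+z^2}+\log\frac{z}{1+\sqrt{1+z^2}},$$ there are coefficients $B_k(\mu,z)$ and $C_k(\mu,z)$ $(k\ge0,\ \Re z>0)$, independent of $n$, such that, as $n\to\infty$, $$U_n^\mu(\zeta)\sim(-1)^n\frac{\left(1+z+\sqrt{1+z^2}\right)^\mu\sqrt z}{(1+z^2)^{1/4}}\,e^{-\nu z-\nu\eta}\sum_{k=0}^\infty\frac{B_k(\mu,z)}{\nu^k},$$ $$F_n^\mu(\zeta)\sim\frac{\left(1+z-\sqrt{1+z^2}\right)^\mu\sqrt z}{(1+z^2)^{1/4}}\,e^{-\nu z+\nu\eta}\sum_{k=0}^\infty\frac{C_k(\mu,z)}{\nu^k},$$ and for every $\delta>0$ both expansions hold uniformly in the sector $z\ne0$, $|\mathrm{ph}\,z|\le\frac12\pi-\delta$: for every $N\ge0$ the error of the sum of the first $N$ terms, divided by the factor in front of the sum, is $O(\nu^{-N})$ with a constant and a threshold for $n$ that depend only on $\mu,\delta,N$. Here $B_0(\mu,z)=C_0(\mu,z)=1$ and $$B_1(\mu,z)=\frac{t(5t^2-3)}{24}+\frac{\mu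 t^2(z-1)}4-\frac{\mu^2(zt+1)}4,\qquad C_1(\mu,z)=-\frac{t(5t^2-3)}{24}+\frac{\mu t^2(z-1)}4+\frac{\mu^2(zt-1)}4.$$ -/

import Mathlib

noncomputable section

/-- The generalized Bessel polynomial `Y_n^μ(z) = ∑_{k=0}^n (n choose k) (n+μ+1)_k (z/2)^k`. -/
def genBesselY (n : ℕ) (μ z : ℂ) : ℂ :=
  ∑ k ∈ Finset.range (n + 1),
    (n.choose k : ℂ) * (ascPochhammer ℂ k).eval ((n : ℂ) + μ + 1) * (z / 2) ^ k

/-- Kummer's function `₁F₁(a; c; x) = ∑_k (a)_k x^k / ((c)_k k!)`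
(for `c` not a non-positive integer). -/
def kummerM (a c x : ℂ) : ℂ :=
  ∑' k : ℕ, (ascPochhammer ℂ k).eval a / (ascPochhammer ℂ k).eval c * (x ^ k / (k.factorial : ℂ))

/-- Kummer's (Tricomi's) function `U(a, c, x)` in the range `Re a > 0`, `Re x > 0`, for arbitrary
complex `c`: `U(a, c, x) = Γ(a)⁻¹ ∫_0^∞ t^{a-1} (1+t)^{c-a-1} e^{-x t} dt`. -/
def kummerU (a c x : ℂ) : ℂ :=
  (Complex.Gamma a)⁻¹ *
    ∫ t in Set.Ioi (0 : ℝ),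
      (t : ℂ) ^ (a - 1) * (1 + (t : ℂ)) ^ (c - a - 1) * Complex.exp (-(x * (t : ℂ)))

/-- `F_n^μ(ζ)`; with `ζ = 1/z` this is
`n! (2z)^{n+μ+1} e^{-2z} / Γ(2n+μ+2) · ₁F₁(n+1; 2n+μ+2; 2z)`. -/
def genBesselF (n : ℕ) (μ ζ : ℂ) : ℂ :=
  (n.factorial : ℂ) * (2 / ζ) ^ ((n : ℂ) + μ + 1) * Complex.exp (-(2 / ζ))
    / Complex.Gamma (2 * (n : ℂ) + μ + 2)
    * kummerM ((n : ℂ) + 1) (2 * (n : ℂ) + μ + 2) (2 / ζ)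

/-- `U_n^μ(ζ)`; with `ζ = 1/z` this is
`(-1)^n n! (2z)^{n+μ+1} e^{-2z} / Γ(n+μ+1) · U(n+1, 2n+μ+2, 2z)`. -/
def genBesselU (n : ℕ) (μ ζ : ℂ) : ℂ :=
  (-1) ^ n * (n.factorial : ℂ) * (2 / ζ) ^ ((n : ℂ) + μ + 1) * Complex.exp (-(2 / ζ))
    / Complex.Gamma ((n : ℂ) + μ + 1)
    * kummerU ((n : ℂ) + 1) (2 * (n : ℂ) + μ + 2) (2 / ζ)

/-- The principal value of `√(1+z²)`. -/
def rootZ (z : ℂ) : ℂ := (1 + z ^ 2) ^ (1 / 2 : ℂ)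

/-- `t = 1/√(1+z²)`. -/
def tZ (z : ℂ) : ℂ := 1 / rootZ z

/-- `η = √(1+z²) + log (z / (1+√(1+z²)))`. -/
def etaZ (z : ℂ) : ℂ := rootZ z + Complex.log (z / (1 + rootZ z))

/-- The large parameter `ν = n + 1/2`. -/
def nuN (n : ℕ) : ℝ := (n : ℝ) + 1 / 2

/-- The sector `|ph z| ≤ π/2 - δ`, `z ≠ 0`. -/
def sector (δ : ℝ) : Set ℂ := {z | z ≠ 0 ∧ |Complex.arg z| ≤ Real.pi / 2 - δ}

/-- Front factor of the expansion of `U_n^μ(1/(νz))`. -/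
def frontU (n : ℕ) (μ z : ℂ) : ℂ :=
  (-1) ^ n * ((1 + z + rootZ z) ^ μ * z ^ (1 / 2 : ℂ) / (1 + z ^ 2) ^ (1 / 4 : ℂ))
    * Complex.exp (-((nuN n : ℂ) * z) - (nuN n : ℂ) * etaZ z)

/-- Front factor of the expansion of `F_n^μ(1/(νz))`. -/
def frontF (n : ℕ) (μ z : ℂ) : ℂ :=
  (1 + z - rootZ z) ^ μ * z ^ (1 / 2 : ℂ) / (1 + z ^ 2) ^ (1 / 4 : ℂ)
    * Complex.exp (-((nuN n : ℂ) * z) + (nuN n : ℂ) * etaZ z)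

/-- `f n z ∼ p n z · ∑_{k ≥ 0} c k z / ν^k` as `n → ∞`, `ν = n + 1/2`, uniformly for `z ∈ S`:
for every `N`, the error of the sum of the first `N` terms is `O(ν^{-N})` relative to the front
factor `p n z`, with a constant and a threshold that do not depend on `z ∈ S`. -/
def HasUniformExpansion (f p c : ℕ → ℂ → ℂ) (S : Set ℂ) : Prop :=
  ∀ N : ℕ, ∃ K : ℝ, ∃ n₀ : ℕ, ∀ n : ℕ, n₀ ≤ n → ∀ z ∈ S,
    ‖f n z - p n z * ∑ k ∈ Finset.range N, c k z / (nuN n : ℂ) ^ k‖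
      ≤ K * ‖p n z‖ / nuN n ^ N

end

/-! With θ = z d/dz, the functions Y, F and U at argument 1/(νz) (−1/(νz) for Y) all satisfy θ²G +
(2νz − 1 − μ)θG − (ν − ½)(ν + ½ + μ)G = 0. Dividing by the front factor, written as exp(`logFront`)
with σ = 1 for F and σ = −1 for U, leaves an amplitude A with θ²A + (2νσR + s)θA + qA = 0, where R =
√(1+z²) (`logFrontTheta_riccati`, `BesselSolution.amplitude`). Inserting A ~ Σ a_k/ν^k gives
θa_{k+1} = −(σ/2)R⁻¹(θ²a_k + sθa_k + qa_k). Since R⁻¹q is O(r/(1+r)²) on cones, r = |z|, each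
right-hand side can be integrated against dz/z up to infinity, where the value d_k of a_k is
prescribed (`exists_formalSolution`).

The error ε of a partial sum satisfies the same equation up to a residual O(ν^{1−N}). Along a ray,
parametrized from the end where the solution is recessive (0 for F, ∞ for U), this is a first-order
linear equation for θε whose coefficient has real part at least a multiple of ν(1+r). A solution
bounded at the recessive end is therefore no larger than residual over coefficient, and integrating
dz/z gives an oscillation of ε along the ray that is half its supremum plus O(ν^{−N}). So ε is
bounded by twice its value at any other point of the ray plus O(ν^{−N}) (`FormalSolution.error_le`);
that point is sent to infinity (`hasUniformExpansion_of_amplitude`).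

What remains is the amplitude at infinity. For U it is ν^μ n!/Γ(n+μ+1), by Watson's lemma for the
Laplace integral of U; its expansion in 1/ν (`exists_gammaRatio_expansion`) supplies the d_k. For F
it is 1, because F = Y − U, Y tends to 1 and U is exponentially small.

The connection formula comes from ∫₀^∞ (1−s)ⁿ s^{n+μ} e^{−xs} ds: binomial expansion gives Y, the
part over [0,1] is Euler's integral for F, the part over [1,∞) is U (`connection_of_one_le_re`). A
three-term recurrence in μ common to Y, F and U removes the restriction on Re μ (`connection`). -/

noncomputable section

open Filter Topology Set MeasureTheory

/-! ### The square root `√(1+z²)` on the right half-plane -/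

/-- The cone `|z| ≤ M · Re z` in the right half-plane. -/
def cone (M : ℝ) : Set ℂ := {z | 0 < z.re ∧ ‖z‖ ≤ M * z.re}

lemma one_le_of_mem_cone {M : ℝ} {z : ℂ} (hz : z ∈ cone M) : 1 ≤ M := by
  have h1 := Complex.re_le_norm z
  have h2 := hz.2
  have h3 := hz.1
  by_contra h
  push Not at h
  nlinarith

lemma mem_cone_self {z : ℂ} (hz : 0 < z.re) : z ∈ cone (‖z‖ / z.re) :=
  ⟨hz, by rw [div_mul_cancel₀ _ hz.ne']⟩

lemma ne_zero_of_re_pos {z : ℂ} (hz : 0 < z.re) : z ≠ 0 := by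
  rintro rfl; simp at hz

lemma smul_mem_cone {M u : ℝ} {z : ℂ} (hz : z ∈ cone M) (hu : 0 < u) : (u : ℂ) * z ∈ cone M := by
  obtain ⟨h1, h2⟩ := hz
  refine ⟨by simpa using mul_pos hu h1, ?_⟩
  simp only [norm_mul, Complex.norm_real, Complex.mul_re, Complex.ofReal_re, Complex.ofReal_im,
    zero_mul, sub_zero, Real.norm_of_nonneg hu.le]
  nlinarith

/-- On the sector cos(arg z) ≥ sin δ, so M = 1/sin δ works. The cone inequality is invariant under
positive scaling and easy to check on discs. -/
lemma sector_subset_cone {δ : ℝ} (hδ : 0 < δ) : ∃ M, sector δ ⊆ cone M := by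
  by_cases h : δ ≤ Real.pi / 2
  · have hs : 0 < Real.sin δ := Real.sin_pos_of_pos_of_lt_pi hδ (by linarith [Real.pi_pos])
    refine ⟨1 / Real.sin δ, fun z hz => ?_⟩
    have hn : 0 < ‖z‖ := norm_pos_iff.2 hz.1
    have hc : Real.sin δ ≤ Real.cos z.arg := by
      rw [← Real.cos_pi_div_two_sub, ← Real.cos_abs z.arg]
      exact Real.cos_le_cos_of_nonneg_of_le_pi (abs_nonneg _) (by linarith [Real.pi_pos]) hz.2
    have hre : z.re = ‖z‖ * Real.cos z.arg := (Complex.norm_mul_cos_arg z).symm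
    refine ⟨by rw [hre]; exact mul_pos hn (hs.trans_le hc), ?_⟩
    rw [hre, div_mul_eq_mul_div, one_mul, le_div_iff₀ hs]
    exact mul_le_mul_of_nonneg_left hc hn.le
  -- For δ > π/2 the sector is empty, so any M serves.
  · refine ⟨0, fun z hz => ?_⟩
    have := hz.2
    have h2 := abs_nonneg z.arg
    push Not at h
    linarith

/-- The imaginary part 2 Re z Im z vanishes only for real z, and then 1 + z² > 0. This makes the
principal root holomorphic on the half-plane. -/
lemma one_add_sq_mem_slitPlane {z : ℂ} (hz : 0 < z.re) : 1 + z ^ 2 ∈ Complex.slitPlane := by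
  rw [Complex.mem_slitPlane_iff]
  by_cases h : z.im = 0
  · left; simp [sq, h]; nlinarith
  · right; simp [sq]
    have := mul_ne_zero hz.ne' h
    intro h'; apply this; linarith

lemma rootZ_sq (z : ℂ) : rootZ z ^ 2 = 1 + z ^ 2 := by
  rw [rootZ, ← Complex.cpow_nat_mul]; simp

lemma rootZ_re_pos {z : ℂ} (hz : 0 < z.re) : 0 < (rootZ z).re := by
  have h := one_add_sq_mem_slitPlane hz
  have h0 := Complex.slitPlane_ne_zero h
  rw [rootZ, Complex.cpow_def_of_ne_zero h0, Complex.exp_re]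
  apply mul_pos (Real.exp_pos _)
  apply Real.cos_pos_of_mem_Ioo
  have h1 := Complex.neg_pi_lt_arg (1 + z ^ 2)
  have h2 := (Complex.arg_le_pi (1 + z ^ 2)).lt_of_ne (Complex.mem_slitPlane_iff_arg.1 h).1
  have : (Complex.log (1 + z ^ 2) * (1 / 2)).im = Complex.arg (1 + z ^ 2) / 2 := by
    rw [show (1 / 2 : ℂ) = ((1 / 2 : ℝ) : ℂ) by norm_num, Complex.im_mul_ofReal, Complex.log_im]
    ring
  rw [this]
  constructor <;> linarith

lemma rootZ_ne_zero {z : ℂ} (hz : 0 < z.re) : rootZ z ≠ 0 := ne_zero_of_re_pos (rootZ_re_pos hz)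

lemma rootZ_eq_exp {z : ℂ} (hz : 0 < z.re) :
    rootZ z = Complex.exp (Complex.log (1 + z ^ 2) / 2) := by
  rw [rootZ, Complex.cpow_def_of_ne_zero (Complex.slitPlane_ne_zero (one_add_sq_mem_slitPlane hz))]
  congr 1; ring

lemma log_rootZ {z : ℂ} (hz : 0 < z.re) :
    Complex.log (rootZ z) = Complex.log (1 + z ^ 2) / 2 := by
  rw [rootZ_eq_exp hz]
  have h1 := Complex.neg_pi_lt_arg (1 + z ^ 2)
  have h2 := Complex.arg_le_pi (1 + z ^ 2)
  have : (Complex.log (1 + z ^ 2) / 2).im = Complex.arg (1 + z ^ 2) / 2 := by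
    rw [show (2 : ℂ) = ((2 : ℝ) : ℂ) by norm_num, Complex.div_ofReal_im, Complex.log_im]
  apply Complex.log_exp <;> rw [this] <;> linarith [Real.pi_pos]

lemma hasDerivAt_rootZ {z : ℂ} (hz : 0 < z.re) : HasDerivAt rootZ (z / rootZ z) z := by
  have h : HasDerivAt (fun z : ℂ => 1 + z ^ 2) (2 * z) z := by
    simpa using (hasDerivAt_pow 2 z).const_add 1
  have h' := h.cpow_const (c := (1 / 2 : ℂ)) (one_add_sq_mem_slitPlane hz)
  have h0 := Complex.slitPlane_ne_zero (one_add_sq_mem_slitPlane hz)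
  have hR := rootZ_ne_zero hz
  refine HasDerivAt.congr_deriv (f := rootZ) h' ?_
  symm
  rw [Complex.cpow_sub _ _ h0, Complex.cpow_one, div_eq_iff hR]
  have := rootZ_sq z
  rw [show (1 + z ^ 2) ^ (1 / 2 : ℂ) = rootZ z from rfl, ← this]
  field_simp

/-- With R = a + bi and z = x + yi one has ab = xy and a² − b² = 1 + x² − y². If a < x, the first
relation forces b² ≥ y², contradicting the second. -/
lemma re_le_rootZ_re {z : ℂ} (hz : 0 < z.re) : z.re ≤ (rootZ z).re := by
  have h := rootZ_sq z
  have ha := rootZ_re_pos hz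
  have h1 := congrArg Complex.re h
  have h2 := congrArg Complex.im h
  simp [sq] at h1 h2
  set a := (rootZ z).re
  set b := (rootZ z).im
  set x := z.re
  set y := z.im
  have h3 : a * b = x * y := by linarith
  by_contra hc
  push Not at hc
  have h4 : a * a < x * x := by nlinarith
  have h5 : y * y ≤ b * b := by
    by_contra h6
    push Not at h6
    have h7 : (a * b) * (a * b) = (x * y) * (x * y) := by rw [h3]
    nlinarith [mul_pos ha ha, mul_self_nonneg b, mul_self_nonneg y]
  nlinarith

lemma rootZ_re_lower {M : ℝ} {z : ℂ} (hz : z ∈ cone M) :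
    (1 + ‖z‖) / (3 * M) ≤ (rootZ z).re := by
  have hM := one_le_of_mem_cone hz
  have h1 := re_le_rootZ_re hz.1
  have ha := rootZ_re_pos hz.1
  rw [div_le_iff₀ (by linarith)]
  -- Near 0 the root has real part at least ½; away from 0 one has Re R ≥ Re z ≥ |z|/M and 1 + |z| ≤
  -- 3|z|.
  by_cases hs : ‖z‖ ≤ 1 / 2
  · have h := congrArg Complex.re (rootZ_sq z)
    simp [sq] at h
    have hy : |z.im| ≤ 1 / 2 := (Complex.abs_im_le_norm z).trans hs
    rw [abs_le] at hy
    have : (1 / 2 : ℝ) ≤ (rootZ z).re := by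
      by_contra hc
      push Not at hc
      nlinarith [mul_self_nonneg (rootZ z).im, mul_self_nonneg z.re]
    nlinarith
  · push Not at hs
    have := hz.2
    nlinarith

lemma norm_rootZ_le (z : ℂ) : ‖rootZ z‖ ≤ 1 + ‖z‖ := by
  have h : ‖rootZ z‖ ^ 2 ≤ (1 + ‖z‖) ^ 2 := by
    rw [← norm_pow, rootZ_sq]
    calc ‖1 + z ^ 2‖ ≤ ‖(1 : ℂ)‖ + ‖z ^ 2‖ := norm_add_le _ _
      _ = 1 + ‖z‖ ^ 2 := by simp
      _ ≤ _ := by nlinarith [norm_nonneg z]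
  exact (pow_le_pow_iff_left₀ (norm_nonneg _) (by positivity) two_ne_zero).1 h

/-- `z / √(1+z²)`. -/
def betaZ (z : ℂ) : ℂ := z * tZ z

lemma tZ_sq_add {z : ℂ} (hz : 0 < z.re) : tZ z ^ 2 + betaZ z ^ 2 = 1 := by
  have := rootZ_ne_zero hz
  rw [betaZ, tZ]
  field_simp
  rw [rootZ_sq]

lemma norm_tZ_le {M : ℝ} {z : ℂ} (hz : z ∈ cone M) : ‖tZ z‖ ≤ 3 * M * (1 / (1 + ‖z‖)) := by
  have h := (rootZ_re_lower hz).trans (Complex.re_le_norm _)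
  have hM := one_le_of_mem_cone hz
  have hn := norm_nonneg z
  rw [tZ, norm_div, norm_one]
  calc 1 / ‖rootZ z‖ ≤ 1 / ((1 + ‖z‖) / (3 * M)) :=
        one_div_le_one_div_of_le (by positivity) h
    _ = _ := by field_simp

lemma norm_betaZ_le {M : ℝ} {z : ℂ} (hz : z ∈ cone M) :
    ‖betaZ z‖ ≤ 3 * M * (‖z‖ / (1 + ‖z‖)) := by
  rw [betaZ, norm_mul]
  calc ‖z‖ * ‖tZ z‖ ≤ ‖z‖ * (3 * M * (1 / (1 + ‖z‖))) :=
        mul_le_mul_of_nonneg_left (norm_tZ_le hz) (norm_nonneg _)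
    _ = _ := by ring

lemma hasDerivAt_tZ {z : ℂ} (hz : 0 < z.re) :
    HasDerivAt tZ (-(tZ z * betaZ z ^ 2) / z) z := by
  have hR := rootZ_ne_zero hz
  have hz0 := ne_zero_of_re_pos hz
  have h := (hasDerivAt_rootZ hz).inv hR
  have h' : HasDerivAt tZ (-(z / rootZ z) / rootZ z ^ 2) z := by
    refine h.congr_of_eventuallyEq (Eventually.of_forall fun w => ?_)
    simp [tZ]
  convert h' using 1
  rw [betaZ, tZ]; field_simp

lemma hasDerivAt_betaZ {z : ℂ} (hz : 0 < z.re) :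
    HasDerivAt betaZ (betaZ z * tZ z ^ 2 / z) z := by
  have hz0 := ne_zero_of_re_pos hz
  have h := (hasDerivAt_id z).mul (hasDerivAt_tZ hz)
  refine HasDerivAt.congr_deriv (f := betaZ) h ?_
  have := tZ_sq_add hz
  simp only [id, one_mul]
  rw [betaZ] at *
  field_simp
  linear_combination -tZ z * this

/-! ### Holomorphic functions on the right half-plane with bounds on cones -/

lemma isOpen_re_pos : IsOpen {z : ℂ | 0 < z.re} := isOpen_lt continuous_const Complex.continuous_re

/-- `f = O(w(|z|))` on every cone. -/
def ConeBounded (w : ℝ → ℝ) (f : ℂ → ℂ) : Prop :=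
  ∀ M : ℝ, ∃ K : ℝ, 0 ≤ K ∧ ∀ z ∈ cone M, ‖f z‖ ≤ K * w ‖z‖

/-- The weight `r/(1+r)²`. -/
def bump (r : ℝ) : ℝ := r / (1 + r) ^ 2

/-- The weight `r/(1+r)`. -/
def ramp (r : ℝ) : ℝ := r / (1 + r)

lemma ConeBounded.add {w : ℝ → ℝ} {f g : ℂ → ℂ} (hf : ConeBounded w f) (hg : ConeBounded w g) :
    ConeBounded w (fun z => f z + g z) := by
  intro M
  obtain ⟨K, hK, h⟩ := hf M
  obtain ⟨K', hK', h'⟩ := hg M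
  refine ⟨K + K', by positivity, fun z hz => (norm_add_le _ _).trans ?_⟩
  linarith [h z hz, h' z hz]

lemma ConeBounded.mul {w w' w'' : ℝ → ℝ} {f g : ℂ → ℂ} (hf : ConeBounded w f)
    (hg : ConeBounded w' g) (hw : ∀ r, 0 ≤ r → w r * w' r = w'' r) :
    ConeBounded w'' (fun z => f z * g z) := by
  intro M
  obtain ⟨K, hK, h⟩ := hf M
  obtain ⟨K', hK', h'⟩ := hg M
  refine ⟨K * K', by positivity, fun z hz => ?_⟩
  rw [norm_mul, ← hw _ (norm_nonneg z), mul_mul_mul_comm]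
  exact mul_le_mul (h z hz) (h' z hz) (norm_nonneg _) ((norm_nonneg _).trans (h z hz))

lemma ConeBounded.const_mul {w : ℝ → ℝ} {f : ℂ → ℂ} (c : ℂ) (hf : ConeBounded w f) :
    ConeBounded w (fun z => c * f z) := by
  intro M
  obtain ⟨K, hK, h⟩ := hf M
  refine ⟨‖c‖ * K, by positivity, fun z hz => ?_⟩
  rw [norm_mul, mul_assoc]
  exact mul_le_mul_of_nonneg_left (h z hz) (norm_nonneg _)

lemma ConeBounded.mono {w w' : ℝ → ℝ} {f : ℂ → ℂ} (hf : ConeBounded w f)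
    (hw : ∀ r, 0 ≤ r → w r ≤ w' r) : ConeBounded w' f := by
  intro M
  obtain ⟨K, hK, h⟩ := hf M
  exact ⟨K, hK, fun z hz => (h z hz).trans
    (mul_le_mul_of_nonneg_left (hw _ (norm_nonneg z)) hK)⟩

lemma coneBounded_const (c : ℂ) : ConeBounded (fun _ => 1) (fun _ => c) :=
  fun _ => ⟨‖c‖, norm_nonneg _, by simp⟩

/-- Cauchy's estimate on cones. -/
lemma norm_mul_deriv_le {f : ℂ → ℂ} (hf : DifferentiableOn ℂ f {z | 0 < z.re}) {M C : ℝ} {z : ℂ}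
    (hz : z ∈ cone M)
    (hC : ∀ w ∈ cone (4 * M), ‖z‖ / 2 ≤ ‖w‖ → ‖w‖ ≤ 2 * ‖z‖ → ‖f w‖ ≤ C) :
    ‖z * deriv f z‖ ≤ 2 * M * C := by
  have hM := one_le_of_mem_cone hz
  have hn : 0 < ‖z‖ := norm_pos_iff.2 (ne_zero_of_re_pos hz.1)
  -- As Re z ≥ |z|/M = 2r, the disc keeps Re w ≥ r, while |w| ≤ (2M + 1)r ≤ 4Mr; hence it lies in
  -- the cone of aperture 4M.
  set r := ‖z‖ / (2 * M) with hr
  have hrpos : 0 < r := by positivity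
  have hrM : r * (2 * M) = ‖z‖ := by rw [hr]; field_simp
  have hr2 : r ≤ ‖z‖ / 2 := by nlinarith
  have key : ∀ w ∈ Metric.closedBall z r, w ∈ cone (4 * M) ∧ ‖z‖ / 2 ≤ ‖w‖ ∧ ‖w‖ ≤ 2 * ‖z‖ := by
    intro w hw
    rw [Metric.mem_closedBall, dist_eq_norm] at hw
    have h1 : z.re - w.re ≤ r := by
      have := Complex.re_le_norm (z - w)
      rw [norm_sub_rev] at this
      simp at this; linarith
    have h2 : ‖z‖ - ‖w‖ ≤ r := by
      have := norm_sub_norm_le z w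
      rw [norm_sub_rev] at this; linarith
    have h3 : ‖w‖ - ‖z‖ ≤ r := (norm_sub_norm_le w z).trans hw
    have h4 := hz.2
    have h5 : r ≤ w.re := by nlinarith
    refine ⟨⟨by linarith, ?_⟩, by linarith, by linarith⟩
    nlinarith
  have hd : DiffContOnCl ℂ f (Metric.ball z r) := by
    apply DifferentiableOn.diffContOnCl
    rw [closure_ball _ hrpos.ne']
    exact hf.mono fun w hw => (key w hw).1.1
  have := Complex.norm_deriv_le_of_forall_mem_sphere_norm_le hrpos hd (C := C) fun w hw => by
    have h := key w (Metric.sphere_subset_closedBall hw)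
    exact hC w h.1 h.2.1 h.2.2
  rw [norm_mul]
  calc ‖z‖ * ‖deriv f z‖ ≤ ‖z‖ * (C / r) := mul_le_mul_of_nonneg_left this hn.le
    _ = 2 * M * C := by rw [← hrM]; field_simp

lemma bump_nonneg {r : ℝ} (hr : 0 ≤ r) : 0 ≤ bump r := by unfold bump; positivity

lemma bump_le_of_le {r s : ℝ} (hr : 0 ≤ r) (h1 : r / 2 ≤ s) (h2 : s ≤ 2 * r) :
    bump s ≤ 8 * bump r := by
  have hs : 0 ≤ s := by linarith
  unfold bump
  rw [mul_div_assoc', div_le_div_iff₀ (by positivity) (by positivity)]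
  have h3 : (1 + r) ^ 2 ≤ 4 * (1 + s) ^ 2 := by nlinarith
  calc s * (1 + r) ^ 2 ≤ (2 * r) * (4 * (1 + s) ^ 2) :=
        mul_le_mul h2 h3 (by positivity) (by positivity)
    _ = _ := by ring

/-- Holomorphic on the right half-plane and `O(r/(1+r)²)` on cones. -/
structure HolDecay (g : ℂ → ℂ) : Prop where
  diff : DifferentiableOn ℂ g {z | 0 < z.re}
  bound : ConeBounded bump g

/-- Cauchy's estimate costs only a wider cone, and the bound is assumed on all cones; so the class
is closed under θ and the recursion can be iterated. -/
lemma HolDecay.theta {g : ℂ → ℂ} (hg : HolDecay g) : HolDecay (fun z => z * deriv g z) := by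
  refine ⟨differentiableOn_id.mul (hg.diff.deriv isOpen_re_pos), fun M => ?_⟩
  obtain ⟨K, hK, h⟩ := hg.bound (4 * M)
  refine ⟨2 * |M| * (K * 8), by positivity, fun z hz => ?_⟩
  have hM := one_le_of_mem_cone hz
  rw [abs_of_nonneg (by linarith), mul_assoc]
  refine (norm_mul_deriv_le (C := K * (8 * bump ‖z‖)) hg.diff hz fun w hw h1 h2 => ?_).trans ?_
  · exact (h w hw).trans (mul_le_mul_of_nonneg_left (bump_le_of_le (norm_nonneg _) h1 h2) hK)
  · apply le_of_eq; ring

lemma HolDecay.add {f g : ℂ → ℂ} (hf : HolDecay f) (hg : HolDecay g) :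
    HolDecay (fun z => f z + g z) := ⟨hf.diff.add hg.diff, hf.bound.add hg.bound⟩

/-! ### Primitives with respect to dz/z along rays. -/

lemma hasDerivAt_ray {f : ℂ → ℂ} {f' : ℂ} {z : ℂ} {u : ℝ} (hf : HasDerivAt f f' (u * z)) :
    HasDerivAt (fun u : ℝ => f (u * z)) (f' * z) u := by
  have h : HasDerivAt (fun u : ℂ => u * z) z (u : ℂ) := by
    simpa using (hasDerivAt_id (u : ℂ)).mul_const z
  exact (HasDerivAt.comp (h₂ := f) (u : ℂ) hf h).comp_ofReal

/-- This is the majorant of g(uz)/u on a ray when g = O(r/(1+r)²). -/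
lemma integrableOn_one_add_mul_inv_sq {c r : ℝ} (hr : 0 < r) :
    MeasureTheory.IntegrableOn (fun u : ℝ => c / (1 + u * r) ^ 2) (Ioi 1) ∧
      ∫ u in Ioi (1 : ℝ), c / (1 + u * r) ^ 2 = c / (r * (1 + r)) := by
  have hderiv : ∀ u ∈ Ici (1 : ℝ),
      HasDerivAt (fun u : ℝ => -(c / r) * (1 + u * r)⁻¹) (c / (1 + u * r) ^ 2) u := by
    intro u hu
    have hu : 1 ≤ u := hu
    have h1 : HasDerivAt (fun u : ℝ => 1 + u * r) r u := by
      simpa using ((hasDerivAt_id u).mul_const r).const_add 1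
    have hne : 1 + u * r ≠ 0 := by positivity
    refine ((h1.inv hne).const_mul (-(c / r))).congr_deriv ?_
    field_simp
  have hlim : Tendsto (fun u : ℝ => -(c / r) * (1 + u * r)⁻¹) atTop (𝓝 (-(c / r) * 0)) := by
    apply Tendsto.const_mul
    apply tendsto_inv_atTop_zero.comp
    exact tendsto_atTop_add_const_left _ _ (tendsto_id.atTop_mul_const hr)
  have hint : MeasureTheory.IntegrableOn (fun u : ℝ => c / (1 + u * r) ^ 2) (Ioi 1) := by
    have h1 : MeasureTheory.IntegrableOn (fun u : ℝ => 1 / (1 + u * r) ^ 2) (Ioi 1) := by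
      have hlim' : Tendsto (fun u : ℝ => -(1 / r) * (1 + u * r)⁻¹) atTop (𝓝 (-(1 / r) * 0)) := by
        apply Tendsto.const_mul
        apply tendsto_inv_atTop_zero.comp
        exact tendsto_atTop_add_const_left _ _ (tendsto_id.atTop_mul_const hr)
      refine MeasureTheory.integrableOn_Ioi_deriv_of_nonneg' (g := fun u : ℝ =>
        -(1 / r) * (1 + u * r)⁻¹) (fun u hu => ?_) (fun u hu => by positivity) hlim'
      have hu : 1 ≤ u := hu
      have h1 : HasDerivAt (fun u : ℝ => 1 + u * r) r u := by
        simpa using ((hasDerivAt_id u).mul_const r).const_add 1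
      have hne : 1 + u * r ≠ 0 := by positivity
      refine ((h1.inv hne).const_mul (-(1 / r))).congr_deriv ?_
      field_simp
    have := h1.const_mul c
    simp only [mul_one_div] at this
    exact this
  refine ⟨hint, ?_⟩
  rw [MeasureTheory.integral_Ioi_of_hasDerivAt_of_tendsto' hderiv hint hlim]
  field_simp
  ring

/-- The primitive with respect to `dz/z` with a prescribed limit at infinity. -/
lemma HolDecay.exists_primitive {g : ℂ → ℂ} (hg : HolDecay g) (d : ℂ) :
    ∃ f : ℂ → ℂ, (∀ z : ℂ, 0 < z.re → HasDerivAt f (g z / z) z) ∧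
      ConeBounded (fun _ => 1) f ∧
      ∀ z : ℂ, 0 < z.re → Tendsto (fun u : ℝ => f (u * z)) atTop (𝓝 d) := by
  -- The primitive is d − P: P integrates from z out to infinity along the ray, and its bound
  -- K/(1+|z|) gives both boundedness and the limit d.
  set P : ℂ → ℂ := fun z => ∫ u in Ioi (1 : ℝ), g (u * z) / u with hP
  have hmem : ∀ {M : ℝ} {z : ℂ} {u : ℝ}, z ∈ cone M → u ∈ Ici (1 : ℝ) → (u : ℂ) * z ∈ cone M :=
    fun hz hu => smul_mem_cone hz (zero_lt_one.trans_le hu)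
  have hnorm : ∀ {z : ℂ} {u : ℝ}, u ∈ Ici (1 : ℝ) → ‖(u : ℂ) * z‖ = u * ‖z‖ := by
    intro z u hu
    rw [norm_mul, Complex.norm_real, Real.norm_of_nonneg (zero_le_one.trans hu)]
  -- pointwise bound of the integrand
  have hb : ∀ M : ℝ, ∃ K, 0 ≤ K ∧ ∀ z ∈ cone M, ∀ u ∈ Ici (1 : ℝ),
      ‖g (u * z) / u‖ ≤ K * ‖z‖ / (1 + u * ‖z‖) ^ 2 := by
    intro M
    obtain ⟨K, hK, h⟩ := hg.bound M
    refine ⟨K, hK, fun z hz u hu => ?_⟩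
    have hu0 : 0 < u := zero_lt_one.trans_le hu
    have := h _ (hmem hz hu)
    rw [hnorm hu, bump] at this
    rw [norm_div, Complex.norm_real, Real.norm_of_nonneg hu0.le, div_le_iff₀ hu0]
    refine this.trans (le_of_eq ?_)
    ring
  have hcont : ∀ z : ℂ, 0 < z.re → ContinuousOn (fun u : ℝ => g (u * z) / u) (Ioi 1) := by
    intro z hz
    apply ContinuousOn.div
    · apply hg.diff.continuousOn.comp (by fun_prop)
      intro u hu
      have hu : 1 < u := hu
      simp only [mem_ofPred_eq, Complex.mul_re, Complex.ofReal_re, Complex.ofReal_im, zero_mul,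
        sub_zero]
      positivity
    · fun_prop
    · intro u hu
      have hu : 1 < u := hu
      exact_mod_cast (by linarith : u ≠ 0)
  have hPb : ∀ M : ℝ, ∃ K, 0 ≤ K ∧ ∀ z ∈ cone M, ‖P z‖ ≤ K / (1 + ‖z‖) := by
    intro M
    obtain ⟨K, hK, h⟩ := hb M
    refine ⟨K, hK, fun z hz => ?_⟩
    have hn : 0 < ‖z‖ := norm_pos_iff.2 (ne_zero_of_re_pos hz.1)
    obtain ⟨h1, h2⟩ := integrableOn_one_add_mul_inv_sq (c := K * ‖z‖) hn
    refine (MeasureTheory.norm_integral_le_of_norm_le h1 ?_).trans (le_of_eq ?_)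
    · exact (MeasureTheory.ae_restrict_iff' measurableSet_Ioi).2
        (Eventually.of_forall fun u hu => h z hz u (mem_Ici.2 (le_of_lt hu)))
    · rw [h2]; field_simp
  have hder : ∀ z : ℂ, 0 < z.re → HasDerivAt P (-(g z / z)) z := by
    intro z hz
    obtain ⟨K', hK', h'⟩ := hg.theta.bound (4 * (‖z‖ / z.re))
    obtain ⟨K, hK, h⟩ := hb (‖z‖ / z.re)
    have hzc := mem_cone_self hz
    have hM := one_le_of_mem_cone hzc
    have hz0 := ne_zero_of_re_pos hz
    have hn : 0 < ‖z‖ := norm_pos_iff.2 hz0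
    -- On this neighbourhood of z the bound for θg holds with one constant and |w| ≥ |z|/2, which
    -- yields a majorant of g'(uw) independent of w.
    set s : Set ℂ := {w | w ∈ cone (4 * (‖z‖ / z.re)) ∧ ‖z‖ / 2 ≤ ‖w‖} with hs
    have hsn : s ∈ 𝓝 z := by
      have h1 : ∀ᶠ w : ℂ in 𝓝 z, 0 < w.re := isOpen_re_pos.mem_nhds hz
      have h2 : ∀ᶠ w : ℂ in 𝓝 z, ‖z‖ / 2 < ‖w‖ :=
        continuous_norm.continuousAt.eventually_const_lt (by linarith)
      have h3 : ∀ᶠ w : ℂ in 𝓝 z, ‖w‖ < 4 * (‖z‖ / z.re) * w.re := by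
        apply ContinuousAt.eventually_lt (by fun_prop) (by fun_prop)
        field_simp; linarith
      filter_upwards [h1, h2, h3] with w h1 h2 h3
      exact ⟨⟨h1, h3.le⟩, h2.le⟩
    have hz2 : 0 < ‖z‖ / 2 := by linarith
    have hdd : ∀ w ∈ s, ∀ u ∈ Ioi (1 : ℝ),
        HasDerivAt (fun w => g (u * w) / u) (deriv g (u * w)) w := by
      intro w hw u hu
      have hu : 1 < u := hu
      have huc : (u : ℂ) ≠ 0 := by exact_mod_cast (by linarith : u ≠ 0)
      have h1 : HasDerivAt (fun w : ℂ => (u : ℂ) * w) u w := by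
        simpa using (hasDerivAt_id w).const_mul (u : ℂ)
      have h2 : HasDerivAt g (deriv g (u * w)) (u * w) :=
        (hg.diff.differentiableAt
          (isOpen_re_pos.mem_nhds (hmem hw.1 hu.le).1)).hasDerivAt
      refine ((HasDerivAt.comp (h₂ := g) w h2 h1).div_const (u : ℂ)).congr_deriv ?_
      field_simp
    have hbound : ∀ w ∈ s, ∀ u ∈ Ioi (1 : ℝ),
        ‖deriv g (u * w)‖ ≤ K' / (1 + u * (‖z‖ / 2)) ^ 2 := by
      intro w hw u hu
      have hu : 1 < u := hu
      have h1 := h' _ (hmem hw.1 hu.le)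
      have hwn : 0 < ‖w‖ := by linarith [hw.2]
      rw [norm_mul, hnorm hu.le, bump, ← mul_div_assoc, mul_comm K', mul_div_assoc] at h1
      have h2 := le_of_mul_le_mul_left h1 (by positivity)
      refine h2.trans (div_le_div_of_nonneg_left hK' (by positivity) ?_)
      have := mul_le_mul_of_nonneg_left hw.2 (zero_le_one.trans hu.le)
      gcongr
    have hmeas : ∀ w : ℂ, 0 < w.re → MeasureTheory.AEStronglyMeasurable
        (fun u : ℝ => g (u * w) / u) (MeasureTheory.volume.restrict (Ioi 1)) :=
      fun w hw => (hcont w hw).aestronglyMeasurable measurableSet_Ioi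
    have hdcont : ContinuousOn (fun u : ℝ => deriv g (u * z)) (Ioi 1) := by
      apply (hg.diff.deriv isOpen_re_pos).continuousOn.comp (by fun_prop)
      intro u hu
      exact (hmem hzc (mem_Ici.2 (le_of_lt hu))).1
    have hint : MeasureTheory.IntegrableOn (fun u : ℝ => g (u * z) / u) (Ioi 1) := by
      refine (integrableOn_one_add_mul_inv_sq (c := K * ‖z‖) hn).1.mono' (hmeas z hz) ?_
      exact (MeasureTheory.ae_restrict_iff' measurableSet_Ioi).2
        (Eventually.of_forall fun u hu => h z hzc u (mem_Ici.2 (le_of_lt hu)))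
    have main := hasDerivAt_integral_of_dominated_loc_of_deriv_le
      (μ := MeasureTheory.volume.restrict (Ioi (1 : ℝ))) (F := fun w (u : ℝ) => g (u * w) / u)
      (F' := fun w (u : ℝ) => deriv g (u * w)) (x₀ := z)
      (bound := fun u => K' / (1 + u * (‖z‖ / 2)) ^ 2) hsn
      (by filter_upwards [hsn] with w hw using hmeas w hw.1.1) hint
      (hdcont.aestronglyMeasurable measurableSet_Ioi)
      ((MeasureTheory.ae_restrict_iff' measurableSet_Ioi).2
        (Eventually.of_forall fun u hu w hw => hbound w hw u hu))
      (integrableOn_one_add_mul_inv_sq hz2).1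
      ((MeasureTheory.ae_restrict_iff' measurableSet_Ioi).2
        (Eventually.of_forall fun u hu w hw => hdd w hw u hu))
    -- The derivative ∫₁^∞ g'(uz) du is evaluated with the primitive u ↦ g(uz)/z, which vanishes at
    -- infinity.
    refine main.2.congr_deriv ?_
    have hlim : Tendsto (fun u : ℝ => g (u * z) / z) atTop (𝓝 0) := by
      obtain ⟨K₂, hK₂, h₂⟩ := hg.bound (‖z‖ / z.re)
      have h0 : Tendsto (fun u : ℝ => K₂ / ‖z‖ * (1 + u * ‖z‖)⁻¹) atTop (𝓝 (K₂ / ‖z‖ * 0)) := by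
        apply Tendsto.const_mul
        apply tendsto_inv_atTop_zero.comp
        exact tendsto_atTop_add_const_left _ _ (tendsto_id.atTop_mul_const hn)
      rw [mul_zero] at h0
      refine squeeze_zero_norm' ?_ h0
      filter_upwards [eventually_ge_atTop 1] with u hu
      have := h₂ _ (hmem hzc hu)
      rw [hnorm hu, bump] at this
      rw [norm_div, div_le_iff₀ hn]
      refine this.trans ?_
      have hu0 : 0 ≤ u * ‖z‖ := by positivity
      calc K₂ * (u * ‖z‖ / (1 + u * ‖z‖) ^ 2) ≤ K₂ * (1 / (1 + u * ‖z‖)) := by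
            apply mul_le_mul_of_nonneg_left _ hK₂
            rw [div_le_div_iff₀ (by positivity) (by positivity)]
            nlinarith
        _ = _ := by field_simp
    have hI := MeasureTheory.integral_Ioi_of_hasDerivAt_of_tendsto' (a := 1)
      (f := fun u : ℝ => g (u * z) / z) (f' := fun u : ℝ => deriv g (u * z)) (fun u hu => ?_)
      main.1 hlim
    · rw [hI]; simp
    · have h2 : HasDerivAt g (deriv g (u * z)) (u * z) :=
        (hg.diff.differentiableAt (isOpen_re_pos.mem_nhds (hmem hzc hu).1)).hasDerivAt
      refine ((hasDerivAt_ray h2).div_const z).congr_deriv ?_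
      field_simp
  refine ⟨fun z => d - P z, fun z hz => ?_, ?_, fun z hz => ?_⟩
  · simpa using (hder z hz).const_sub d
  · intro M
    obtain ⟨K, hK, h⟩ := hPb M
    refine ⟨‖d‖ + K, by positivity, fun z hz => (norm_sub_le _ _).trans ?_⟩
    have : K / (1 + ‖z‖) ≤ K := div_le_self hK (by linarith [norm_nonneg z])
    linarith [h z hz]
  · obtain ⟨K, hK, h⟩ := hPb (‖z‖ / z.re)
    have hn : 0 < ‖z‖ := norm_pos_iff.2 (ne_zero_of_re_pos hz)
    have h0 : Tendsto (fun u : ℝ => K * (1 + u * ‖z‖)⁻¹) atTop (𝓝 (K * 0)) := by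
      apply Tendsto.const_mul
      apply tendsto_inv_atTop_zero.comp
      exact tendsto_atTop_add_const_left _ _ (tendsto_id.atTop_mul_const hn)
    rw [mul_zero] at h0
    have h1 : Tendsto (fun u : ℝ => P (u * z)) atTop (𝓝 0) := by
      refine squeeze_zero_norm' ?_ h0
      filter_upwards [eventually_ge_atTop 1] with u hu
      have := h _ (hmem (mem_cone_self hz) hu)
      rwa [hnorm hu, div_eq_mul_inv] at this
    simpa using h1.const_sub d

/-- A primitive on a convex domain is fixed by its limit along one ray. This identifies the
abstractly constructed first coefficient with the explicit formula. -/
lemma eq_of_hasDerivAt_of_tendsto {f₁ f₂ g : ℂ → ℂ} {d : ℂ}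
    (h₁ : ∀ z : ℂ, 0 < z.re → HasDerivAt f₁ (g z) z)
    (h₂ : ∀ z : ℂ, 0 < z.re → HasDerivAt f₂ (g z) z)
    (l₁ : ∀ z : ℂ, 0 < z.re → Tendsto (fun u : ℝ => f₁ (u * z)) atTop (𝓝 d))
    (l₂ : ∀ z : ℂ, 0 < z.re → Tendsto (fun u : ℝ => f₂ (u * z)) atTop (𝓝 d))
    {z : ℂ} (hz : 0 < z.re) : f₁ z = f₂ z := by
  have hpre : Convex ℝ {z : ℂ | 0 < z.re} := convex_halfSpace_re_gt 0
  have hconst : ∀ w ∈ {z : ℂ | 0 < z.re}, f₁ w - f₂ w = f₁ z - f₂ z := by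
    intro w hw
    refine hpre.is_const_of_fderivWithin_eq_zero (𝕜 := ℂ) (f := fun w => f₁ w - f₂ w) ?_ ?_ hw hz
    · intro v hv
      exact ((h₁ v hv).sub (h₂ v hv)).differentiableAt.differentiableWithinAt
    · intro v hv
      have := ((h₁ v hv).sub (h₂ v hv))
      rw [sub_self] at this
      rw [fderivWithin_of_isOpen isOpen_re_pos hv]
      have h3 := this.hasFDerivAt.fderiv
      have h4 : fderiv ℂ (fun w => f₁ w - f₂ w) v = fderiv ℂ (f₁ - f₂) v := rfl
      rw [h4, h3]; ext; simp
  have hl := (l₁ z hz).sub (l₂ z hz)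
  rw [sub_self] at hl
  have : Tendsto (fun _ : ℝ => f₁ z - f₂ z) atTop (𝓝 0) := by
    refine hl.congr' ?_
    filter_upwards [eventually_gt_atTop 0] with u hu
    exact hconst _ (by simpa using mul_pos hu hz)
  exact sub_eq_zero.1 (tendsto_nhds_unique tendsto_const_nhds this)

/-! ### Behaviour at infinity in cones -/

/-- Tending to infinity inside the cone `|z| ≤ M · Re z`. -/
def coneAt (M : ℝ) : Filter ℂ := Bornology.cobounded ℂ ⊓ 𝓟 (cone M)

lemma eventually_mem_cone (M : ℝ) : ∀ᶠ z in coneAt M, z ∈ cone M :=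
  mem_inf_of_right (mem_principal_self _)

lemma tendsto_norm_coneAt (M : ℝ) : Tendsto (fun z : ℂ => ‖z‖) (coneAt M) atTop :=
  tendsto_norm_cobounded_atTop.mono_left inf_le_left

lemma tendsto_re_coneAt (M : ℝ) : Tendsto (fun z : ℂ => z.re) (coneAt M) atTop := by
  by_cases hM : 0 < M
  · refine tendsto_atTop_mono' _ ?_ ((tendsto_norm_coneAt M).atTop_div_const hM)
    filter_upwards [eventually_mem_cone M] with z hz
    rw [div_le_iff₀ hM, mul_comm]; exact hz.2
  · have : cone M = ∅ := by
      ext z; simp only [mem_empty_iff_false, iff_false]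
      intro hz; linarith [one_le_of_mem_cone hz]
    simp [coneAt, this]

lemma tendsto_ray {M : ℝ} {z : ℂ} (hz : z ∈ cone M) :
    Tendsto (fun u : ℝ => (u : ℂ) * z) atTop (coneAt M) := by
  refine tendsto_inf.2 ⟨?_, tendsto_principal.2 ?_⟩
  · rw [← tendsto_norm_atTop_iff_cobounded]
    have hn : 0 < ‖z‖ := norm_pos_iff.2 (ne_zero_of_re_pos hz.1)
    refine (tendsto_id.atTop_mul_const hn).congr' ?_
    filter_upwards [eventually_ge_atTop 0] with u hu
    rw [norm_mul, Complex.norm_real, Real.norm_of_nonneg hu]; rfl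
  · filter_upwards [eventually_gt_atTop 0] with u hu using smul_mem_cone hz hu

lemma tendsto_tZ (M : ℝ) : Tendsto tZ (coneAt M) (𝓝 0) := by
  have h : Tendsto (fun z : ℂ => 3 * M * (1 / (1 + ‖z‖))) (coneAt M) (𝓝 (3 * M * 0)) := by
    apply Tendsto.const_mul
    simp only [one_div]
    exact tendsto_inv_atTop_zero.comp (tendsto_atTop_add_const_left _ _ (tendsto_norm_coneAt M))
  rw [mul_zero] at h
  refine squeeze_zero_norm' ?_ h
  filter_upwards [eventually_mem_cone M] with z hz using norm_tZ_le hz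

lemma rootZ_sub_mul (z : ℂ) : (rootZ z - z) * (rootZ z + z) = 1 := by
  linear_combination rootZ_sq z

lemma tendsto_rootZ_sub (M : ℝ) : Tendsto (fun z => rootZ z - z) (coneAt M) (𝓝 0) := by
  refine squeeze_zero_norm' ?_ (tendsto_inv_atTop_zero.comp (tendsto_re_coneAt M))
  filter_upwards [eventually_mem_cone M] with z hz
  have h1 : z.re ≤ ‖rootZ z + z‖ := by
    have := Complex.re_le_norm (rootZ z + z)
    simp only [Complex.add_re] at this
    linarith [rootZ_re_pos hz.1]
  have h2 : ‖rootZ z - z‖ * ‖rootZ z + z‖ = 1 := by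
    rw [← norm_mul, rootZ_sub_mul, norm_one]
  simp only [Function.comp]
  rw [← one_div, le_div_iff₀ hz.1, ← h2]
  exact mul_le_mul_of_nonneg_left h1 (norm_nonneg _)

lemma tendsto_betaZ (M : ℝ) : Tendsto betaZ (coneAt M) (𝓝 1) := by
  have h := ((tendsto_rootZ_sub M).mul (tendsto_tZ M)).const_sub 1
  simp only [mul_zero, sub_zero] at h
  refine h.congr' ?_
  filter_upwards [eventually_mem_cone M] with z hz
  have := rootZ_ne_zero hz.1
  rw [betaZ, tZ]; field_simp; ring

/-! ### The amplitude equation and its formal solution -/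

/-- The coefficient `s` in `θ²A + (2νσR + s)θA + qA = 0`. -/
def sZ (σ μ z : ℂ) : ℂ := -betaZ z ^ 2 + σ * μ * (tZ z - betaZ z)

/-- The coefficient `q` in `θ²A + (2νσR + s)θA + qA = 0`. -/
def qZ (σ μ z : ℂ) : ℂ :=
  betaZ z * ((-2 * betaZ z * tZ z ^ 2 - σ * μ * (tZ z * betaZ z + tZ z ^ 2)) / 2
    + (betaZ z ^ 3 - 2 * σ * μ * betaZ z * (tZ z - betaZ z) - 2 * μ ^ 2 * tZ z) / 4)

lemma differentiableOn_tZ : DifferentiableOn ℂ tZ {z | 0 < z.re} := fun _ hz =>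
  (hasDerivAt_tZ hz).differentiableAt.differentiableWithinAt

lemma differentiableOn_betaZ : DifferentiableOn ℂ betaZ {z | 0 < z.re} := fun _ hz =>
  (hasDerivAt_betaZ hz).differentiableAt.differentiableWithinAt

lemma coneBounded_tZ : ConeBounded (fun r => 1 / (1 + r)) tZ := fun M =>
  ⟨3 * |M|, by positivity, fun z hz => by
    rw [abs_of_nonneg (by linarith [one_le_of_mem_cone hz])]; exact norm_tZ_le hz⟩

lemma coneBounded_betaZ : ConeBounded ramp betaZ := fun M =>
  ⟨3 * |M|, by positivity, fun z hz => by
    rw [abs_of_nonneg (by linarith [one_le_of_mem_cone hz])]; exact norm_betaZ_le hz⟩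

lemma coneBounded_one_of_tZ : ConeBounded (fun _ => 1) tZ :=
  coneBounded_tZ.mono fun r hr => by
    rw [div_le_one (by positivity)]; linarith

lemma ramp_le_one {r : ℝ} (hr : 0 ≤ r) : ramp r ≤ 1 := by
  rw [ramp, div_le_one (by positivity)]; linarith

lemma coneBounded_one_of_betaZ : ConeBounded (fun _ => 1) betaZ :=
  coneBounded_betaZ.mono fun _ hr => ramp_le_one hr

lemma ConeBounded.mul_one {w : ℝ → ℝ} {f g : ℂ → ℂ} (hf : ConeBounded w f)
    (hg : ConeBounded (fun _ => 1) g) : ConeBounded w (fun z => f z * g z) :=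
  hf.mul hg fun _ _ => _root_.mul_one _

lemma coneBounded_sZ (σ μ : ℂ) : ConeBounded (fun _ => 1) (sZ σ μ) := by
  have hb := coneBounded_one_of_betaZ
  have ht := coneBounded_one_of_tZ
  have h := ((hb.mul_one hb).const_mul (-1)).add ((ht.add (hb.const_mul (-1))).const_mul (σ * μ))
  convert h using 2 with z
  simp only [sZ]; ring

/-- The factor β = z/R in front of q gives the vanishing at 0; without it the primitive with respect
to dz/z would be unbounded there. -/
lemma coneBounded_qZ (σ μ : ℂ) : ConeBounded ramp (qZ σ μ) := by
  have hb := coneBounded_one_of_betaZ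
  have ht := coneBounded_one_of_tZ
  have h1 := ((hb.mul_one (ht.mul_one ht)).const_mul (-1)).add
    (((ht.mul_one hb).add (ht.mul_one ht)).const_mul (-(σ * μ) / 2))
  have h2 := (((hb.mul_one (hb.mul_one hb)).const_mul (1 / 4)).add
    ((hb.mul_one (ht.add (hb.const_mul (-1)))).const_mul (-(σ * μ) / 2))).add
    (ht.const_mul (-(μ ^ 2) / 2))
  convert coneBounded_betaZ.mul_one (h1.add h2) using 2 with z
  simp only [qZ]; ring

lemma differentiableOn_sZ (σ μ : ℂ) : DifferentiableOn ℂ (sZ σ μ) {z | 0 < z.re} := by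
  have := differentiableOn_tZ
  have := differentiableOn_betaZ
  unfold sZ; fun_prop

lemma differentiableOn_qZ (σ μ : ℂ) : DifferentiableOn ℂ (qZ σ μ) {z | 0 < z.re} := by
  have := differentiableOn_tZ
  have := differentiableOn_betaZ
  unfold qZ; fun_prop

/-- The candidate for the coefficient of `1/ν`. -/
def firstCoeff (σ μ z : ℂ) : ℂ :=
  -σ * (tZ z * (5 * tZ z ^ 2 - 3) / 24) + μ * (tZ z * betaZ z - tZ z ^ 2) / 4
    + μ ^ 2 * (σ * betaZ z - 1) / 4

/-- This is the recursion at k = 0: with a₀ = 1 and g₀ = 0 only the term in q survives. The check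
reduces to t² + β² = 1 and σ² = 1. -/
lemma hasDerivAt_firstCoeff {σ : ℂ} (hσ : σ ^ 2 = 1) (μ : ℂ) {z : ℂ} (hz : 0 < z.re) :
    HasDerivAt (firstCoeff σ μ) (-(σ / 2) * (tZ z * qZ σ μ z) / z) z := by
  have ht := hasDerivAt_tZ hz
  have hb := hasDerivAt_betaZ hz
  have h := (((ht.mul (((ht.pow 2).const_mul 5).sub_const 3)).div_const 24).const_mul (-σ)).add
    ((((ht.mul hb).sub (ht.pow 2)).const_mul μ).div_const 4) |>.add
    ((((hb.const_mul σ).sub_const 1).const_mul (μ ^ 2)).div_const 4)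
  refine HasDerivAt.congr_deriv (f := firstCoeff σ μ) h ?_
  have h1 := tZ_sq_add hz
  have hz0 := ne_zero_of_re_pos hz
  simp only [qZ]
  simp only [Pi.pow_apply, Nat.cast_ofNat, Nat.add_one_sub_one, pow_one]
  linear_combination (σ * tZ z * betaZ z ^ 2 / 8 / z) * h1 -
    (μ / 4 * (2 * tZ z ^ 2 * betaZ z ^ 2 + tZ z ^ 3 * betaZ z - tZ z * betaZ z ^ 3) / z) * hσ

/-- A formal solution of the amplitude equation: `a k` are the coefficients, `g k = θ(a k)`. -/
structure FormalSolution (σ μ : ℂ) (d : ℕ → ℂ) (a g : ℕ → ℂ → ℂ) : Prop where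
  zero : ∀ z, a 0 z = 1
  zero' : ∀ z, g 0 z = 0
  decay : ∀ k, HolDecay (g k)
  deriv : ∀ k z, 0 < z.re → HasDerivAt (a k) (g k z / z) z
  bound : ∀ k, ConeBounded (fun _ => 1) (a k)
  lim : ∀ k z, 0 < z.re → Tendsto (fun u : ℝ => a k (u * z)) atTop (𝓝 (d k))
  step : ∀ k z, 0 < z.re →
    g (k + 1) z = -(σ / 2) * (tZ z * (z * _root_.deriv (g k) z + sZ σ μ z * g k z
      + qZ σ μ z * a k z))

lemma HolDecay.mul_bounded {g h : ℂ → ℂ} (hg : HolDecay g)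
    (hh : DifferentiableOn ℂ h {z | 0 < z.re}) (hb : ConeBounded (fun _ => 1) h) :
    HolDecay (fun z => g z * h z) := ⟨hg.diff.mul hh, hg.bound.mul_one hb⟩

/-- The term tq is O(r/(1+r)²) because q = O(r/(1+r)) and t = O(1/(1+r)); the other two terms
inherit the decay of g and θg. -/
lemma HolDecay.step {a g : ℂ → ℂ} (σ μ : ℂ) (hg : HolDecay g)
    (ha : ∀ z : ℂ, 0 < z.re → HasDerivAt a (g z / z) z) (hb : ConeBounded (fun _ => 1) a) :
    HolDecay (fun z => -(σ / 2) * (tZ z * (z * _root_.deriv g z + sZ σ μ z * g z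
      + qZ σ μ z * a z))) := by
  have had : DifferentiableOn ℂ a {z | 0 < z.re} := fun z hz =>
    (ha z hz).differentiableAt.differentiableWithinAt
  have h1 := hg.theta.mul_bounded differentiableOn_tZ coneBounded_one_of_tZ
  have h2 := (hg.mul_bounded (differentiableOn_sZ σ μ) (coneBounded_sZ σ μ)).mul_bounded
    differentiableOn_tZ coneBounded_one_of_tZ
  have h3 : HolDecay (fun z => qZ σ μ z * a z * tZ z) :=
    ⟨((differentiableOn_qZ σ μ).mul had).mul differentiableOn_tZ,
      ((coneBounded_qZ σ μ).mul_one hb).mul coneBounded_tZ fun r hr => by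
        unfold ramp bump; field_simp⟩
  have h4 := ((h1.add h2).add h3).mul_bounded (h := fun _ => -(σ / 2)) (by fun_prop)
    (coneBounded_const _)
  convert h4 using 2 with z
  ring

/-- The constants of integration are free, so the limits d_k may be prescribed. The condition on d₁
is the value at infinity of `firstCoeff`, where t → 0 and β → 1. -/
lemma exists_formalSolution {σ : ℂ} (hσ : σ ^ 2 = 1) (μ : ℂ) {d : ℕ → ℂ} (h0 : d 0 = 1)
    (h1 : d 1 = μ ^ 2 * (σ - 1) / 4) :
    ∃ a g, FormalSolution σ μ d a g ∧ ∀ z, 0 < z.re → a 1 z = firstCoeff σ μ z := by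
  let Good : (ℂ → ℂ) × (ℂ → ℂ) → Prop := fun p => HolDecay p.2 ∧
    (∀ z : ℂ, 0 < z.re → HasDerivAt p.1 (p.2 z / z) z) ∧ ConeBounded (fun _ => 1) p.1
  have hstep : ∀ (k : ℕ) (p : {p // Good p}), ∃ p' : {p // Good p},
      (∀ z, p'.1.2 z = -(σ / 2) * (tZ z * (z * _root_.deriv p.1.2 z + sZ σ μ z * p.1.2 z
        + qZ σ μ z * p.1.1 z))) ∧
      ∀ z, 0 < z.re → Tendsto (fun u : ℝ => p'.1.1 (u * z)) atTop (𝓝 (d (k + 1))) := by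
    rintro k ⟨⟨a, g⟩, hg, ha, hb⟩
    have hd := hg.step σ μ ha hb
    obtain ⟨f, hf1, hf2, hf3⟩ := hd.exists_primitive (d (k + 1))
    exact ⟨⟨⟨f, _⟩, hd, hf1, hf2⟩, fun z => rfl, hf3⟩
  choose F hF1 hF2 using hstep
  have hinit : Good (fun _ => 1, fun _ => 0) := by
    refine ⟨⟨by fun_prop, fun M => ⟨0, le_rfl, by simp⟩⟩, fun z hz => ?_, coneBounded_const 1⟩
    simpa using hasDerivAt_const z (1 : ℂ)
  let S : ℕ → {p // Good p} := fun k => Nat.rec ⟨_, hinit⟩ F k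
  have hFS : FormalSolution σ μ d (fun k => (S k).1.1) (fun k => (S k).1.2) := by
    refine ⟨fun _ => rfl, fun _ => rfl, fun k => (S k).2.1, fun k => (S k).2.2.1,
      fun k => (S k).2.2.2, fun k => ?_, fun k z _ => hF1 k (S k) z⟩
    cases k with
    | zero => intro z _; rw [h0]; exact tendsto_const_nhds
    | succ k => exact hF2 k (S k)
  refine ⟨_, _, hFS, fun z hz => ?_⟩
  refine eq_of_hasDerivAt_of_tendsto (fun z hz => hFS.deriv 1 z hz)
    (fun z hz => (hasDerivAt_firstCoeff hσ μ hz).congr_deriv ?_) (hFS.lim 1) (fun z hz => ?_) hz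
  · have h := hFS.step 0 z hz
    have h' : ∀ z, (S 0).1.2 z = 0 := fun _ => rfl
    have h'' : _root_.deriv (S 0).1.2 z = 0 := deriv_const z 0
    have h3 : (S 0).1.1 z = 1 := rfl
    simp only [h', h'', h3] at h
    refine Eq.trans ?_ (congrArg (· / z) h.symm)
    ring
  · have hb := (tendsto_betaZ _).comp (tendsto_ray (mem_cone_self hz))
    have ht := (tendsto_tZ _).comp (tendsto_ray (mem_cone_self hz))
    have := (((ht.mul (((ht.pow 2).const_mul 5).sub_const 3)).div_const 24).const_mul (-σ)).add
      ((((ht.mul hb).sub (ht.pow 2)).const_mul μ).div_const 4) |>.add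
      ((((hb.const_mul σ).sub_const 1).const_mul (μ ^ 2)).div_const 4)
    refine (this.congr fun _ => rfl).trans (le_of_eq ?_)
    rw [h1]; congr 1; ring

/-! ### Estimates along rays -/

lemma hasDerivAt_bump {r : ℝ} (hr : 0 < r) :
    HasDerivAt bump (bump r * ((1 - r) / (1 + r)) / r) r := by
  have h1 : HasDerivAt (fun r : ℝ => (1 + r) ^ 2) (2 * (1 + r)) r := by
    simpa using ((hasDerivAt_id r).const_add 1).fun_pow 2
  have h := (hasDerivAt_id r).div h1 (by positivity)
  refine HasDerivAt.congr_deriv (f := bump) h ?_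
  rw [bump]
  simp only [id]
  field_simp
  ring

/-- A solution of `ρy' = -py - f` that is bounded at `0` is controlled by `f/Re p`. -/
lemma norm_le_bump_of_ode {y L p f : ℝ → ℂ} {ρ₁ Φ C : ℝ} (hΦ : 0 ≤ Φ)
    (hy : ∀ ρ ∈ Ioc 0 ρ₁, HasDerivAt y ((-(p ρ * y ρ) - f ρ) / ρ) ρ)
    (hL : ∀ ρ ∈ Ioc 0 ρ₁, HasDerivAt L (p ρ / ρ) ρ)
    (hp : ∀ ρ ∈ Ioc 0 ρ₁, 2 ≤ (p ρ).re)
    (hf : ∀ ρ ∈ Ioc 0 ρ₁, ‖f ρ‖ ≤ Φ * bump ρ * (p ρ).re)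
    (hC : ∀ᶠ ρ in 𝓝[>] 0, ‖y ρ‖ ≤ C) {x : ℝ} (hx : x ∈ Ioc 0 ρ₁) :
    ‖y x‖ ≤ 2 * Φ * bump x := by
  set j : ℝ → ℝ := fun ρ => Real.exp (L ρ).re with hj
  have hjd : ∀ ρ ∈ Ioc 0 ρ₁, HasDerivAt j (j ρ * ((p ρ).re / ρ)) ρ := by
    intro ρ hρ
    have h1 : HasDerivAt (fun ρ => (L ρ).re) (p ρ / ρ).re ρ :=
      Complex.reCLM.hasFDerivAt.comp_hasDerivAt ρ (hL ρ hρ)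
    rw [Complex.div_ofReal_re] at h1
    exact h1.exp
  -- exp L is an integrating factor: it turns the equation into ρ(y e^L)' = −f e^L.
  have hW : ∀ ρ ∈ Ioc 0 ρ₁, HasDerivAt (fun ρ => y ρ * Complex.exp (L ρ))
      (-(f ρ) * Complex.exp (L ρ) / ρ) ρ := by
    intro ρ hρ
    refine ((hy ρ hρ).mul (hL ρ hρ).cexp).congr_deriv ?_
    have : (ρ : ℂ) ≠ 0 := by exact_mod_cast hρ.1.ne'
    field_simp
    ring
  have hnorm : ∀ ρ, ‖Complex.exp (L ρ)‖ = j ρ := fun ρ => Complex.norm_exp _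
  have hjpos : ∀ ρ, 0 < j ρ := fun ρ => Real.exp_pos _
  have key : ∀ a ∈ Ioo 0 x, ‖y x * Complex.exp (L x)‖ ≤
      2 * Φ * (bump x * j x) + ‖y a * Complex.exp (L a)‖ := by
    intro a ha
    have hsub : ∀ ρ ∈ Icc a x, ρ ∈ Ioc 0 ρ₁ := fun ρ hρ =>
      ⟨ha.1.trans_le hρ.1, hρ.2.trans hx.2⟩
    have hB : ∀ ρ ∈ Icc a x, HasDerivAt
        (fun ρ => 2 * Φ * (bump ρ * j ρ) + ‖y a * Complex.exp (L a)‖)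
        (2 * Φ * (bump ρ * j ρ * ((p ρ).re + (1 - ρ) / (1 + ρ)) / ρ)) ρ := by
      intro ρ hρ
      have := (((hasDerivAt_bump (hsub ρ hρ).1).mul (hjd ρ (hsub ρ hρ))).const_mul
        (2 * Φ)).add_const (‖y a * Complex.exp (L a)‖)
      refine this.congr_deriv ?_
      ring
    refine image_norm_le_of_norm_deriv_right_le_deriv_boundary' (a := a) (b := x)
      (f := fun ρ => y ρ * Complex.exp (L ρ))
      (f' := fun ρ => -(f ρ) * Complex.exp (L ρ) / ρ)
      (fun ρ hρ => (hW ρ (hsub ρ hρ)).continuousAt.continuousWithinAt)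
      (fun ρ hρ => (hW ρ (hsub ρ ⟨hρ.1, hρ.2.le⟩)).hasDerivWithinAt)
      (B := fun ρ => 2 * Φ * (bump ρ * j ρ) + ‖y a * Complex.exp (L a)‖) ?_
      (fun ρ hρ => (hB ρ hρ).continuousAt.continuousWithinAt)
      (fun ρ hρ => (hB ρ ⟨hρ.1, hρ.2.le⟩).hasDerivWithinAt) ?_ ⟨ha.2.le, le_rfl⟩
    · have := bump_nonneg ha.1.le
      have := hjpos a
      have : 0 ≤ 2 * Φ * (bump a * j a) := by positivity
      linarith
    · intro ρ hρ
      have hm := hsub ρ ⟨hρ.1, hρ.2.le⟩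
      have hρ0 := hm.1
      rw [norm_div, norm_mul, norm_neg, hnorm, Complex.norm_real, Real.norm_of_nonneg hρ0.le,
        ← mul_div_assoc]
      apply div_le_div_of_nonneg_right _ hρ0.le
      -- The comparison function is 2Φ · bump · j. The logarithmic derivative of the bump is at
      -- least −1 and Re p ≥ 2, so half of Re p survives; this is the source of the factor 2.
      have h1 : (-1 : ℝ) ≤ (1 - ρ) / (1 + ρ) := by
        rw [le_div_iff₀ (by linarith)]; linarith
      have h2 : (p ρ).re ≤ 2 * ((p ρ).re + (1 - ρ) / (1 + ρ)) := by linarith [hp ρ hm]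
      have h3 := bump_nonneg hρ0.le
      have h4 := hjpos ρ
      calc ‖f ρ‖ * j ρ ≤ (Φ * bump ρ * (p ρ).re) * j ρ :=
            mul_le_mul_of_nonneg_right (hf ρ hm) h4.le
        _ = (Φ * bump ρ * j ρ) * (p ρ).re := by ring
        _ ≤ (Φ * bump ρ * j ρ) * (2 * ((p ρ).re + (1 - ρ) / (1 + ρ))) :=
            mul_le_mul_of_nonneg_left h2 (by positivity)
        _ = _ := by ring
  -- Since Re p ≥ 1, j(ρ)/ρ increases; hence j(a) → 0 as a → 0, and the boundary term of a bounded y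
  -- disappears.
  have hsmall : ∀ a ∈ Ioo 0 x, j a ≤ a * (j x / x) := by
    intro a ha
    have hsub : ∀ ρ ∈ Icc a x, ρ ∈ Ioc 0 ρ₁ := fun ρ hρ =>
      ⟨ha.1.trans_le hρ.1, hρ.2.trans hx.2⟩
    have hd : ∀ ρ ∈ Icc a x, HasDerivAt (fun ρ => j ρ / ρ)
        (j ρ * ((p ρ).re - 1) / ρ ^ 2) ρ := by
      intro ρ hρ
      have h0 := (hsub ρ hρ).1.ne'
      refine ((hjd ρ (hsub ρ hρ)).div (hasDerivAt_id ρ) h0).congr_deriv ?_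
      simp only [id]
      field_simp
    have hmono : MonotoneOn (fun ρ => j ρ / ρ) (Icc a x) := by
      refine monotoneOn_of_deriv_nonneg (convex_Icc a x)
        (fun ρ hρ => (hd ρ hρ).continuousAt.continuousWithinAt)
        (fun ρ hρ => (hd ρ (interior_subset hρ)).differentiableAt.differentiableWithinAt)
        fun ρ hρ => ?_
      rw [(hd ρ (interior_subset hρ)).deriv]
      have h2 := hp ρ (hsub ρ (interior_subset hρ))
      have := hjpos ρ
      have : 0 ≤ (p ρ).re - 1 := by linarith
      positivity
    have := hmono ⟨le_rfl, ha.2.le⟩ ⟨ha.2.le, le_rfl⟩ ha.2.le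
    rw [div_le_iff₀ ha.1] at this
    linarith
  have hC0 : ∀ᶠ a in 𝓝[>] (0 : ℝ), ‖y x * Complex.exp (L x)‖ ≤
      2 * Φ * (bump x * j x) + |C| * (a * (j x / x)) := by
    filter_upwards [hC, Ioo_mem_nhdsGT hx.1] with a ha hax
    refine (key a hax).trans ?_
    rw [norm_mul (y a), hnorm]
    have := mul_le_mul (ha.trans (le_abs_self C)) (hsmall a hax) (hjpos a).le (abs_nonneg C)
    linarith
  have hlim : Tendsto (fun a : ℝ => 2 * Φ * (bump x * j x) + |C| * (a * (j x / x))) (𝓝[>] 0)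
      (𝓝 (2 * Φ * (bump x * j x) + |C| * (0 * (j x / x)))) := by
    apply Tendsto.mono_left _ nhdsWithin_le_nhds
    exact Continuous.tendsto (by fun_prop) 0
  have hfin := ge_of_tendsto hlim hC0
  rw [norm_mul, hnorm, zero_mul, mul_zero, add_zero, ← mul_assoc] at hfin
  exact le_of_mul_le_mul_right hfin (hjpos x)

/-- The bump divided by ρ is 1/(1+ρ)², whose integral over (0,∞) equals 1. -/
lemma norm_sub_le_of_deriv_le_bump {ε y : ℝ → ℂ} {ρ₁ Φ : ℝ} (hΦ : 0 ≤ Φ)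
    (hε : ∀ ρ ∈ Ioc 0 ρ₁, HasDerivAt ε (y ρ / ρ) ρ)
    (hy : ∀ ρ ∈ Ioc 0 ρ₁, ‖y ρ‖ ≤ Φ * bump ρ) {x x' : ℝ} (hx : x ∈ Ioc 0 ρ₁)
    (hx' : x' ∈ Ioc 0 ρ₁) : ‖ε x - ε x'‖ ≤ Φ := by
  wlog h : x' ≤ x generalizing x x'
  · rw [norm_sub_rev]; exact this hx' hx (by linarith)
  have hsub : ∀ ρ ∈ Icc x' x, ρ ∈ Ioc 0 ρ₁ := fun ρ hρ =>
    ⟨hx'.1.trans_le hρ.1, hρ.2.trans hx.2⟩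
  have hB : ∀ ρ ∈ Icc x' x, HasDerivAt (fun ρ : ℝ => Φ * (-(1 + ρ)⁻¹) + Φ * (1 + x')⁻¹)
      (Φ * (bump ρ / ρ)) ρ := by
    intro ρ hρ
    have h0 := (hsub ρ hρ).1
    have h1 := (((((hasDerivAt_id ρ).const_add 1).inv
      (by simp only [id]; positivity)).neg).const_mul Φ).add_const (Φ * (1 + x')⁻¹)
    refine h1.congr_deriv ?_
    rw [bump]; simp only [id]; field_simp
  have := image_norm_le_of_norm_deriv_right_le_deriv_boundary' (a := x') (b := x)
      (f := fun ρ => ε ρ - ε x') (f' := fun ρ => y ρ / ρ)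
      (fun ρ hρ => ((hε ρ (hsub ρ hρ)).sub_const _).continuousAt.continuousWithinAt)
      (fun ρ hρ => ((hε ρ (hsub ρ ⟨hρ.1, hρ.2.le⟩)).sub_const _).hasDerivWithinAt)
      (B := fun ρ : ℝ => Φ * (-(1 + ρ)⁻¹) + Φ * (1 + x')⁻¹)
      (B' := fun ρ => Φ * (bump ρ / ρ)) (by simp)
      (fun ρ hρ => (hB ρ hρ).continuousAt.continuousWithinAt)
      (fun ρ hρ => (hB ρ ⟨hρ.1, hρ.2.le⟩).hasDerivWithinAt)
      (fun ρ hρ => by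
        have hm := hsub ρ ⟨hρ.1, hρ.2.le⟩
        rw [norm_div, Complex.norm_real, Real.norm_of_nonneg hm.1.le, ← mul_div_assoc]
        exact div_le_div_of_nonneg_right (hy ρ hm) hm.1.le) ⟨h, le_rfl⟩
  refine this.trans ?_
  have h1 : 0 ≤ (1 + x)⁻¹ := by have := hx.1; positivity
  have h2 : (1 + x')⁻¹ ≤ 1 := inv_le_one_of_one_le₀ (by linarith [hx'.1])
  nlinarith

/-- An amplitude `A` with `D = θA` that solves `θ²A + (2νσR + s)θA + qA = 0` and is bounded at the
end of the half-plane where the solution is recessive (`0` for `σ = 1`, `∞` for `σ = -1`). -/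
structure Amplitude (σ : ℝ) (μ : ℂ) (ν : ℝ) (A D : ℂ → ℂ) : Prop where
  deriv : ∀ z, 0 < z.re → HasDerivAt A (D z / z) z
  deriv_theta : ∀ z, 0 < z.re →
    HasDerivAt D ((-((2 * ν * σ * rootZ z + sZ σ μ z) * D z) - qZ σ μ z * A z) / z) z
  bound : ∀ M, ∃ C, ∃ r₀ : ℝ, 0 < r₀ ∧ ∀ z ∈ cone M, ‖z‖ ^ σ ≤ r₀ → ‖A z‖ ≤ C

/-- The logarithm of an integrating factor for the amplitude equation. -/
def logFactor (σ : ℝ) (μ : ℂ) (ν : ℝ) (z : ℂ) : ℂ :=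
  2 * ν * σ * (rootZ z + (Complex.log z - Complex.log (1 + rootZ z))) - Complex.log (rootZ z)
    + σ * μ * (Complex.log z - Complex.log (1 + rootZ z) - Complex.log (z + rootZ z))

lemma mem_slitPlane_of_re_pos {z : ℂ} (hz : 0 < z.re) : z ∈ Complex.slitPlane := Or.inl hz

lemma one_add_rootZ_re_pos {z : ℂ} (hz : 0 < z.re) : 0 < (1 + rootZ z).re := by
  simpa using add_pos one_pos (rootZ_re_pos hz)

lemma add_rootZ_re_pos {z : ℂ} (hz : 0 < z.re) : 0 < (z + rootZ z).re := by
  simpa using add_pos hz (rootZ_re_pos hz)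

lemma hasDerivAt_logFactor (σ : ℝ) (μ : ℂ) (ν : ℝ) {z : ℂ} (hz : 0 < z.re) :
    HasDerivAt (logFactor σ μ ν) ((2 * ν * σ * rootZ z + sZ σ μ z) / z) z := by
  have hR := hasDerivAt_rootZ hz
  have hlz := Complex.hasDerivAt_log (mem_slitPlane_of_re_pos hz)
  have hl1 := (hR.const_add 1).clog (mem_slitPlane_of_re_pos (one_add_rootZ_re_pos hz))
  have hlR := hR.clog (mem_slitPlane_of_re_pos (rootZ_re_pos hz))
  have hls := ((hasDerivAt_id z).add hR).clog (mem_slitPlane_of_re_pos (add_rootZ_re_pos hz))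
  have h := (((hR.add (hlz.sub hl1)).const_mul (2 * ν * σ : ℂ)).sub hlR).add
    (((hlz.sub hl1).sub hls).const_mul (σ * μ))
  refine HasDerivAt.congr_deriv (f := logFactor σ μ ν) h ?_
  have h0 := ne_zero_of_re_pos hz
  have h1 := rootZ_ne_zero hz
  have h2 := ne_zero_of_re_pos (one_add_rootZ_re_pos hz)
  have h3 := ne_zero_of_re_pos (add_rootZ_re_pos hz)
  have hsq := rootZ_sq z
  have e1 : z⁻¹ - z / rootZ z / (1 + rootZ z) = 1 / (z * rootZ z) := by
    field_simp
    linear_combination hsq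
  have e2 : (1 + z / rootZ z) / (z + rootZ z) = 1 / rootZ z := by
    field_simp
    ring
  have e3 : z / rootZ z + 1 / (z * rootZ z) = rootZ z / z := by
    field_simp
    linear_combination -hsq
  simp only [Pi.add_apply, id]
  rw [e1, e2, e3, sZ, betaZ, tZ]
  field_simp
  ring

/-- The weight is invariant under r ↦ 1/r, which lets rays run from 0 and rays run from ∞ be treated
together. -/
lemma bump_rpow {σ : ℝ} (hσ : σ = 1 ∨ σ = -1) {r : ℝ} (hr : 0 < r) : bump (r ^ σ) = bump r := by
  rcases hσ with rfl | rfl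
  · rw [Real.rpow_one]
  · rw [Real.rpow_neg_one, bump, bump]
    field_simp
    ring

/-- On the path ρ^σ e the operator ρ d/dρ is σθ; for σ = −1 the point ρ = 0 is the end at infinity.
-/
lemma hasDerivAt_comp_path {f : ℂ → ℂ} {f' e : ℂ} {σ ρ : ℝ} (hρ : 0 < ρ) (he : e ≠ 0)
    (hf : HasDerivAt f (f' / ((ρ ^ σ : ℝ) * e)) ((ρ ^ σ : ℝ) * e)) :
    HasDerivAt (fun ρ : ℝ => f ((ρ ^ σ : ℝ) * e)) (σ * f' / ρ) ρ := by
  have h := (Real.hasDerivAt_rpow_const (x := ρ) (p := σ) (Or.inl hρ.ne'))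
  have h2 := HasDerivAt.scomp ρ (hasDerivAt_ray hf) h
  refine HasDerivAt.congr_deriv (f := fun ρ : ℝ => f ((ρ ^ σ : ℝ) * e)) h2 ?_
  have hρc : (ρ : ℂ) ≠ 0 := by exact_mod_cast hρ.ne'
  have h3 : ((ρ ^ σ : ℝ) : ℂ) ≠ 0 := by exact_mod_cast (Real.rpow_pos_of_pos hρ σ).ne'
  rw [Real.rpow_sub hρ, Real.rpow_one, Complex.real_smul]
  push_cast at h3 ⊢
  field_simp

lemma Amplitude.differentiableOn {σ ν : ℝ} {μ : ℂ} {A D : ℂ → ℂ} (h : Amplitude σ μ ν A D) :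
    DifferentiableOn ℂ A {z | 0 < z.re} := fun z hz =>
  (h.deriv z hz).differentiableAt.differentiableWithinAt

/-- Cauchy's estimate on discs where |w| lies between |z|/2 and 2|z|; for both signs of σ this
changes |w|^σ by at most a factor 2, hence the halved radius. -/
lemma Amplitude.bound_theta {σ ν : ℝ} (hσ : σ = 1 ∨ σ = -1) {μ : ℂ} {A D : ℂ → ℂ}
    (h : Amplitude σ μ ν A D) (M : ℝ) :
    ∃ C, ∃ r₀ : ℝ, 0 < r₀ ∧ ∀ z ∈ cone M, ‖z‖ ^ σ ≤ r₀ → ‖D z‖ ≤ C := by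
  obtain ⟨C, r₀, hr, hC⟩ := h.bound (4 * M)
  refine ⟨2 * M * C, r₀ / 2, by positivity, fun z hz hzr => ?_⟩
  have hz0 := ne_zero_of_re_pos hz.1
  have hn : 0 < ‖z‖ := norm_pos_iff.2 hz0
  have hD : D z = z * _root_.deriv A z := by rw [(h.deriv z hz.1).deriv]; field_simp
  rw [hD]
  refine norm_mul_deriv_le h.differentiableOn hz fun w hw h1 h2 => hC w hw ?_
  refine le_trans ?_ (by linarith : 2 * ‖z‖ ^ σ ≤ r₀)
  rcases hσ with rfl | rfl
  · simpa using h2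
  · simp only [Real.rpow_neg_one]
    calc ‖w‖⁻¹ ≤ (‖z‖ / 2)⁻¹ := inv_anti₀ (by positivity) h1
      _ = 2 * ‖z‖⁻¹ := by field_simp

/-- The partial sums of a formal solution satisfy the amplitude equation up to `O(ν^{1-N})`. -/
lemma FormalSolution.hasDerivAt_partialSum {σ : ℝ} (hσ : σ = 1 ∨ σ = -1) {μ : ℂ} {d : ℕ → ℂ}
    {a g : ℕ → ℂ → ℂ} (h : FormalSolution σ μ d a g) {ν : ℝ} (hν : ν ≠ 0) (N : ℕ) {z : ℂ}
    (hz : 0 < z.re) :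
    HasDerivAt (fun z => ∑ k ∈ Finset.range N, g k z / (ν : ℂ) ^ k)
      ((-((2 * ν * σ * rootZ z + sZ σ μ z) * ∑ k ∈ Finset.range N, g k z / (ν : ℂ) ^ k)
        - qZ σ μ z * (∑ k ∈ Finset.range N, a k z / (ν : ℂ) ^ k)
        - 2 * σ * rootZ z * (ν * g N z / ν ^ N)) / z) z := by
  have hR := rootZ_ne_zero hz
  have hz0 := ne_zero_of_re_pos hz
  have hνc : (ν : ℂ) ≠ 0 := by exact_mod_cast hν
  have hσ2 : (σ : ℂ) ^ 2 = 1 := by rcases hσ with rfl | rfl <;> norm_num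
  have hg : ∀ k, HasDerivAt (g k)
      ((-(2 * σ * rootZ z * g (k + 1) z) - sZ σ μ z * g k z - qZ σ μ z * a k z) / z) z := by
    intro k
    have h1 := ((h.decay k).diff.differentiableAt (isOpen_re_pos.mem_nhds hz)).hasDerivAt
    refine h1.congr_deriv ?_
    rw [h.step k z hz, tZ]
    field_simp
    linear_combination -(z * _root_.deriv (g k) z + sZ σ μ z * g k z + qZ σ μ z * a k z) * hσ2
  -- The orders cancel successively and only the unmatched term −2σRν g_N/ν^N is left; for N = 0 it
  -- vanishes because g₀ = 0.
  induction N with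
  | zero =>
    simp [h.zero' z]
    exact hasDerivAt_const z (0 : ℂ)
  | succ N ih =>
    simp only [Finset.sum_range_succ]
    refine (ih.add ((hg N).div_const _)).congr_deriv ?_
    field_simp
    ring

/-- Uniform error control for solutions of the amplitude equation. -/
theorem FormalSolution.error_le {σ : ℝ} (hσ : σ = 1 ∨ σ = -1) {μ : ℂ} {d : ℕ → ℂ}
    {a g : ℕ → ℂ → ℂ} (h : FormalSolution σ μ d a g) (M : ℝ) (N : ℕ) :
    ∃ K ν₀ : ℝ, ∀ ν : ℝ, ν₀ ≤ ν → ∀ A D, Amplitude σ μ ν A D → ∀ z ∈ cone M, ∀ u : ℝ, 0 < u →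
      ‖A z - ∑ k ∈ Finset.range N, a k z / (ν : ℂ) ^ k‖ ≤
        2 * ‖A (u * z) - ∑ k ∈ Finset.range N, a k (u * z) / (ν : ℂ) ^ k‖ + K / ν ^ N := by
  by_cases hM : 1 ≤ M
  swap
  · exact ⟨0, 0, fun _ _ _ _ _ z hz => absurd (one_le_of_mem_cone hz) hM⟩
  obtain ⟨Kq, hKq, hq⟩ := coneBounded_qZ σ μ M
  obtain ⟨Ks, hKs, hs⟩ := coneBounded_sZ σ μ M
  obtain ⟨Kg, hKg, hg⟩ := (h.decay N).bound M
  set c : ℝ := 1 / (3 * M) with hc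
  have hcpos : 0 < c := by positivity
  have hσabs : |σ| = 1 := by rcases hσ with rfl | rfl <;> simp
  have hσ2 : (σ : ℂ) ^ 2 = 1 := by rcases hσ with rfl | rfl <;> norm_num
  -- The three thresholds serve in turn to absorb s into the leading coefficient, to make Re p ≥ 2,
  -- and to make the contribution of q at most half the supremum of the error.
  refine ⟨8 * Kg / c, max (max (Ks / c) (2 / c)) (4 * Kq / c), fun ν hν A D hA z hz u hu => ?_⟩
  have hν1 : Ks ≤ ν * c := by
    rw [← div_le_iff₀ hcpos]; exact ((le_max_left _ _).trans (le_max_left _ _)).trans hν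
  have hν2 : 2 ≤ ν * c := by
    rw [← div_le_iff₀ hcpos]; exact ((le_max_right _ _).trans (le_max_left _ _)).trans hν
  have hν3 : 4 * Kq ≤ ν * c := by
    rw [← div_le_iff₀ hcpos]; exact (le_max_right _ _).trans hν
  have hνpos : 0 < ν := by
    by_contra hneg; push Not at hneg; nlinarith
  have hz0 := ne_zero_of_re_pos hz.1
  have hn : 0 < ‖z‖ := norm_pos_iff.2 hz0
  set e : ℂ := ((‖z‖⁻¹ : ℝ) : ℂ) * z with he
  have hec : e ∈ cone M := smul_mem_cone hz (by positivity)
  have hen : ‖e‖ = 1 := by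
    rw [he, norm_mul, Complex.norm_real, Real.norm_of_nonneg (by positivity)]
    field_simp
  have he0 := ne_zero_of_re_pos hec.1
  set γ : ℝ → ℂ := fun ρ => ((ρ ^ σ : ℝ) : ℂ) * e with hγ
  have hγc : ∀ ρ, 0 < ρ → γ ρ ∈ cone M := fun ρ hρ =>
    smul_mem_cone hec (Real.rpow_pos_of_pos hρ σ)
  have hγn : ∀ ρ, 0 < ρ → ‖γ ρ‖ = ρ ^ σ := fun ρ hρ => by
    rw [hγ]; simp only
    rw [norm_mul, hen, mul_one, Complex.norm_real,
      Real.norm_of_nonneg (Real.rpow_nonneg hρ.le σ)]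
  have hσσ : ∀ r : ℝ, 0 < r → (r ^ σ) ^ σ = r := by
    intro r hr
    rw [← Real.rpow_mul hr.le]
    rcases hσ with rfl | rfl <;> simp
  have hγpt : ∀ v : ℝ, 0 < v → γ ((v * ‖z‖) ^ σ) = v * z := by
    intro v hv
    have : ((‖z‖ : ℝ) : ℂ) ≠ 0 := by exact_mod_cast hn.ne'
    simp only [hγ]
    rw [hσσ _ (by positivity), he]
    push_cast
    field_simp
  set ε : ℂ → ℂ := fun z => A z - ∑ k ∈ Finset.range N, a k z / (ν : ℂ) ^ k with hεdef
  set δ : ℂ → ℂ := fun z => D z - ∑ k ∈ Finset.range N, g k z / (ν : ℂ) ^ k with hδdef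
  have hεd : ∀ w, 0 < w.re → HasDerivAt ε (δ w / w) w := by
    intro w hw
    have h1 : HasDerivAt (fun z => ∑ k ∈ Finset.range N, a k z / (ν : ℂ) ^ k)
        (∑ k ∈ Finset.range N, g k w / w / (ν : ℂ) ^ k) w :=
      HasDerivAt.fun_sum fun k _ => (h.deriv k w hw).div_const _
    refine ((hA.deriv w hw).sub h1).congr_deriv ?_
    simp only [hδdef]
    rw [sub_div, Finset.sum_div]
    congr 1
    exact Finset.sum_congr rfl fun k _ => by ring
  set f : ℂ → ℂ := fun w => qZ σ μ w * ε w - 2 * σ * rootZ w * (ν * g N w / ν ^ N) with hf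
  have hδd : ∀ w, 0 < w.re →
      HasDerivAt δ ((-((2 * ν * σ * rootZ w + sZ σ μ w) * δ w) - f w) / w) w := by
    intro w hw
    refine ((hA.deriv_theta w hw).sub
      (h.hasDerivAt_partialSum hσ hνpos.ne' N hw)).congr_deriv ?_
    simp only [hδdef, hf, hεdef]
    ring
  -- As σ² = 1, p = 2νR + σs: its real part is positive and large for both signs once the path
  -- starts at the recessive end.
  set p : ℝ → ℂ := fun ρ => σ * (2 * ν * σ * rootZ (γ ρ) + sZ σ μ (γ ρ)) with hp
  have hpre : ∀ ρ, 0 < ρ → ν * c * (1 + ρ ^ σ) ≤ (p ρ).re := by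
    intro ρ hρ
    have h1 : p ρ = ((2 * ν : ℝ) : ℂ) * rootZ (γ ρ) + (σ : ℂ) * sZ σ μ (γ ρ) := by
      simp only [hp]; push_cast
      linear_combination (2 * ν * rootZ (γ ρ)) * hσ2
    have h2 := rootZ_re_lower (hγc ρ hρ)
    have h3 := hs _ (hγc ρ hρ)
    rw [hγn ρ hρ] at h2
    have h4 : |(sZ σ μ (γ ρ)).re| ≤ Ks := by
      have := (Complex.abs_re_le_norm _).trans h3; simpa using this
    rw [h1, Complex.add_re, Complex.re_ofReal_mul, Complex.re_ofReal_mul]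
    have h5 : -Ks ≤ σ * (sZ σ μ (γ ρ)).re := by
      have : |σ * (sZ σ μ (γ ρ)).re| ≤ Ks := by rw [abs_mul, hσabs, one_mul]; exact h4
      exact (abs_le.1 this).1
    have h6 : c * (1 + ρ ^ σ) ≤ (rootZ (γ ρ)).re := by
      rw [hc, one_div_mul_eq_div]; exact h2
    have h7 := Real.rpow_pos_of_pos hρ σ
    have h8 : ν * c * 1 ≤ ν * c * (1 + ρ ^ σ) :=
      mul_le_mul_of_nonneg_left (by linarith) (by positivity)
    nlinarith [mul_le_mul_of_nonneg_left h6 hνpos.le]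
  have hνc : 0 < ν * c := by positivity
  -- boundedness near the recessive end
  obtain ⟨CD, r₁, hr₁, hCD⟩ := hA.bound_theta hσ M
  obtain ⟨CA, r₂, hr₂, hCA⟩ := hA.bound M
  have hγσ : ∀ ρ, 0 < ρ → ‖γ ρ‖ ^ σ = ρ := fun ρ hρ => by rw [hγn ρ hρ, hσσ ρ hρ]
  have hga : ∃ Ca, ∀ w ∈ cone M, ‖∑ k ∈ Finset.range N, a k w / (ν : ℂ) ^ k‖ ≤ Ca := by
    choose K hK0 hK using fun k => h.bound k M
    refine ⟨∑ k ∈ Finset.range N, K k / ‖(ν : ℂ) ^ k‖, fun w hw => norm_sum_le_of_le _ ?_⟩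
    intro k _
    rw [norm_div]
    exact div_le_div_of_nonneg_right (by simpa using hK k w hw) (norm_nonneg _)
  have hgb : ∃ Cg, ∀ w ∈ cone M, ‖∑ k ∈ Finset.range N, g k w / (ν : ℂ) ^ k‖ ≤ Cg := by
    choose K hK0 hK using fun k => (h.decay k).bound M
    refine ⟨∑ k ∈ Finset.range N, K k / ‖(ν : ℂ) ^ k‖, fun w hw => norm_sum_le_of_le _ ?_⟩
    intro k _
    rw [norm_div]
    have hb : bump ‖w‖ ≤ 1 := by
      have := norm_nonneg w
      rw [bump, div_le_one (by positivity)]; nlinarith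
    exact div_le_div_of_nonneg_right
      ((hK k w hw).trans (mul_le_of_le_one_right (hK0 k) hb)) (norm_nonneg _)
  obtain ⟨Ca, hCa⟩ := hga
  obtain ⟨Cg, hCg⟩ := hgb
  have hδb : ∀ᶠ ρ in 𝓝[>] (0 : ℝ), ‖σ * δ (γ ρ)‖ ≤ CD + Cg := by
    filter_upwards [Ioo_mem_nhdsGT hr₁] with ρ hρ
    rw [norm_mul, Complex.norm_real, Real.norm_eq_abs, hσabs, one_mul]
    refine (norm_sub_le _ _).trans (add_le_add ?_ (hCg _ (hγc ρ hρ.1)))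
    exact hCD _ (hγc ρ hρ.1) (by rw [hγσ ρ hρ.1]; exact hρ.2.le)
  -- the two points
  have hx1 := hγpt 1 one_pos
  have hx2 := hγpt u hu
  rw [Complex.ofReal_one, one_mul, one_mul] at hx1
  set x₁ := ‖z‖ ^ σ with hx₁
  set x₂ := (u * ‖z‖) ^ σ with hx₂
  have hx₁pos : 0 < x₁ := Real.rpow_pos_of_pos hn σ
  have hx₂pos : 0 < x₂ := Real.rpow_pos_of_pos (by positivity) σ
  set ρ₁ := max x₁ x₂ with hρ₁
  have hm1 : x₁ ∈ Ioc 0 ρ₁ := ⟨hx₁pos, le_max_left _ _⟩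
  have hm2 : x₂ ∈ Ioc 0 ρ₁ := ⟨hx₂pos, le_max_right _ _⟩
  have hεγ : ∀ ρ, 0 < ρ → HasDerivAt (fun ρ => ε (γ ρ)) (σ * δ (γ ρ) / ρ) ρ := fun ρ hρ =>
    hasDerivAt_comp_path hρ he0 (hεd _ (hγc ρ hρ).1)
  -- boundedness of the error on the ray
  set S : Set ℝ := (fun ρ => ‖ε (γ ρ)‖) '' Ioc 0 ρ₁ with hS
  have hSb : BddAbove S := by
    have hcomp : BddAbove ((fun ρ => ‖ε (γ ρ)‖) '' Icc r₂ ρ₁) := by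
      refine (isCompact_Icc.image_of_continuousOn fun ρ hρ => ?_).bddAbove
      exact (hεγ ρ (hr₂.trans_le hρ.1)).continuousAt.norm.continuousWithinAt
    obtain ⟨B, hB⟩ := hcomp
    refine ⟨max B (CA + Ca), ?_⟩
    rintro _ ⟨ρ, hρ, rfl⟩
    by_cases hle : r₂ ≤ ρ
    · exact (hB ⟨ρ, ⟨hle, hρ.2⟩, rfl⟩).trans (le_max_left _ _)
    · refine le_trans ?_ (le_max_right _ _)
      refine (norm_sub_le _ _).trans (add_le_add ?_ (hCa _ (hγc ρ hρ.1)))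
      exact hCA _ (hγc ρ hρ.1) (by rw [hγσ ρ hρ.1]; linarith)
  -- The supremum is finite, by compactness away from ρ = 0 and the recessive bound near it;
  -- finiteness is what permits the absorption below.
  set m := sSup S with hmdef
  have hm : ∀ ρ ∈ Ioc 0 ρ₁, ‖ε (γ ρ)‖ ≤ m := fun ρ hρ => le_csSup hSb ⟨ρ, hρ, rfl⟩
  have hm0 : 0 ≤ m := (norm_nonneg _).trans (hm _ hm1)
  set Φ : ℝ := (Kq * m + 2 * ν * Kg / ν ^ N) / (ν * c) with hΦ
  have hΦ0 : 0 ≤ Φ := by positivity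
  have hfb : ∀ ρ ∈ Ioc 0 ρ₁, ‖f (γ ρ)‖ ≤ Φ * bump ρ * (p ρ).re := by
    intro ρ hρ
    have hr := Real.rpow_pos_of_pos hρ.1 σ
    have h1 := hq _ (hγc ρ hρ.1)
    have h2 := hg _ (hγc ρ hρ.1)
    have h3 := norm_rootZ_le (γ ρ)
    rw [hγn ρ hρ.1] at h1 h2 h3
    set r := ρ ^ σ with hrdef
    have hf1 : ‖f (γ ρ)‖ ≤ (Kq * m + 2 * ν * Kg / ν ^ N) * ramp r := by
      have e1 : ‖qZ σ μ (γ ρ) * ε (γ ρ)‖ ≤ Kq * ramp r * m := by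
        rw [norm_mul]
        exact mul_le_mul h1 (hm ρ hρ) (norm_nonneg _) ((norm_nonneg _).trans h1)
      have e2 : ‖2 * σ * rootZ (γ ρ) * (ν * g N (γ ρ) / ν ^ N)‖ ≤
          2 * (1 + r) * (ν * (Kg * bump r) / ν ^ N) := by
        rw [norm_mul, norm_mul, norm_mul, norm_div, norm_mul, norm_pow, Complex.norm_real,
          Complex.norm_real, Real.norm_eq_abs, hσabs, Real.norm_of_nonneg hνpos.le,
          Complex.norm_ofNat, mul_one]
        gcongr
      have e3 : (1 + r) * bump r = ramp r := by rw [bump, ramp]; field_simp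
      calc ‖f (γ ρ)‖ ≤ _ := norm_sub_le _ _
        _ ≤ _ := add_le_add e1 e2
        _ = _ := by rw [← e3]; ring
    -- ramp(r) = bump(r)(1+r), and the factor 1 + r is paid for by Re p ≥ νc(1+r).
    refine hf1.trans ?_
    have h4 := hpre ρ hρ.1
    have h5 := bump_nonneg hρ.1.le
    calc (Kq * m + 2 * ν * Kg / ν ^ N) * ramp r
        = Φ * bump ρ * (ν * c * (1 + r)) := by
          rw [hΦ, ← bump_rpow hσ hρ.1, ← hrdef, bump, ramp]; field_simp
      _ ≤ _ := mul_le_mul_of_nonneg_left h4 (by positivity)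
  have hy := fun (x : ℝ) (hx : x ∈ Ioc 0 ρ₁) =>
    norm_le_bump_of_ode (y := fun ρ => σ * δ (γ ρ)) (L := fun ρ => logFactor σ μ ν (γ ρ))
      (p := p) (f := fun ρ => f (γ ρ)) (ρ₁ := ρ₁) (C := CD + Cg) hΦ0
      (fun ρ hρ => by
        refine ((hasDerivAt_comp_path hρ.1 he0
          (hδd _ (hγc ρ hρ.1).1)).const_mul (σ : ℂ)).congr_deriv ?_
        simp only [hp]
        linear_combination (-(f (γ ρ)) / ρ) * hσ2)
      (fun ρ hρ => (hasDerivAt_comp_path hρ.1 he0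
        (hasDerivAt_logFactor σ μ ν (hγc ρ hρ.1).1)))
      (fun ρ hρ => by
        have h1 := hpre ρ hρ.1
        have h2 := Real.rpow_pos_of_pos hρ.1 σ
        nlinarith) hfb hδb hx
  have hosc := fun (x : ℝ) (hx : x ∈ Ioc 0 ρ₁) =>
    norm_sub_le_of_deriv_le_bump (ε := fun ρ => ε (γ ρ)) (Φ := 2 * Φ) (by positivity)
      (fun ρ hρ => hεγ ρ hρ.1) hy hx hm2
  -- Here 4Kq ≤ νc enters: the part of 2Φ proportional to m is at most m/2 and can be moved to the
  -- left in `hmle`.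
  have hΦm : 2 * Φ ≤ m / 2 + 4 * Kg / (c * ν ^ N) := by
    have h1 : Kq * m / (ν * c) ≤ m / 4 := by
      rw [div_le_iff₀ hνc]; nlinarith
    have h2 : Φ = Kq * m / (ν * c) + 2 * Kg / (c * ν ^ N) := by
      rw [hΦ]; field_simp
    have h3 : 4 * Kg / (c * ν ^ N) = 2 * (2 * Kg / (c * ν ^ N)) := by ring
    rw [h2, h3]; linarith
  have hall : ∀ x ∈ Ioc 0 ρ₁, ‖ε (γ x)‖ ≤ ‖ε (γ x₂)‖ + (m / 2 + 4 * Kg / (c * ν ^ N)) := by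
    intro x hx
    have h1 := (hosc x hx).trans hΦm
    have h2 := norm_sub_norm_le (ε (γ x)) (ε (γ x₂))
    linarith
  have hmle : m ≤ ‖ε (γ x₂)‖ + (m / 2 + 4 * Kg / (c * ν ^ N)) := by
    refine csSup_le ⟨_, x₁, hm1, rfl⟩ ?_
    rintro _ ⟨x, hx, rfl⟩
    exact hall x hx
  have hfin := hm x₁ hm1
  rw [hx1] at hfin
  rw [hx2] at hmle
  have hK : 8 * Kg / c / ν ^ N = 2 * (4 * Kg / (c * ν ^ N)) := by
    field_simp; ring
  rw [hK]
  linarith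

/-! ### The front factors -/

/-- The product (R − z)(R + z) is 1, and |R − z| < |R + z| since Re R Re z > 0 and Im R Im z ≥ 0. It
places 1 + z − R in the right half-plane. -/
lemma norm_rootZ_sub_lt_one {z : ℂ} (hz : 0 < z.re) : ‖rootZ z - z‖ < 1 := by
  have ha := rootZ_re_pos hz
  have h2 := congrArg Complex.im (rootZ_sq z)
  simp [sq] at h2
  have h3 : 0 ≤ (rootZ z).im * z.im := by
    have h4 : (rootZ z).re * (rootZ z).im = z.re * z.im := by linarith
    have h5 : (rootZ z).re * ((rootZ z).im * z.im) = z.re * (z.im * z.im) := by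
      rw [← mul_assoc, h4]; ring
    by_contra hneg
    push Not at hneg
    nlinarith [mul_self_nonneg z.im]
  have h1 : ‖rootZ z - z‖ ^ 2 < ‖rootZ z + z‖ ^ 2 := by
    rw [Complex.sq_norm, Complex.sq_norm, Complex.normSq_apply, Complex.normSq_apply]
    simp only [Complex.sub_re, Complex.sub_im, Complex.add_re, Complex.add_im]
    nlinarith [mul_pos ha hz]
  have h2 : ‖rootZ z - z‖ * ‖rootZ z + z‖ = 1 := by
    rw [← norm_mul, rootZ_sub_mul, norm_one]
  by_contra hge
  push Not at hge
  nlinarith [norm_nonneg (rootZ z + z), norm_nonneg (rootZ z - z)]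

lemma one_add_sub_rootZ_re_pos {σ : ℝ} (hσ : σ = 1 ∨ σ = -1) {z : ℂ} (hz : 0 < z.re) :
    0 < (1 + z - σ * rootZ z).re := by
  rcases hσ with rfl | rfl
  · have h1 := norm_rootZ_sub_lt_one hz
    have h2 := Complex.re_le_norm (rootZ z - z)
    simp only [Complex.sub_re, Complex.add_re, Complex.one_re, Complex.ofReal_one, one_mul] at *
    linarith
  · have := rootZ_re_pos hz
    simp only [Complex.sub_re, Complex.add_re, Complex.one_re, Complex.re_ofReal_mul]
    linarith

/-- The logarithm of the front factor. -/
def logFront (σ : ℝ) (μ : ℂ) (ν : ℝ) (z : ℂ) : ℂ :=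
  μ * Complex.log (1 + z - σ * rootZ z) + (Complex.log z - Complex.log (rootZ z)) / 2 - ν * z
    + ν * σ * (rootZ z + (Complex.log z - Complex.log (1 + rootZ z)))

/-- The logarithmic derivative `θ` of the front factor. -/
def logFrontTheta (σ : ℝ) (μ : ℂ) (ν : ℝ) (z : ℂ) : ℂ :=
  ν * (σ * rootZ z - z) + (tZ z ^ 2 + μ + σ * μ * (tZ z - betaZ z)) / 2

lemma hasDerivAt_logFront {σ : ℝ} (hσ : σ = 1 ∨ σ = -1) (μ : ℂ) (ν : ℝ) {z : ℂ}
    (hz : 0 < z.re) : HasDerivAt (logFront σ μ ν) (logFrontTheta σ μ ν z / z) z := by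
  have hσ2 : (σ : ℂ) ^ 2 = 1 := by rcases hσ with rfl | rfl <;> norm_num
  have hR := hasDerivAt_rootZ hz
  have hlz := Complex.hasDerivAt_log (mem_slitPlane_of_re_pos hz)
  have hl1 := (hR.const_add 1).clog (mem_slitPlane_of_re_pos (one_add_rootZ_re_pos hz))
  have hlR := hR.clog (mem_slitPlane_of_re_pos (rootZ_re_pos hz))
  have hls := (((hasDerivAt_id z).const_add 1).sub (hR.const_mul (σ : ℂ))).clog
    (mem_slitPlane_of_re_pos (one_add_sub_rootZ_re_pos hσ hz))
  have h := (((hls.const_mul μ).add ((hlz.sub hlR).div_const 2)).sub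
    ((hasDerivAt_id z).const_mul (ν : ℂ))).add
    ((hR.add (hlz.sub hl1)).const_mul (ν * σ : ℂ))
  refine HasDerivAt.congr_deriv (f := logFront σ μ ν) h ?_
  have h0 := ne_zero_of_re_pos hz
  have h1 := rootZ_ne_zero hz
  have h2 := ne_zero_of_re_pos (one_add_rootZ_re_pos hz)
  have h3 := ne_zero_of_re_pos (one_add_sub_rootZ_re_pos hσ hz)
  have hsq := rootZ_sq z
  have e1 : z⁻¹ - z / rootZ z / (1 + rootZ z) = 1 / (z * rootZ z) := by
    field_simp
    linear_combination hsq
  have e2 : (1 - σ * (z / rootZ z)) / (1 + z - σ * rootZ z)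
      = (1 + σ * (tZ z - betaZ z)) / (2 * z) := by
    rw [betaZ, tZ]
    field_simp
    linear_combination σ * hsq - (z * rootZ z - rootZ z) * hσ2
  have e3 : z / rootZ z + 1 / (z * rootZ z) = rootZ z / z := by
    field_simp
    linear_combination -hsq
  have e4 : z⁻¹ - z / rootZ z / rootZ z = tZ z ^ 2 / z := by
    rw [tZ]
    field_simp
    linear_combination hsq
  simp only [Pi.sub_apply, id]
  rw [e1, e2, e3, e4, logFrontTheta]
  field_simp
  ring

lemma hasDerivAt_logFrontTheta (σ : ℝ) (μ : ℂ) (ν : ℝ) {z : ℂ} (hz : 0 < z.re) :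
    HasDerivAt (logFrontTheta σ μ ν) ((ν * (σ * (z * betaZ z) - z) - (tZ z ^ 2 * betaZ z ^ 2
      + σ * μ * (tZ z * betaZ z ^ 2 + betaZ z * tZ z ^ 2) / 2)) / z) z := by
  have hR := hasDerivAt_rootZ hz
  have ht := hasDerivAt_tZ hz
  have hb := hasDerivAt_betaZ hz
  have h0 := ne_zero_of_re_pos hz
  have h1 := rootZ_ne_zero hz
  have h := (((hR.const_mul (σ : ℂ)).sub (hasDerivAt_id z)).const_mul (ν : ℂ)).add
    ((((ht.fun_pow 2).add_const μ).add ((ht.sub hb).const_mul (σ * μ : ℂ))).div_const 2)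
  refine HasDerivAt.congr_deriv (f := logFrontTheta σ μ ν) h ?_
  have e : z / rootZ z = betaZ z := by rw [betaZ, tZ]; ring
  rw [e]
  simp only [Nat.cast_ofNat, Nat.add_one_sub_one, pow_one]
  field_simp
  ring

/-- The Riccati-type identity behind the amplitude equation. -/
lemma logFrontTheta_riccati {σ : ℝ} (hσ : σ = 1 ∨ σ = -1) (μ : ℂ) (ν : ℝ) {z : ℂ}
    (hz : 0 < z.re) :
    ν ^ 2 + μ * ν - 1 / 4 - μ / 2 - (ν * (σ * (z * betaZ z) - z) - (tZ z ^ 2 * betaZ z ^ 2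
      + σ * μ * (tZ z * betaZ z ^ 2 + betaZ z * tZ z ^ 2) / 2)) + logFrontTheta σ μ ν z ^ 2
      = (2 * ν * σ * rootZ z + sZ σ μ z) * logFrontTheta σ μ ν z - qZ σ μ z := by
  have hσ2 : (σ : ℂ) ^ 2 = 1 := by rcases hσ with rfl | rfl <;> norm_num
  have h1 := rootZ_ne_zero hz
  have hsq := rootZ_sq z
  have htR : tZ z * rootZ z = 1 := by rw [tZ]; field_simp
  have hzt : betaZ z * rootZ z = z := by rw [betaZ, mul_assoc, htR, mul_one]
  have h3 := tZ_sq_add hz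
  have hzb : z * betaZ z = rootZ z - tZ z := by
    have : z * betaZ z = z ^ 2 * tZ z := by rw [betaZ]; ring
    rw [this]
    linear_combination (-tZ z) * hsq + rootZ z * htR
  rw [hzb]
  simp only [logFrontTheta, sZ, qZ]
  generalize rootZ z = R at *
  generalize betaZ z = b at *
  generalize tZ z = t at *
  linear_combination (-ν ^ 2) * hsq - (ν ^ 2 * R ^ 2 + ν * μ * (1 - z)
      + μ ^ 2 * (t - b) ^ 2 / 4) * hσ2 - ν * σ ^ 2 * μ * htR + ν * (b * σ + σ ^ 2 * μ) * hzt
    + ν * σ * hzb + (-ν * z + (t ^ 2 + b ^ 2 + 1 + 2 * μ) / 4 - μ ^ 2 / 4) * h3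

lemma hasDerivAt_exp_logFront {σ : ℝ} (hσ : σ = 1 ∨ σ = -1) (μ : ℂ) (ν : ℝ) {z : ℂ}
    (hz : 0 < z.re) : HasDerivAt (fun z => Complex.exp (-logFront σ μ ν z))
      (Complex.exp (-logFront σ μ ν z) * -(logFrontTheta σ μ ν z / z)) z :=
  (hasDerivAt_logFront hσ μ ν hz).neg.cexp

/-- A solution `G`, with `G₁ = θG`, of `θ²G + (2νz - 1 - μ)θG - (ν - ½)(ν + ½ + μ)G = 0`. -/
structure BesselSolution (μ : ℂ) (ν : ℝ) (G G₁ : ℂ → ℂ) : Prop where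
  deriv : ∀ z, 0 < z.re → HasDerivAt G (G₁ z / z) z
  deriv_theta : ∀ z, 0 < z.re → HasDerivAt G₁
    ((-((2 * ν * z - 1 - μ) * G₁ z) + (ν - 1 / 2) * (ν + 1 / 2 + μ) * G z) / z) z

lemma BesselSolution.sub {μ : ℂ} {ν : ℝ} {G G₁ H H₁ : ℂ → ℂ} (hG : BesselSolution μ ν G G₁)
    (hH : BesselSolution μ ν H H₁) :
    BesselSolution μ ν (fun z => G z - H z) (fun z => G₁ z - H₁ z) :=
  ⟨fun z hz => ((hG.deriv z hz).sub (hH.deriv z hz)).congr_deriv (by ring),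
    fun z hz => ((hG.deriv_theta z hz).sub (hH.deriv_theta z hz)).congr_deriv (by ring)⟩

/-- Removing exp(`logFront`) by the product rule shifts the coefficient of θ by 2 `logFrontTheta`;
the coefficient of A is supplied by `logFrontTheta_riccati`. -/
lemma BesselSolution.amplitude {σ : ℝ} (hσ : σ = 1 ∨ σ = -1) {μ : ℂ} {ν : ℝ} {G G₁ : ℂ → ℂ}
    (h : BesselSolution μ ν G G₁)
    (hb : ∀ M, ∃ C, ∃ r₀ : ℝ, 0 < r₀ ∧ ∀ z ∈ cone M, ‖z‖ ^ σ ≤ r₀ →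
      ‖G z * Complex.exp (-logFront σ μ ν z)‖ ≤ C) :
    Amplitude σ μ ν (fun z => G z * Complex.exp (-logFront σ μ ν z))
      (fun z => (G₁ z - logFrontTheta σ μ ν z * G z) * Complex.exp (-logFront σ μ ν z)) := by
  refine ⟨fun z hz => ?_, fun z hz => ?_, hb⟩
  · refine ((h.deriv z hz).mul (hasDerivAt_exp_logFront hσ μ ν hz)).congr_deriv ?_
    ring
  · refine (((h.deriv_theta z hz).sub ((hasDerivAt_logFrontTheta σ μ ν hz).mul
      (h.deriv z hz))).mul (hasDerivAt_exp_logFront hσ μ ν hz)).congr_deriv ?_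
    have h1 := logFrontTheta_riccati hσ μ ν hz
    have h2 : 2 * logFrontTheta σ μ ν z + 2 * ν * z - 1 - μ = 2 * ν * σ * rootZ z + sZ σ μ z := by
      simp only [logFrontTheta, sZ]
      linear_combination tZ_sq_add hz
    generalize Complex.exp (-logFront σ μ ν z) = E
    simp only [Pi.sub_apply, Pi.mul_apply]
    linear_combination (G z * E / z) * h1 - ((G₁ z) * E / z) * h2

/-! ### Principal branches, and the front factors as single exponentials. -/

lemma nuN_pos (n : ℕ) : 0 < nuN n := by unfold nuN; positivity

lemma arg_abs_lt_of_re_pos {z : ℂ} (hz : 0 < z.re) : |z.arg| < Real.pi / 2 :=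
  Complex.abs_arg_lt_pi_div_two_iff.2 (Or.inl hz)

lemma log_div_of_re_pos {z w : ℂ} (hz : 0 < z.re) (hw : 0 < w.re) :
    Complex.log (z / w) = Complex.log z - Complex.log w := by
  have h1 := abs_lt.1 (arg_abs_lt_of_re_pos hz)
  have h2 := abs_lt.1 (arg_abs_lt_of_re_pos hw)
  have hz0 := ne_zero_of_re_pos hz
  have hw0 := ne_zero_of_re_pos hw
  have : z / w = Complex.exp (Complex.log z - Complex.log w) := by
    rw [Complex.exp_sub, Complex.exp_log hz0, Complex.exp_log hw0]
  rw [this, Complex.log_exp]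
  · rw [Complex.sub_im, Complex.log_im, Complex.log_im]; linarith
  · rw [Complex.sub_im, Complex.log_im, Complex.log_im]; linarith

/-- Arguments in the right half-plane stay below π/2, so the logarithm of z/(1+R) splits, and
`log_rootZ` turns the fourth root of 1 + z² into half of log R. -/
lemma front_eq_exp {σ : ℝ} (hσ : σ = 1 ∨ σ = -1) (μ : ℂ) (ν : ℝ) {z : ℂ} (hz : 0 < z.re) :
    (1 + z - σ * rootZ z) ^ μ * z ^ (1 / 2 : ℂ) / (1 + z ^ 2) ^ (1 / 4 : ℂ)
      * Complex.exp (-(ν * z) + ν * σ * etaZ z) = Complex.exp (logFront σ μ ν z) := by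
  have h0 := ne_zero_of_re_pos hz
  have h3 := ne_zero_of_re_pos (one_add_sub_rootZ_re_pos hσ hz)
  have h4 := Complex.slitPlane_ne_zero (one_add_sq_mem_slitPlane hz)
  rw [Complex.cpow_def_of_ne_zero h0, Complex.cpow_def_of_ne_zero h3,
    Complex.cpow_def_of_ne_zero h4, etaZ, log_div_of_re_pos hz (one_add_rootZ_re_pos hz),
    ← Complex.exp_add, ← Complex.exp_sub, ← Complex.exp_add, logFront, log_rootZ hz]
  congr 1
  ring

lemma frontF_eq_exp (n : ℕ) (μ : ℂ) {z : ℂ} (hz : 0 < z.re) :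
    frontF n μ z = Complex.exp (logFront 1 μ (nuN n) z) := by
  rw [← front_eq_exp (Or.inl rfl) μ (nuN n) hz, frontF]
  simp

lemma frontU_eq_exp (n : ℕ) (μ : ℂ) {z : ℂ} (hz : 0 < z.re) :
    frontU n μ z = (-1) ^ n * Complex.exp (logFront (-1) μ (nuN n) z) := by
  rw [← front_eq_exp (Or.inr rfl) μ (nuN n) hz, frontU, ← mul_assoc]
  have e : -((nuN n : ℂ) * z) - (nuN n : ℂ) * etaZ z
      = -((nuN n : ℂ) * z) + nuN n * ((-1 : ℝ) : ℂ) * etaZ z := by push_cast; ring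
  have e2 : 1 + z - ((-1 : ℝ) : ℂ) * rootZ z = 1 + z + rootZ z := by push_cast; ring
  rw [e, e2]

/-! ### Limits of the front factors -/

lemma betaZ_eq_div (z : ℂ) : betaZ z = z / rootZ z := by rw [betaZ, tZ]; ring

lemma tendsto_log_sub_log_rootZ (M : ℝ) :
    Tendsto (fun z => Complex.log z - Complex.log (rootZ z)) (coneAt M) (𝓝 0) := by
  have h := (tendsto_betaZ M).clog (by simp)
  rw [Complex.log_one] at h
  refine h.congr' ?_
  filter_upwards [eventually_mem_cone M] with z hz
  rw [betaZ_eq_div, log_div_of_re_pos hz.1 (rootZ_re_pos hz.1)]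

lemma tendsto_log_sub_log_one_add_rootZ (M : ℝ) :
    Tendsto (fun z => Complex.log z - Complex.log (1 + rootZ z)) (coneAt M) (𝓝 0) := by
  have h := ((tendsto_betaZ M).div ((tendsto_tZ M).add_const 1) (by simp)).clog (by simp)
  rw [zero_add, div_one, Complex.log_one] at h
  refine h.congr' ?_
  filter_upwards [eventually_mem_cone M] with z hz
  have h1 := rootZ_ne_zero hz.1
  have h2 := ne_zero_of_re_pos (one_add_rootZ_re_pos hz.1)
  rw [← log_div_of_re_pos hz.1 (one_add_rootZ_re_pos hz.1)]
  congr 1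
  simp only [Pi.div_apply]
  have h3 : tZ z + 1 = (1 + rootZ z) / rootZ z := by rw [tZ]; field_simp
  rw [betaZ_eq_div, h3]
  field_simp

lemma tendsto_logFront_one (μ : ℂ) (ν M : ℝ) :
    Tendsto (logFront 1 μ ν) (coneAt M) (𝓝 0) := by
  have h1 : Tendsto (fun z => Complex.log (1 + z - ((1 : ℝ) : ℂ) * rootZ z)) (coneAt M)
      (𝓝 (Complex.log (1 - 0))) := by
    refine (((tendsto_rootZ_sub M).const_sub 1).clog (by simp)).congr fun z => ?_
    congr 1; push_cast; ring
  have h := (((h1.const_mul μ).add ((tendsto_log_sub_log_rootZ M).div_const 2))).add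
    (((tendsto_rootZ_sub M).add (tendsto_log_sub_log_one_add_rootZ M)).const_mul (ν : ℂ))
  simp only [sub_zero, Complex.log_one, mul_zero, zero_div, add_zero] at h
  refine h.congr fun z => ?_
  rw [logFront]; push_cast; ring

/-- For σ = −1 the front factor is asymptotic to (2z)^μ e^{−2νz}, whereas for σ = 1 it tends to 1.
-/
lemma tendsto_logFront_neg_one (μ : ℂ) (ν M : ℝ) :
    Tendsto (fun z => logFront (-1) μ ν z + 2 * ν * z - μ * Complex.log (2 * z)) (coneAt M)
      (𝓝 0) := by
  have h1 : Tendsto (fun z => Complex.log (1 + z + rootZ z) - Complex.log (2 * z)) (coneAt M)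
      (𝓝 0) := by
    have h := ((((tendsto_tZ M).add (tendsto_betaZ M)).add_const 1).div
      ((tendsto_betaZ M).const_mul 2) (by simp)).clog (by norm_num)
    have e : (0 + 1 + 1 : ℂ) / (2 * 1) = 1 := by norm_num
    rw [e, Complex.log_one] at h
    refine h.congr' ?_
    filter_upwards [eventually_mem_cone M] with z hz
    have h1 := rootZ_ne_zero hz.1
    have h0 := ne_zero_of_re_pos hz.1
    have h2 : 0 < (1 + z + rootZ z).re := by
      have := one_add_sub_rootZ_re_pos (σ := -1) (Or.inr rfl) hz.1
      simpa using this
    rw [← log_div_of_re_pos h2 (by simpa using hz.1)]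
    congr 1
    simp only [Pi.div_apply]
    have h3 : tZ z + betaZ z + 1 = (1 + z + rootZ z) / rootZ z := by
      rw [betaZ, tZ]; field_simp
    rw [h3, betaZ_eq_div]
    field_simp
  have h := (((h1.const_mul μ).add ((tendsto_log_sub_log_rootZ M).div_const 2))).sub
    (((tendsto_rootZ_sub M).add (tendsto_log_sub_log_one_add_rootZ M)).const_mul (ν : ℂ))
  simp only [sub_zero, mul_zero, zero_div, add_zero] at h
  refine h.congr fun z => ?_
  rw [logFront]
  have e : 1 + z - ((-1 : ℝ) : ℂ) * rootZ z = 1 + z + rootZ z := by push_cast; ring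
  rw [e]; push_cast; ring

lemma continuousAt_rootZ_zero : ContinuousAt rootZ 0 := by
  unfold rootZ
  refine ContinuousAt.cpow (by fun_prop) (by fun_prop) ?_
  simp

lemma rootZ_zero : rootZ 0 = 1 := by simp [rootZ]

/-- Near the origin the front factor of the `σ = 1` solution behaves like `z^{ν+1/2+μ}`. -/
lemma exists_bound_front_near_zero (μ : ℂ) (ν : ℝ) : ∃ C r₀ : ℝ, 0 < r₀ ∧ ∀ z : ℂ, 0 < z.re →
    ‖z‖ ≤ r₀ → ‖Complex.exp ((ν + 1 / 2 + μ) * Complex.log z - logFront 1 μ ν z)‖ ≤ C := by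
  set f : ℂ → ℂ := fun z => Complex.exp (μ * (Complex.log (1 + z + rootZ z) - ((Real.log 2 : ℝ) : ℂ))
    + Complex.log (rootZ z) / 2 + ν * z - ν * (rootZ z - Complex.log (1 + rootZ z))) with hf
  have hc : ContinuousAt f 0 := by
    have h := continuousAt_rootZ_zero
    have h1 : ContinuousAt (fun z => Complex.log (1 + z + rootZ z)) 0 :=
      ContinuousAt.clog (by fun_prop) (by rw [rootZ_zero]; norm_num)
    have h2 : ContinuousAt (fun z => Complex.log (rootZ z)) 0 :=
      ContinuousAt.clog h (by rw [rootZ_zero]; norm_num)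
    have h3 : ContinuousAt (fun z => Complex.log (1 + rootZ z)) 0 :=
      ContinuousAt.clog (by fun_prop) (by rw [rootZ_zero]; norm_num)
    fun_prop
  have hev : ∀ᶠ z in 𝓝 (0 : ℂ), ‖f z‖ < ‖f 0‖ + 1 :=
    hc.norm.eventually_lt_const (by linarith)
  obtain ⟨r, hr, hball⟩ := Metric.eventually_nhds_iff.1 hev
  refine ⟨‖f 0‖ + 1, r / 2, by positivity, fun z hz hzr => ?_⟩
  have hb := hball (y := z) (by rw [dist_zero_right]; linarith)
  refine le_trans (le_of_eq ?_) hb.le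
  congr 2
  have h0 : 0 < (1 + z + rootZ z).re := by
    have := one_add_sub_rootZ_re_pos (σ := -1) (Or.inr rfl) hz
    simpa using this
  have h00 := ne_zero_of_re_pos h0
  -- From (1+z)² − R² = 2z. This exposes the linear zero of 1 + z − R at the origin, so that
  -- everything left after removing the power of z is continuous there.
  have h2 : (1 + z - ((1 : ℝ) : ℂ) * rootZ z) = (2 * z) / (1 + z + rootZ z) := by
    rw [eq_div_iff h00]; push_cast
    linear_combination -rootZ_sq z
  have h3 : Complex.log (2 * z) = ((Real.log 2 : ℝ) : ℂ) + Complex.log z := by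
    have := Complex.log_ofReal_mul (r := 2) two_pos (ne_zero_of_re_pos hz)
    rwa [Complex.ofReal_ofNat] at this
  rw [logFront, h2, log_div_of_re_pos (by simpa using hz) h0, h3]
  push_cast; ring

/-! ### Laplace transforms of functions of subexponential growth -/

/-- Continuous on `(0,∞)` and of subexponential growth. -/
structure SubExp (f : ℝ → ℂ) : Prop where
  cont : ContinuousOn f (Ioi 0)
  bound : ∀ a : ℝ, 0 < a → ∃ C, ∀ t : ℝ, 0 < t → ‖f t‖ ≤ C * Real.exp (a * t)

/-- The Laplace transform. -/
def laplaceInt (f : ℝ → ℂ) (x : ℂ) : ℂ := ∫ t in Ioi (0 : ℝ), f t * Complex.exp (-(x * t))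

lemma SubExp.mul_id {f : ℝ → ℂ} (hf : SubExp f) : SubExp (fun t => (t : ℂ) * f t) := by
  refine ⟨by have := hf.cont; fun_prop, fun a ha => ?_⟩
  obtain ⟨C, hC⟩ := hf.bound (a / 2) (by positivity)
  refine ⟨2 / a * C, fun t ht => ?_⟩
  rw [norm_mul, Complex.norm_real, Real.norm_of_nonneg ht.le]
  have h1 : t ≤ 2 / a * Real.exp (a / 2 * t) := by
    have := Real.add_one_le_exp (a / 2 * t)
    rw [div_mul_eq_mul_div, le_div_iff₀ ha]; linarith
  calc t * ‖f t‖ ≤ (2 / a * Real.exp (a / 2 * t)) * (C * Real.exp (a / 2 * t)) :=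
        mul_le_mul h1 (hC t ht) (norm_nonneg _) (by positivity)
    _ = 2 / a * C * (Real.exp (a / 2 * t) * Real.exp (a / 2 * t)) := by ring
    _ = _ := by rw [← Real.exp_add]; congr 2; ring

lemma norm_exp_neg_mul (x : ℂ) (t : ℝ) :
    ‖Complex.exp (-(x * t))‖ = Real.exp (-(x.re * t)) := by
  rw [Complex.norm_exp]; simp

lemma SubExp.measurable {f : ℝ → ℂ} (hf : SubExp f) (x : ℂ) : AEStronglyMeasurable
    (fun t : ℝ => f t * Complex.exp (-(x * t))) (volume.restrict (Ioi 0)) := by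
  have := hf.cont
  exact ContinuousOn.aestronglyMeasurable (by fun_prop) measurableSet_Ioi

lemma SubExp.integrable {f : ℝ → ℂ} (hf : SubExp f) {x : ℂ} (hx : 0 < x.re) :
    IntegrableOn (fun t : ℝ => f t * Complex.exp (-(x * t))) (Ioi 0) := by
  obtain ⟨C, hC⟩ := hf.bound (x.re / 2) (by positivity)
  refine ((exp_neg_integrableOn_Ioi 0 (half_pos hx)).const_mul C).mono' (hf.measurable x) ?_
  refine (ae_restrict_iff' measurableSet_Ioi).2 (Eventually.of_forall fun t ht => ?_)
  rw [norm_mul, norm_exp_neg_mul]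
  calc ‖f t‖ * Real.exp (-(x.re * t)) ≤ (C * Real.exp (x.re / 2 * t)) * Real.exp (-(x.re * t)) :=
        mul_le_mul_of_nonneg_right (hC t ht) (Real.exp_pos _).le
    _ = _ := by rw [mul_assoc, ← Real.exp_add]; congr 2; ring

lemma SubExp.hasDerivAt {f : ℝ → ℂ} (hf : SubExp f) {x : ℂ} (hx : 0 < x.re) :
    HasDerivAt (laplaceInt f) (-laplaceInt (fun t => (t : ℂ) * f t) x) x := by
  obtain ⟨C, hC⟩ := hf.mul_id.bound (x.re / 4) (by positivity)
  have hs : {w : ℂ | x.re / 2 < w.re} ∈ 𝓝 x :=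
    (isOpen_lt continuous_const Complex.continuous_re).mem_nhds (by simp only [mem_ofPred_eq]; linarith)
  have main := hasDerivAt_integral_of_dominated_loc_of_deriv_le
    (μ := volume.restrict (Ioi (0 : ℝ))) (F := fun w (t : ℝ) => f t * Complex.exp (-(w * t)))
    (F' := fun w (t : ℝ) => -((t : ℂ) * f t * Complex.exp (-(w * t)))) (x₀ := x)
    (bound := fun t => C * Real.exp (-(x.re / 4) * t)) hs
    (Eventually.of_forall fun w => hf.measurable w) (hf.integrable hx)
    (hf.mul_id.measurable x).neg
    ((ae_restrict_iff' measurableSet_Ioi).2 (Eventually.of_forall fun t ht w hw => ?_))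
    ((exp_neg_integrableOn_Ioi 0 (by positivity)).const_mul C)
    (Eventually.of_forall fun t w _ => ?_)
  · refine main.2.congr_deriv ?_
    rw [integral_neg]; rfl
  · have ht : 0 < t := ht
    have hw : x.re / 2 < w.re := hw
    rw [norm_neg, norm_mul, norm_exp_neg_mul]
    calc ‖(t : ℂ) * f t‖ * Real.exp (-(w.re * t))
        ≤ (C * Real.exp (x.re / 4 * t)) * Real.exp (-(x.re / 2 * t)) := by
          refine mul_le_mul (hC t ht) (Real.exp_le_exp.2 ?_) (Real.exp_pos _).le
            ((norm_nonneg _).trans (hC t ht))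
          nlinarith
      _ = _ := by rw [mul_assoc, ← Real.exp_add]; congr 2; ring
  · have h1 : HasDerivAt (fun w : ℂ => -(w * t)) (-(t : ℂ)) w := by
      simpa using ((hasDerivAt_id w).mul_const (t : ℂ)).fun_neg
    refine (h1.cexp.const_mul (f t)).congr_deriv ?_
    ring

lemma exists_one_add_pow_le (p : ℕ) {a : ℝ} (ha : 0 < a) :
    ∃ C, 0 < C ∧ ∀ t : ℝ, 0 ≤ t → (1 + t) ^ p ≤ C * Real.exp (a * t) := by
  refine ⟨p.factorial / a ^ p * Real.exp a, by positivity, fun t ht => ?_⟩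
  have h := Real.pow_div_factorial_le_exp (a * (1 + t)) (by positivity) p
  rw [div_le_iff₀ (by positivity), mul_pow] at h
  have e : Real.exp (a * (1 + t)) = Real.exp a * Real.exp (a * t) := by
    rw [← Real.exp_add]; congr 1; ring
  rw [e] at h
  have h2 : (1 + t) ^ p ≤ Real.exp a * Real.exp (a * t) * p.factorial / a ^ p := by
    rw [le_div_iff₀ (by positivity)]; linarith
  refine h2.trans (le_of_eq ?_)
  ring

lemma norm_one_add_cpow_le (m : ℂ) {t : ℝ} (ht : 0 ≤ t) :
    ‖(1 + (t : ℂ)) ^ m‖ ≤ (1 + t) ^ ⌈|m.re|⌉₊ := by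
  have e : (1 + (t : ℂ)) = ((1 + t : ℝ) : ℂ) := by push_cast; ring
  rw [e, Complex.norm_cpow_eq_rpow_re_of_pos (by linarith), ← Real.rpow_natCast]
  exact Real.rpow_le_rpow_of_exponent_le (by linarith) ((le_abs_self _).trans (Nat.le_ceil _))

lemma subExp_tricomi (n : ℕ) (m : ℂ) :
    SubExp (fun t : ℝ => (t : ℂ) ^ n * (1 + (t : ℂ)) ^ m) := by
  refine ⟨fun t ht => ?_, fun a ha => ?_⟩
  · have ht : 0 < t := ht
    apply ContinuousAt.continuousWithinAt
    refine ContinuousAt.mul (by fun_prop) (ContinuousAt.cpow (by fun_prop) continuousAt_const ?_)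
    left; simp; linarith
  · obtain ⟨C, hC0, hC⟩ := exists_one_add_pow_le (n + ⌈|m.re|⌉₊) ha
    refine ⟨C, fun t ht => le_trans ?_ (hC t ht.le)⟩
    rw [norm_mul, norm_pow, Complex.norm_real, Real.norm_of_nonneg ht.le, pow_add]
    have h1 : t ^ n ≤ (1 + t) ^ n := pow_le_pow_left₀ ht.le (by linarith) n
    exact mul_le_mul h1 (norm_one_add_cpow_le m ht.le) (norm_nonneg _) (by positivity)

/-- The integral in Tricomi's function, `∫_0^∞ t^n (1+t)^m e^{-xt} dt`. -/
def tricomiInt (n : ℕ) (m x : ℂ) : ℂ := laplaceInt (fun t : ℝ => (t : ℂ) ^ n * (1 + (t : ℂ)) ^ m) x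

lemma hasDerivAt_tricomiInt (n : ℕ) (m : ℂ) {x : ℂ} (hx : 0 < x.re) :
    HasDerivAt (tricomiInt n m) (-tricomiInt (n + 1) m x) x := by
  refine ((subExp_tricomi n m).hasDerivAt hx).congr_deriv ?_
  simp only [tricomiInt]
  congr 2
  ext t; ring

lemma tricomiInt_add_one (n : ℕ) (m : ℂ) {x : ℂ} (hx : 0 < x.re) :
    tricomiInt n (m + 1) x = tricomiInt n m x + tricomiInt (n + 1) m x := by
  simp only [tricomiInt, laplaceInt]
  rw [← integral_add ((subExp_tricomi n m).integrable hx)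
    ((subExp_tricomi (n + 1) m).integrable hx)]
  refine setIntegral_congr_fun measurableSet_Ioi fun t ht => ?_
  have ht : 0 < t := ht
  have h0 : 1 + (t : ℂ) ≠ 0 := by exact_mod_cast (by positivity : 1 + t ≠ 0)
  rw [Complex.cpow_add _ _ h0, Complex.cpow_one]
  ring

/-- Integration by parts in Tricomi's integral. -/
lemma tricomiInt_parts (n : ℕ) (m : ℂ) {x : ℂ} (hx : 0 < x.re) :
    (n + 1) * tricomiInt n (m + 1) x + (m + 1) * tricomiInt (n + 1) m x
      = x * tricomiInt (n + 1) (m + 1) x := by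
  have hd : ∀ t ∈ Ici (0 : ℝ), HasDerivAt
      (fun t : ℝ => (t : ℂ) ^ (n + 1) * (1 + (t : ℂ)) ^ (m + 1) * Complex.exp (-(x * t)))
      ((n + 1) * ((t : ℂ) ^ n * (1 + (t : ℂ)) ^ (m + 1) * Complex.exp (-(x * t)))
        + (m + 1) * ((t : ℂ) ^ (n + 1) * (1 + (t : ℂ)) ^ m * Complex.exp (-(x * t)))
        - x * ((t : ℂ) ^ (n + 1) * (1 + (t : ℂ)) ^ (m + 1) * Complex.exp (-(x * t)))) t := by
    intro t ht
    have ht : 0 ≤ t := ht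
    have h1 : HasDerivAt (fun t : ℂ => t ^ (n + 1)) ((n + 1) * (t : ℂ) ^ n) (t : ℂ) := by
      simpa using hasDerivAt_pow (n + 1) (t : ℂ)
    have h2 : HasDerivAt (fun t : ℂ => (1 + t) ^ (m + 1)) ((m + 1) * (1 + (t : ℂ)) ^ m) (t : ℂ) := by
      have := ((hasDerivAt_id (t : ℂ)).const_add 1).cpow_const (c := m + 1)
        (by left; simp; linarith)
      simpa using this
    have h3 : HasDerivAt (fun t : ℂ => -(x * t)) (-x) (t : ℂ) := by
      simpa using ((hasDerivAt_id (t : ℂ)).const_mul x).fun_neg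
    refine ((h1.mul h2).mul h3.cexp).comp_ofReal.congr_deriv ?_
    simp only [Pi.mul_apply]
    ring
  have i1 := ((subExp_tricomi n (m + 1)).integrable hx).const_mul ((n : ℂ) + 1)
  have i2 := ((subExp_tricomi (n + 1) m).integrable hx).const_mul (m + 1)
  have i3 := ((subExp_tricomi (n + 1) (m + 1)).integrable hx).const_mul x
  have hlim : Tendsto
      (fun t : ℝ => (t : ℂ) ^ (n + 1) * (1 + (t : ℂ)) ^ (m + 1) * Complex.exp (-(x * t)))
      atTop (𝓝 0) := by
    obtain ⟨C, hC⟩ := (subExp_tricomi (n + 1) (m + 1)).bound (x.re / 2) (by positivity)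
    have h0 : Tendsto (fun t : ℝ => C * Real.exp (-(x.re / 2 * t))) atTop (𝓝 (C * 0)) := by
      apply Tendsto.const_mul
      apply Real.tendsto_exp_neg_atTop_nhds_zero.comp
      exact tendsto_id.const_mul_atTop (half_pos hx)
    rw [mul_zero] at h0
    refine squeeze_zero_norm' ?_ h0
    filter_upwards [eventually_gt_atTop 0] with t ht
    rw [norm_mul, norm_exp_neg_mul]
    calc _ ≤ (C * Real.exp (x.re / 2 * t)) * Real.exp (-(x.re * t)) :=
        mul_le_mul_of_nonneg_right (hC t ht) (Real.exp_pos _).le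
      _ = _ := by rw [mul_assoc, ← Real.exp_add]; congr 2; ring
  have hI := integral_Ioi_of_hasDerivAt_of_tendsto' hd ((i1.add i2).sub i3) hlim
  have e : ∫ t in Ioi (0 : ℝ),
      ((n + 1) * ((t : ℂ) ^ n * (1 + (t : ℂ)) ^ (m + 1) * Complex.exp (-(x * t)))
        + (m + 1) * ((t : ℂ) ^ (n + 1) * (1 + (t : ℂ)) ^ m * Complex.exp (-(x * t)))
        - x * ((t : ℂ) ^ (n + 1) * (1 + (t : ℂ)) ^ (m + 1) * Complex.exp (-(x * t))))
      = (n + 1) * tricomiInt n (m + 1) x + (m + 1) * tricomiInt (n + 1) m x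
        - x * tricomiInt (n + 1) (m + 1) x := by
    have i12 : Integrable (fun t : ℝ =>
        (n + 1) * ((t : ℂ) ^ n * (1 + (t : ℂ)) ^ (m + 1) * Complex.exp (-(x * t)))
        + (m + 1) * ((t : ℂ) ^ (n + 1) * (1 + (t : ℂ)) ^ m * Complex.exp (-(x * t))))
        (volume.restrict (Ioi 0)) := i1.add i2
    rw [integral_sub i12 i3, integral_add i1 i2]
    simp only [integral_const_mul]
    rfl
  rw [e] at hI
  simp at hI
  linear_combination hI

/-! ### The function U as a Laplace integral, and its behaviour at infinity. -/

lemma genBesselU_eq (n : ℕ) (μ ζ : ℂ) :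
    genBesselU n μ ζ = (-1) ^ n * (2 / ζ) ^ ((n : ℂ) + μ + 1) * Complex.exp (-(2 / ζ))
      / Complex.Gamma ((n : ℂ) + μ + 1) * tricomiInt n (n + μ) (2 / ζ) := by
  have h : kummerU ((n : ℂ) + 1) (2 * (n : ℂ) + μ + 2) (2 / ζ)
      = (n.factorial : ℂ)⁻¹ * tricomiInt n (n + μ) (2 / ζ) := by
    rw [kummerU, Complex.Gamma_nat_eq_factorial, tricomiInt, laplaceInt]
    congr 1
    refine setIntegral_congr_fun measurableSet_Ioi fun t _ => ?_
    rw [show (n : ℂ) + 1 - 1 = n by ring, Complex.cpow_natCast]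
    congr 3
    ring
  have hn : (n.factorial : ℂ) ≠ 0 := by exact_mod_cast n.factorial_ne_zero
  rw [genBesselU, h]
  field_simp

lemma norm_one_add_cpow_sub_one_le (m : ℂ) {t : ℝ} (ht : 0 ≤ t) :
    ‖(1 + (t : ℂ)) ^ m - 1‖ ≤ ‖m‖ * (1 + t) ^ ⌈|(m - 1).re|⌉₊ * t := by
  have hd : ∀ s ∈ Icc 0 t, HasDerivWithinAt (fun s : ℝ => (1 + (s : ℂ)) ^ m)
      (m * (1 + (s : ℂ)) ^ (m - 1)) (Icc 0 t) s := by
    intro s hs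
    have h2 : HasDerivAt (fun t : ℂ => (1 + t) ^ m) (m * (1 + (s : ℂ)) ^ (m - 1)) (s : ℂ) := by
      have := ((hasDerivAt_id (s : ℂ)).const_add 1).cpow_const (c := m)
        (by left; simp; linarith [hs.1])
      simpa using this
    exact h2.comp_ofReal.hasDerivWithinAt
  have h := (convex_Icc 0 t).norm_image_sub_le_of_norm_hasDerivWithin_le
    (C := ‖m‖ * (1 + t) ^ ⌈|(m - 1).re|⌉₊) hd (fun s hs => ?_) (left_mem_Icc.2 ht)
    (right_mem_Icc.2 ht)
  · simpa [abs_of_nonneg ht] using h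
  · rw [norm_mul]
    refine mul_le_mul_of_nonneg_left ((norm_one_add_cpow_le _ hs.1).trans ?_) (norm_nonneg _)
    exact pow_le_pow_left₀ (by linarith [hs.1]) (by linarith [hs.2]) _

lemma subExp_cpow {a : ℂ} (ha : 0 ≤ a.re) : SubExp (fun t : ℝ => (t : ℂ) ^ a) := by
  refine ⟨fun t ht => ?_, fun c hc => ?_⟩
  · apply ContinuousAt.continuousWithinAt
    exact ContinuousAt.cpow (by fun_prop) continuousAt_const (Or.inl (by simpa using ht))
  · obtain ⟨C, hC0, hC⟩ := exists_one_add_pow_le ⌈|a.re|⌉₊ hc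
    refine ⟨C, fun t ht => le_trans ?_ (hC t ht.le)⟩
    refine le_trans ?_ (norm_one_add_cpow_le (a.re : ℂ) ht.le)
    have e : (1 + (t : ℂ)) = ((1 + t : ℝ) : ℂ) := by push_cast; ring
    rw [e, Complex.norm_cpow_eq_rpow_re_of_pos ht,
      Complex.norm_cpow_eq_rpow_re_of_pos (by linarith), Complex.ofReal_re]
    exact Real.rpow_le_rpow ht.le (by linarith) ha

/-- Euler's integral with a complex scaling factor. -/
lemma laplaceInt_cpow {a : ℂ} (ha : 1 ≤ a.re) {x : ℂ} (hx : 0 < x.re) :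
    laplaceInt (fun t : ℝ => (t : ℂ) ^ (a - 1)) x = x ^ (-a) * Complex.Gamma a := by
  have hs : SubExp (fun t : ℝ => (t : ℂ) ^ (a - 1)) := subExp_cpow (by simpa using ha)
  have h1 : AnalyticOnNhd ℂ (laplaceInt (fun t : ℝ => (t : ℂ) ^ (a - 1))) {x | 0 < x.re} :=
    DifferentiableOn.analyticOnNhd (fun x hx =>
      (hs.hasDerivAt hx).differentiableAt.differentiableWithinAt) isOpen_re_pos
  have h2 : AnalyticOnNhd ℂ (fun x : ℂ => x ^ (-a) * Complex.Gamma a) {x | 0 < x.re} :=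
    DifferentiableOn.analyticOnNhd (fun x hx =>
      (((hasDerivAt_id x).cpow_const (mem_slitPlane_of_re_pos hx)).mul_const
        _).differentiableAt.differentiableWithinAt) isOpen_re_pos
  -- Both sides are holomorphic on the half-plane and agree at positive reals, which accumulate at
  -- 1.
  refine h1.eqOn_of_preconnected_of_frequently_eq h2
    (convex_halfSpace_re_gt 0).isPreconnected (z₀ := 1) (by simp) ?_ hx
  have htend : Tendsto (fun u : ℝ => (u : ℂ)) (𝓝[≠] 1) (𝓝[≠] 1) := by
    refine tendsto_nhdsWithin_iff.2 ⟨?_, ?_⟩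
    · exact (Complex.continuous_ofReal.tendsto' 1 1 (by simp)).mono_left nhdsWithin_le_nhds
    · filter_upwards [self_mem_nhdsWithin] with u hu
      simpa using hu
  refine htend.frequently (Eventually.frequently ?_)
  filter_upwards [nhdsWithin_le_nhds (Ioi_mem_nhds one_pos)] with u hu
  have hu : 0 < u := hu
  have h := Complex.integral_cpow_mul_exp_neg_mul_Ioi (a := a) (by linarith) hu
  rw [laplaceInt, h, one_div, ← Complex.ofReal_inv, Complex.cpow_neg, Complex.ofReal_inv,
    Complex.inv_cpow _ _ (by rw [Complex.arg_ofReal_of_nonneg hu.le]; exact Real.pi_pos.ne)]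

lemma integral_pow_mul_exp_neg (n : ℕ) {x : ℂ} (hx : 0 < x.re) :
    ∫ t in Ioi (0 : ℝ), (t : ℂ) ^ n * Complex.exp (-(x * t)) = n.factorial / x ^ (n + 1) := by
  have h := laplaceInt_cpow (a := (n : ℂ) + 1) (by simp) hx
  rw [laplaceInt, Complex.Gamma_nat_eq_factorial, add_sub_cancel_right] at h
  simp only [Complex.cpow_natCast] at h
  rw [h, show -((n : ℂ) + 1) = -((n + 1 : ℕ) : ℂ) by push_cast; ring, Complex.cpow_neg,
    Complex.cpow_natCast]
  ring

/-- Watson's lemma at leading order: replacing (1+t)^m by 1 costs O(t(1+t)^p) in the integrand,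
hence O((Re x)^{−n−2}) in the integral, and |x| ≤ M Re x on the cone. -/
lemma tendsto_tricomiInt (n : ℕ) (m : ℂ) (M : ℝ) :
    Tendsto (fun x => x ^ (n + 1) * tricomiInt n m x) (coneAt M) (𝓝 n.factorial) := by
  set p := ⌈|(m - 1).re|⌉₊
  obtain ⟨C, hC0, hC⟩ := exists_one_add_pow_le p (a := 1 / 2) (by norm_num)
  set D : ℝ := ‖m‖ * C * (n + 1).factorial * 2 ^ (n + 2) * |M| ^ (n + 1) with hD
  have hlim : Tendsto (fun x : ℂ => D * (x.re)⁻¹) (coneAt M) (𝓝 (D * 0)) :=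
    (tendsto_inv_atTop_zero.comp (tendsto_re_coneAt M)).const_mul D
  rw [mul_zero] at hlim
  have key : Tendsto (fun x => x ^ (n + 1) * tricomiInt n m x - n.factorial) (coneAt M) (𝓝 0) := by
    refine squeeze_zero_norm' ?_ hlim
    filter_upwards [eventually_mem_cone M, (tendsto_re_coneAt M).eventually_ge_atTop 1] with x hx h1
    have hx0 := ne_zero_of_re_pos hx.1
    have e1 : x ^ (n + 1) * tricomiInt n m x - n.factorial = x ^ (n + 1) *
        ∫ t in Ioi (0 : ℝ), (t : ℂ) ^ n * ((1 + (t : ℂ)) ^ m - 1) * Complex.exp (-(x * t)) := by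
      have hi : IntegrableOn (fun t : ℝ => (t : ℂ) ^ n * Complex.exp (-(x * t))) (Ioi 0) := by
        have := (subExp_tricomi n 0).integrable hx.1
        simpa using this
      have : ∫ t in Ioi (0 : ℝ), (t : ℂ) ^ n * ((1 + (t : ℂ)) ^ m - 1) * Complex.exp (-(x * t))
          = tricomiInt n m x - n.factorial / x ^ (n + 1) := by
        rw [← integral_pow_mul_exp_neg n hx.1, tricomiInt, laplaceInt,
          ← integral_sub ((subExp_tricomi n m).integrable hx.1) hi]
        congr 1
        ext t; ring
      rw [this]; field_simp
    have hr : 0 < x.re / 2 := half_pos hx.1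
    have e2 : ‖∫ t in Ioi (0 : ℝ),
        (t : ℂ) ^ n * ((1 + (t : ℂ)) ^ m - 1) * Complex.exp (-(x * t))‖ ≤
        ‖m‖ * C * ((n + 1).factorial / (x.re / 2) ^ (n + 2)) := by
      have hre := integral_pow_mul_exp_neg (n + 1) (x := ((x.re / 2 : ℝ) : ℂ)) (by simpa using hr)
      have hint : IntegrableOn (fun t : ℝ => t ^ (n + 1) * Real.exp (-(x.re / 2 * t))) (Ioi 0) := by
        have := ((subExp_tricomi (n + 1) 0).integrable
          (x := ((x.re / 2 : ℝ) : ℂ)) (by simpa using hr)).norm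
        refine IntegrableOn.congr_fun (f := _) this (fun t ht => ?_) measurableSet_Ioi
        have ht : 0 < t := ht
        rw [norm_mul, norm_exp_neg_mul]
        simp [abs_of_pos ht]
      have hre' : ∫ t in Ioi (0 : ℝ), t ^ (n + 1) * Real.exp (-(x.re / 2 * t))
          = (n + 1).factorial / (x.re / 2) ^ (n + 2) := by
        rw [← Complex.ofReal_inj, ← integral_complex_ofReal]
        push_cast at hre ⊢
        exact hre
      rw [← hre', ← integral_const_mul]
      refine norm_integral_le_of_norm_le (hint.const_mul _) ?_
      refine (ae_restrict_iff' measurableSet_Ioi).2 (Eventually.of_forall fun t ht => ?_)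
      have ht : 0 < t := ht
      rw [norm_mul, norm_mul, norm_pow, Complex.norm_real, Real.norm_of_nonneg ht.le,
        norm_exp_neg_mul]
      have h3 : ‖(1 + (t : ℂ)) ^ m - 1‖ ≤ ‖m‖ * (C * Real.exp (1 / 2 * t)) * t := by
        refine (norm_one_add_cpow_sub_one_le m ht.le).trans ?_
        gcongr
        exact hC t ht.le
      have h4 : Real.exp (1 / 2 * t) * Real.exp (-(x.re * t)) ≤ Real.exp (-(x.re / 2 * t)) := by
        rw [← Real.exp_add, Real.exp_le_exp]; nlinarith
      calc t ^ n * ‖(1 + (t : ℂ)) ^ m - 1‖ * Real.exp (-(x.re * t))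
          ≤ t ^ n * (‖m‖ * (C * Real.exp (1 / 2 * t)) * t) * Real.exp (-(x.re * t)) := by gcongr
        _ = ‖m‖ * C * t ^ (n + 1) * (Real.exp (1 / 2 * t) * Real.exp (-(x.re * t))) := by ring
        _ ≤ ‖m‖ * C * t ^ (n + 1) * Real.exp (-(x.re / 2 * t)) := by gcongr
        _ = _ := by ring
    have hM := one_le_of_mem_cone hx
    rw [e1, norm_mul, norm_pow]
    calc ‖x‖ ^ (n + 1) * _ ≤ (|M| * x.re) ^ (n + 1) *
          (‖m‖ * C * ((n + 1).factorial / (x.re / 2) ^ (n + 2))) := by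
          refine mul_le_mul (pow_le_pow_left₀ (norm_nonneg _) ?_ _) e2 (norm_nonneg _)
            (by have := hx.1; positivity)
          rw [abs_of_nonneg (by linarith)]; exact hx.2
      _ = D * (x.re)⁻¹ := by
          have := hx.1.ne'
          rw [hD, mul_pow, div_pow]; field_simp; ring
  simpa using key.add_const (n.factorial : ℂ)

/-! ### The three solutions of the differential equation -/

/-- The differential equation in the variable `x = 2νz`. -/
structure KummerSolution (n : ℕ) (μ : ℂ) (g g₁ : ℂ → ℂ) : Prop where
  deriv : ∀ x, 0 < x.re → HasDerivAt g (g₁ x / x) x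
  deriv_theta : ∀ x, 0 < x.re →
    HasDerivAt g₁ ((-((x - 1 - μ) * g₁ x) + n * (n + 1 + μ) * g x) / x) x

lemma re_two_mul_nuN_mul_pos (n : ℕ) {z : ℂ} (hz : 0 < z.re) : 0 < (2 * nuN n * z : ℂ).re := by
  have h : (2 * nuN n * z : ℂ) = ((2 * nuN n : ℝ) : ℂ) * z := by push_cast; ring
  rw [h, Complex.re_ofReal_mul]
  have := nuN_pos n
  positivity

lemma KummerSolution.besselSolution {n : ℕ} {μ : ℂ} {g g₁ : ℂ → ℂ} (h : KummerSolution n μ g g₁) :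
    BesselSolution μ (nuN n) (fun z => g (2 * nuN n * z)) (fun z => g₁ (2 * nuN n * z)) := by
  have hν : (nuN n : ℂ) ≠ 0 := by exact_mod_cast (nuN_pos n).ne'
  have hl : ∀ z : ℂ, HasDerivAt (fun z : ℂ => 2 * (nuN n : ℂ) * z) (2 * nuN n) z := fun z => by
    simpa using (hasDerivAt_id z).const_mul (2 * nuN n : ℂ)
  refine ⟨fun z hz => ?_, fun z hz => ?_⟩
  · have hz0 := ne_zero_of_re_pos hz
    refine (HasDerivAt.comp (h₂ := g) z (h.deriv _ (re_two_mul_nuN_mul_pos n hz))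
      (hl z)).congr_deriv ?_
    field_simp
  · have hz0 := ne_zero_of_re_pos hz
    refine (HasDerivAt.comp (h₂ := g₁) z (h.deriv_theta _ (re_two_mul_nuN_mul_pos n hz))
      (hl z)).congr_deriv ?_
    have : (n : ℂ) = nuN n - 1 / 2 := by rw [nuN]; push_cast; ring
    rw [this]
    field_simp
    ring

lemma BesselSolution.const_mul {μ : ℂ} {ν : ℝ} {G G₁ : ℂ → ℂ} (h : BesselSolution μ ν G G₁)
    (c : ℂ) : BesselSolution μ ν (fun z => c * G z) (fun z => c * G₁ z) :=
  ⟨fun z hz => ((h.deriv z hz).const_mul c).congr_deriv (by ring),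
    fun z hz => ((h.deriv_theta z hz).const_mul c).congr_deriv (by ring)⟩

/-- Differentiating under the integral raises n, and `tricomiInt_parts` with m = n + μ, after
eliminating the exponent m + 1, is exactly the relation closing the second-order equation. -/
lemma kummerSolution_tricomi (n : ℕ) (μ : ℂ) :
    KummerSolution n μ (fun x => x ^ ((n : ℂ) + μ + 1) * Complex.exp (-x) * tricomiInt n (n + μ) x)
      (fun x => x ^ ((n : ℂ) + μ + 1) * Complex.exp (-x) *
        ((n + μ + 1 - x) * tricomiInt n (n + μ) x - x * tricomiInt (n + 1) (n + μ) x)) := by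
  have hp : ∀ x : ℂ, 0 < x.re → HasDerivAt (fun x : ℂ => x ^ ((n : ℂ) + μ + 1) * Complex.exp (-x))
      (x ^ ((n : ℂ) + μ + 1) * Complex.exp (-x) * ((n + μ + 1 - x) / x)) x := by
    intro x hx
    have hx0 := ne_zero_of_re_pos hx
    have h1 := (hasDerivAt_id x).cpow_const (c := (n : ℂ) + μ + 1) (mem_slitPlane_of_re_pos hx)
    have h2 := (hasDerivAt_neg x).cexp
    refine (h1.mul h2).congr_deriv ?_
    simp only [id]
    rw [Complex.cpow_sub _ _ hx0, Complex.cpow_one]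
    field_simp
    ring
  refine ⟨fun x hx => ?_, fun x hx => ?_⟩
  · have hx0 := ne_zero_of_re_pos hx
    refine ((hp x hx).mul (hasDerivAt_tricomiInt n (n + μ) hx)).congr_deriv ?_
    field_simp
    ring
  · have hx0 := ne_zero_of_re_pos hx
    have hk0 := hasDerivAt_tricomiInt n (n + μ) hx
    have hk1 := hasDerivAt_tricomiInt (n + 1) (n + μ) hx
    have hlin : HasDerivAt (fun x : ℂ => (n : ℂ) + μ + 1 - x) (-1) x := by
      simpa using (hasDerivAt_id x).const_sub ((n : ℂ) + μ + 1)
    refine ((hp x hx).mul ((hlin.mul hk0).sub ((hasDerivAt_id x).mul hk1))).congr_deriv ?_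
    have h := tricomiInt_parts n (n + μ) hx
    rw [tricomiInt_add_one n _ hx, tricomiInt_add_one (n + 1) _ hx] at h
    simp only [Pi.sub_apply, Pi.mul_apply, id]
    field_simp
    linear_combination (-(x ^ ((n : ℂ) + μ + 1)) * x) * h

/-! ### The generalized Bessel polynomial -/

/-- The coefficient of `x^{-k}` in `Y_n^μ(-2/x)`. -/
def besselCoeff (n : ℕ) (μ : ℂ) (k : ℕ) : ℂ :=
  (n.choose k : ℂ) * (ascPochhammer ℂ k).eval ((n : ℂ) + μ + 1) * (-1) ^ k

lemma genBesselY_eq (n : ℕ) (μ x : ℂ) :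
    genBesselY n μ (-(2 / x)) = ∑ k ∈ Finset.range (n + 1), besselCoeff n μ k * (x⁻¹) ^ k := by
  refine Finset.sum_congr rfl fun k _ => ?_
  rw [besselCoeff, show -(2 / x) / 2 = (-1) * x⁻¹ by ring, mul_pow]
  ring

/-- At k = n both sides vanish, so the sum terminates by itself. The recursion is the differential
equation read coefficientwise. -/
lemma besselCoeff_succ (n : ℕ) (μ : ℂ) {k : ℕ} (hk : k ≤ n) :
    (k + 1) * besselCoeff n μ (k + 1) = -((n - k) * (n + μ + 1 + k)) * besselCoeff n μ k := by
  have h : ((n.choose (k + 1) : ℂ)) * (k + 1) = n.choose k * (n - k) := by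
    have := Nat.choose_succ_right_eq n k
    rw [← Nat.cast_sub hk]
    exact_mod_cast this
  rw [besselCoeff, besselCoeff, ascPochhammer_succ_eval, pow_succ]
  linear_combination (-(ascPochhammer ℂ k).eval ((n : ℂ) + μ + 1) * (n + μ + 1 + k) * (-1) ^ k) * h

lemma hasDerivAt_inv_pow (k : ℕ) {x : ℂ} (hx : x ≠ 0) :
    HasDerivAt (fun x : ℂ => (x⁻¹) ^ k) (-k * (x⁻¹) ^ k / x) x := by
  refine ((hasDerivAt_inv hx).fun_pow k).congr_deriv ?_
  cases k with
  | zero => simp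
  | succ k => simp only [Nat.add_sub_cancel, pow_succ]; field_simp

lemma kummerSolution_bessel (n : ℕ) (μ : ℂ) :
    KummerSolution n μ (fun x => genBesselY n μ (-(2 / x)))
      (fun x => ∑ k ∈ Finset.range (n + 1), besselCoeff n μ k * (-k * (x⁻¹) ^ k)) := by
  have hY : (fun x => genBesselY n μ (-(2 / x))) =
      fun x => ∑ k ∈ Finset.range (n + 1), besselCoeff n μ k * (x⁻¹) ^ k :=
    funext fun x => genBesselY_eq n μ x
  rw [hY]
  refine ⟨fun x hx => ?_, fun x hx => ?_⟩
  · have hx0 := ne_zero_of_re_pos hx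
    refine (HasDerivAt.fun_sum fun k _ =>
      (hasDerivAt_inv_pow k hx0).const_mul (besselCoeff n μ k)).congr_deriv ?_
    rw [Finset.sum_div]
    exact Finset.sum_congr rfl fun k _ => by ring
  · have hx0 := ne_zero_of_re_pos hx
    refine (HasDerivAt.fun_sum fun k _ =>
      ((hasDerivAt_inv_pow k hx0).const_mul (-(k : ℂ))).const_mul
        (besselCoeff n μ k)).congr_deriv ?_
    rw [eq_div_iff hx0, Finset.sum_mul]
    have h1 : ∑ k ∈ Finset.range (n + 1), ((k + 1) * besselCoeff n μ (k + 1)) * (x⁻¹) ^ k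
        = x * ∑ k ∈ Finset.range (n + 1), besselCoeff n μ k * (k * (x⁻¹) ^ k) := by
      rw [Finset.sum_range_succ, Finset.sum_range_succ' (fun k => besselCoeff n μ k * _),
        besselCoeff_succ n μ le_rfl]
      simp only [sub_self, zero_mul, neg_zero, Nat.cast_zero, mul_zero, add_zero]
      rw [Finset.mul_sum]
      refine Finset.sum_congr rfl fun k _ => ?_
      rw [pow_succ]; push_cast; field_simp
    have h2 : ∑ k ∈ Finset.range (n + 1), ((k + 1) * besselCoeff n μ (k + 1)) * (x⁻¹) ^ k
        = ∑ k ∈ Finset.range (n + 1), (k ^ 2 + (1 + μ) * k - n * (n + 1 + μ))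
          * besselCoeff n μ k * (x⁻¹) ^ k := by
      refine Finset.sum_congr rfl fun k hk => ?_
      rw [besselCoeff_succ n μ (Nat.lt_succ_iff.1 (Finset.mem_range.1 hk))]
      ring
    rw [h2] at h1
    have h3 : ∑ k ∈ Finset.range (n + 1), (k ^ 2 + (1 + μ) * k - n * (n + 1 + μ))
          * besselCoeff n μ k * (x⁻¹) ^ k
        = ∑ k ∈ Finset.range (n + 1), besselCoeff n μ k * (-k * (-k * (x⁻¹) ^ k / x)) * x
          + (1 + μ) * ∑ k ∈ Finset.range (n + 1), besselCoeff n μ k * (k * (x⁻¹) ^ k)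
          - n * (n + 1 + μ) * ∑ k ∈ Finset.range (n + 1), besselCoeff n μ k * (x⁻¹) ^ k := by
      rw [Finset.mul_sum, Finset.mul_sum, ← Finset.sum_add_distrib, ← Finset.sum_sub_distrib]
      refine Finset.sum_congr rfl fun k _ => ?_
      field_simp
    have h4 : ∑ k ∈ Finset.range (n + 1), besselCoeff n μ k * (-k * (x⁻¹) ^ k)
        = -∑ k ∈ Finset.range (n + 1), besselCoeff n μ k * (k * (x⁻¹) ^ k) := by
      rw [← Finset.sum_neg_distrib]
      exact Finset.sum_congr rfl fun k _ => by ring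
    rw [h4]
    linear_combination h1 - h3

lemma tendsto_genBesselY (n : ℕ) (μ : ℂ) (M : ℝ) :
    Tendsto (fun x => genBesselY n μ (-(2 / x))) (coneAt M) (𝓝 1) := by
  have h0 : Tendsto (fun x : ℂ => x⁻¹) (coneAt M) (𝓝 0) :=
    tendsto_inv₀_cobounded.mono_left inf_le_left
  have h1 : Tendsto (fun x : ℂ => ∑ k ∈ Finset.range (n + 1), besselCoeff n μ k * (x⁻¹) ^ k)
      (coneAt M) (𝓝 (∑ k ∈ Finset.range (n + 1), besselCoeff n μ k * 0 ^ k)) :=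
    tendsto_finsetSum _ fun k _ => (h0.pow k).const_mul _
  have h2 : ∑ k ∈ Finset.range (n + 1), besselCoeff n μ k * (0 : ℂ) ^ k = 1 := by
    rw [Finset.sum_range_succ']
    simp [besselCoeff]
  rw [h2] at h1
  exact h1.congr fun x => (genBesselY_eq n μ x).symm

/-! ### The connection formula -/

lemma ascPochhammer_eval_succ_left (k : ℕ) (c : ℂ) :
    (ascPochhammer ℂ (k + 1)).eval c = c * (ascPochhammer ℂ k).eval (c + 1) := by
  rw [ascPochhammer_succ_left]; simp

lemma ascPochhammer_eval_ne_zero {c : ℂ} (hc : ∀ m : ℕ, c ≠ -m) (k : ℕ) :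
    (ascPochhammer ℂ k).eval c ≠ 0 := by
  induction k with
  | zero => simp
  | succ k ih =>
    rw [ascPochhammer_succ_eval]
    exact mul_ne_zero ih fun h => hc k (eq_neg_of_add_eq_zero_left h)

/-- The terms of Kummer's series. -/
def kummerTerm (a c x : ℂ) (k : ℕ) : ℂ :=
  (ascPochhammer ℂ k).eval a / (ascPochhammer ℂ k).eval c * (x ^ k / (k.factorial : ℂ))

lemma summable_kummerTerm (n : ℕ) {c : ℂ} (hc : ∀ m : ℕ, c ≠ -m) (x : ℂ) :
    Summable (kummerTerm (n + 1) c x) := by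
  refine summable_of_ratio_norm_eventually_le (r := 1 / 2) (by norm_num) ?_
  -- From this index on |c + k| ≥ 2(n+1)|x|, and n + 1 + k ≤ (n+1)(k+1), so the ratio of consecutive
  -- terms is at most ½.
  filter_upwards [eventually_ge_atTop ⌈‖c‖ + 2 * (n + 1) * ‖x‖ + 1⌉₊] with k hk
  have hk' : ‖c‖ + 2 * (n + 1) * ‖x‖ + 1 ≤ k := Nat.ceil_le.1 hk
  have hck : c + k ≠ 0 := fun h => hc k (eq_neg_of_add_eq_zero_left h)
  have hp := ascPochhammer_eval_ne_zero hc k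
  have hf : ((k.factorial : ℕ) : ℂ) ≠ 0 := by exact_mod_cast k.factorial_ne_zero
  have hk1 : (k : ℂ) + 1 ≠ 0 := by exact_mod_cast k.succ_ne_zero
  have e : kummerTerm (n + 1) c x (k + 1) =
      ((n + 1 + k) * x / ((c + k) * (k + 1))) * kummerTerm (n + 1) c x k := by
    rw [kummerTerm, kummerTerm, ascPochhammer_succ_eval, ascPochhammer_succ_eval, pow_succ,
      Nat.factorial_succ]
    push_cast
    field_simp
  rw [e, norm_mul]
  refine mul_le_mul_of_nonneg_right ?_ (norm_nonneg _)
  have h1 : (2 * (n + 1) * ‖x‖ : ℝ) ≤ ‖c + k‖ := by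
    have := norm_sub_norm_le (k : ℂ) (-c)
    rw [Complex.norm_natCast, norm_neg, sub_neg_eq_add, add_comm (k : ℂ)] at this
    linarith
  have h2 : ‖(n : ℂ) + 1 + k‖ ≤ (n + 1) * (k + 1) := by
    have : (n : ℂ) + 1 + k = ((n + 1 + k : ℕ) : ℂ) := by push_cast; ring
    rw [this, Complex.norm_natCast]; push_cast
    nlinarith [Nat.cast_nonneg (α := ℝ) n, Nat.cast_nonneg (α := ℝ) k]
  have h3 : ‖(k : ℂ) + 1‖ = k + 1 := by
    have : (k : ℂ) + 1 = ((k + 1 : ℕ) : ℂ) := by push_cast; ring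
    rw [this, Complex.norm_natCast]; push_cast; ring
  have h4 : 0 < ‖c + k‖ := norm_pos_iff.2 hck
  rw [norm_div, norm_mul, norm_mul, h3, div_le_iff₀ (by positivity)]
  calc ‖(n : ℂ) + 1 + k‖ * ‖x‖ ≤ ((n + 1) * (k + 1)) * ‖x‖ :=
        mul_le_mul_of_nonneg_right h2 (norm_nonneg _)
    _ = 1 / 2 * ((2 * (n + 1) * ‖x‖) * (k + 1)) := by ring
    _ ≤ _ := by gcongr

lemma not_neg_nat_add_one {c : ℂ} (hc : ∀ m : ℕ, c ≠ -m) : ∀ m : ℕ, c + 1 ≠ -m := by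
  intro m h
  apply hc (m + 1)
  push_cast
  linear_combination h

/-- A contiguous relation for Kummer's function. -/
lemma kummerM_contiguous (n : ℕ) {c : ℂ} (hc : ∀ m : ℕ, c ≠ -m) (x : ℂ) :
    c * (c + 1) * kummerM (n + 1) c x = (c + 1) * (c + x) * kummerM (n + 1) (c + 1) x
      - (c - n) * x * kummerM (n + 1) (c + 1 + 1) x := by
  have hc1 := not_neg_nat_add_one hc
  have hc2 := not_neg_nat_add_one hc1
  have s0 := summable_kummerTerm n hc x
  have s1 := summable_kummerTerm n hc1 x
  have s2 := summable_kummerTerm n hc2 x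
  -- In the difference of the two series the constant terms cancel; the coefficient of x^{k+1} is
  -- then compared with that of x · x^k.
  have key : ∀ k, c * (c + 1) * (kummerTerm (n + 1) c x (k + 1)
      - kummerTerm (n + 1) (c + 1) x (k + 1)) = x * ((c + 1) * kummerTerm (n + 1) (c + 1) x k
      - (c - n) * kummerTerm (n + 1) (c + 1 + 1) x k) := by
    intro k
    have hp := ascPochhammer_eval_ne_zero hc1 k
    have hc0 : c ≠ 0 := by simpa using hc 0
    have hc10 : c + 1 ≠ 0 := by simpa using hc1 0
    have hck : c + 1 + k ≠ 0 := fun h => hc1 k (eq_neg_of_add_eq_zero_left h)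
    have hf : ((k.factorial : ℕ) : ℂ) ≠ 0 := by exact_mod_cast k.factorial_ne_zero
    have hk1 : (k : ℂ) + 1 ≠ 0 := by exact_mod_cast k.succ_ne_zero
    have e2 : (ascPochhammer ℂ k).eval (c + 1 + 1)
        = (ascPochhammer ℂ k).eval (c + 1) * (c + 1 + k) / (c + 1) := by
      rw [eq_div_iff hc10, mul_comm, ← ascPochhammer_eval_succ_left, ascPochhammer_succ_eval]
    simp only [kummerTerm]
    rw [ascPochhammer_eval_succ_left k c, ascPochhammer_succ_eval k (c + 1), e2,
      ascPochhammer_succ_eval k ((n : ℂ) + 1), pow_succ, Nat.factorial_succ]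
    push_cast
    field_simp
    ring
  have h0 : kummerM (n + 1) c x = 1 + ∑' k, kummerTerm (n + 1) c x (k + 1) := by
    have := s0.tsum_eq_zero_add
    rw [show kummerTerm (n + 1) c x 0 = 1 by simp [kummerTerm]] at this
    exact this
  have h1 : kummerM (n + 1) (c + 1) x = 1 + ∑' k, kummerTerm (n + 1) (c + 1) x (k + 1) := by
    have := s1.tsum_eq_zero_add
    rw [show kummerTerm (n + 1) (c + 1) x 0 = 1 by simp [kummerTerm]] at this
    exact this
  have h2 : c * (c + 1) * (kummerM (n + 1) c x - kummerM (n + 1) (c + 1) x)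
      = x * ((c + 1) * kummerM (n + 1) (c + 1) x
        - (c - n) * kummerM (n + 1) (c + 1 + 1) x) := by
    rw [h0, h1, add_sub_add_left_eq_sub, ← ((summable_nat_add_iff 1).2 s0).tsum_sub
      ((summable_nat_add_iff 1).2 s1), ← tsum_mul_left, tsum_congr key, tsum_mul_left,
      (s1.mul_left _).tsum_sub (s2.mul_left _), tsum_mul_left, tsum_mul_left, ← h1]
    rfl
  linear_combination h2

lemma continuousOn_one_sub_cpow {a : ℂ} : ContinuousOn (fun s : ℝ => (1 - (s : ℂ)) ^ a) (Ioo 0 1) := by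
  intro s hs
  apply ContinuousAt.continuousWithinAt
  refine ContinuousAt.cpow (by fun_prop) continuousAt_const (Or.inl ?_)
  simpa using hs.2

/-- Euler's integral for Kummer's function. -/
lemma euler_integral_kummerM (n : ℕ) {b : ℂ} (hb : 1 ≤ b.re) (x : ℂ) :
    ∫ u in (0 : ℝ)..1, (u : ℂ) ^ n * (1 - (u : ℂ)) ^ (b - 1) * Complex.exp (x * u)
      = n.factorial * Complex.Gamma b / Complex.Gamma (n + 1 + b)
        * kummerM (n + 1) (n + 1 + b) x := by
  have hae : ∀ᵐ t : ℝ ∂volume, t ≠ 1 := by simp [ae_iff, measure_singleton]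
  have hsum : HasSum (fun k : ℕ => ∫ u in (0 : ℝ)..1,
      (u : ℂ) ^ n * (1 - (u : ℂ)) ^ (b - 1) * ((x * u) ^ k / (k.factorial : ℂ)))
      (∫ u in (0 : ℝ)..1, (u : ℂ) ^ n * (1 - (u : ℂ)) ^ (b - 1) * Complex.exp (x * u)) := by
    refine intervalIntegral.hasSum_integral_of_dominated_convergence
      (fun k _ => ‖x‖ ^ k / k.factorial) (fun k => ?_) (fun k => ?_) ?_ ?_ ?_
    · rw [uIoc_of_le zero_le_one, ← restrict_Ioo_eq_restrict_Ioc]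
      refine ContinuousOn.aestronglyMeasurable ?_ measurableSet_Ioo
      have := continuousOn_one_sub_cpow (a := b - 1)
      fun_prop
    · filter_upwards [hae] with u hu1 hu
      rw [uIoc_of_le zero_le_one] at hu
      have hu0 := hu.1.le
      have h1 : 0 < 1 - u := by linarith [lt_of_le_of_ne hu.2 hu1]
      have e : (1 - (u : ℂ)) = ((1 - u : ℝ) : ℂ) := by push_cast; ring
      rw [norm_mul, norm_mul, norm_pow, e, Complex.norm_cpow_eq_rpow_re_of_pos h1, norm_div,
        norm_pow, norm_mul, Complex.norm_real, Real.norm_of_nonneg hu0, Complex.norm_natCast]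
      have h2 : u ^ n ≤ 1 := pow_le_one₀ hu0 hu.2
      -- The condition Re b ≥ 1 keeps the integrand bounded, so the exponential series itself
      -- dominates.
      have h3 : (1 - u) ^ (b - 1).re ≤ 1 :=
        Real.rpow_le_one h1.le (by linarith) (by simpa using hb)
      have h4 : (‖x‖ * u) ^ k ≤ ‖x‖ ^ k :=
        pow_le_pow_left₀ (by positivity) (mul_le_of_le_one_right (norm_nonneg _) hu.2) k
      calc u ^ n * (1 - u) ^ (b - 1).re * ((‖x‖ * u) ^ k / k.factorial)
          ≤ 1 * 1 * (‖x‖ ^ k / k.factorial) := by gcongr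
        _ = _ := by ring
    · exact Eventually.of_forall fun u _ => Real.summable_pow_div_factorial _
    · exact intervalIntegrable_const
    · refine Eventually.of_forall fun u _ => HasSum.mul_left _ ?_
      have := NormedSpace.expSeries_div_hasSum_exp (x * (u : ℂ))
      rwa [← Complex.exp_eq_exp_ℂ] at this
  have hc : ∀ m : ℕ, (n + 1 + b : ℂ) ≠ -m := by
    intro m h
    have := congrArg Complex.re h
    simp at this
    linarith [Nat.cast_nonneg (α := ℝ) n, Nat.cast_nonneg (α := ℝ) m]
  have hGc : Complex.Gamma (n + 1 + b) ≠ 0 := Complex.Gamma_ne_zero hc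
  have hterm : ∀ k : ℕ, ∫ u in (0 : ℝ)..1,
      (u : ℂ) ^ n * (1 - (u : ℂ)) ^ (b - 1) * ((x * u) ^ k / (k.factorial : ℂ))
      = n.factorial * Complex.Gamma b / Complex.Gamma (n + 1 + b)
        * kummerTerm (n + 1) (n + 1 + b) x k := by
    intro k
    have hn1 : ∀ m : ℕ, ((n : ℂ) + 1) ≠ -m := by
      intro m h
      have := congrArg Complex.re h
      simp at this
      linarith [Nat.cast_nonneg (α := ℝ) n, Nat.cast_nonneg (α := ℝ) m]
    have hbeta := Complex.Gamma_mul_Gamma_eq_betaIntegral (s := (n : ℂ) + 1 + k) (t := b)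
      (by simp; positivity) (by linarith)
    have e1 := Complex.Gamma_add_nat_div_Gamma_eq (n := k) _ hn1
    have e2 := Complex.Gamma_add_nat_div_Gamma_eq (n := k) _ hc
    rw [Complex.Gamma_nat_eq_factorial] at e1
    have hf : ((n.factorial : ℕ) : ℂ) ≠ 0 := by exact_mod_cast n.factorial_ne_zero
    rw [div_eq_iff hf] at e1
    rw [div_eq_iff hGc, show (n : ℂ) + 1 + b + k = n + 1 + k + b by ring] at e2
    rw [e1, e2] at hbeta
    have hp := ascPochhammer_eval_ne_zero hc k
    have hint : ∫ u in (0 : ℝ)..1,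
        (u : ℂ) ^ n * (1 - (u : ℂ)) ^ (b - 1) * ((x * u) ^ k / (k.factorial : ℂ))
        = x ^ k / k.factorial * Complex.betaIntegral (n + 1 + k) b := by
      rw [Complex.betaIntegral, ← intervalIntegral.integral_const_mul]
      congr 1
      ext u
      rw [show (n : ℂ) + 1 + k - 1 = ((n + k : ℕ) : ℂ) by push_cast; ring, Complex.cpow_natCast,
        pow_add, mul_pow]
      ring
    rw [hint, kummerTerm]
    field_simp
    linear_combination (-(x ^ k) / k.factorial) * hbeta
  rw [funext hterm] at hsum
  rw [← hsum.tsum_eq, tsum_mul_left]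
  rfl

lemma subExp_beta (n : ℕ) {a : ℂ} (ha : 0 ≤ a.re) :
    SubExp (fun s : ℝ => (1 - (s : ℂ)) ^ n * (s : ℂ) ^ a) := by
  have h := subExp_cpow ha
  refine ⟨by have := h.cont; fun_prop, fun c hc => ?_⟩
  obtain ⟨C, hC⟩ := h.bound (c / 2) (by positivity)
  obtain ⟨C', hC'0, hC'⟩ := exists_one_add_pow_le n (a := c / 2) (by positivity)
  refine ⟨C' * C, fun t ht => ?_⟩
  rw [norm_mul, norm_pow]
  have h1 : ‖1 - (t : ℂ)‖ ≤ 1 + t := by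
    refine (norm_sub_le _ _).trans ?_
    rw [Complex.norm_real, Real.norm_of_nonneg ht.le, norm_one]
  calc ‖1 - (t : ℂ)‖ ^ n * ‖(t : ℂ) ^ a‖
      ≤ (C' * Real.exp (c / 2 * t)) * (C * Real.exp (c / 2 * t)) :=
        mul_le_mul ((pow_le_pow_left₀ (norm_nonneg _) h1 n).trans (hC' t ht.le)) (hC t ht)
          (norm_nonneg _) (by positivity)
    _ = C' * C * (Real.exp (c / 2 * t) * Real.exp (c / 2 * t)) := by ring
    _ = _ := by rw [← Real.exp_add]; congr 2; ring

/-- Expanding (1−s)ⁿ turns each power of s into a Gamma integral, and Γ(n+μ+1+k)/Γ(n+μ+1) is the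
Pochhammer factor of Y. -/
lemma integral_bessel (n : ℕ) (μ : ℂ) (hb : 1 ≤ ((n : ℂ) + μ + 1).re) {x : ℂ} (hx : 0 < x.re) :
    laplaceInt (fun s : ℝ => (1 - (s : ℂ)) ^ n * (s : ℂ) ^ ((n : ℂ) + μ)) x
      = x ^ (-((n : ℂ) + μ + 1)) * Complex.Gamma (n + μ + 1) * genBesselY n μ (-(2 / x)) := by
  have hx0 := ne_zero_of_re_pos hx
  have hbm : ∀ m : ℕ, (n + μ + 1 : ℂ) ≠ -m := by
    intro m h
    have := congrArg Complex.re h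
    simp at this hb
    linarith [Nat.cast_nonneg (α := ℝ) m]
  have hGb : Complex.Gamma (n + μ + 1) ≠ 0 := Complex.Gamma_ne_zero hbm
  have hre : ∀ k : ℕ, 1 ≤ ((n : ℂ) + μ + 1 + k).re := by
    intro k; rw [Complex.add_re, Complex.natCast_re]; linarith [Nat.cast_nonneg (α := ℝ) k]
  have hsub : ∀ k : ℕ, SubExp (fun t : ℝ => (t : ℂ) ^ ((n : ℂ) + μ + 1 + k - 1)) := fun k =>
    subExp_cpow (by rw [Complex.sub_re, Complex.one_re]; linarith [hre k])
  have hexp : ∀ s ∈ Ioi (0 : ℝ),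
      (1 - (s : ℂ)) ^ n * (s : ℂ) ^ ((n : ℂ) + μ) * Complex.exp (-(x * s))
      = ∑ k ∈ Finset.range (n + 1), (n.choose k : ℂ) * (-1) ^ k
        * ((s : ℂ) ^ ((n : ℂ) + μ + 1 + k - 1) * Complex.exp (-(x * s))) := by
    intro s hs
    have hs0 : (s : ℂ) ≠ 0 := by
      have hs : 0 < s := hs
      exact_mod_cast hs.ne'
    have h1 : (1 - (s : ℂ)) ^ n = ∑ k ∈ Finset.range (n + 1), (n.choose k : ℂ) * (-1) ^ k
        * (s : ℂ) ^ k := by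
      rw [show (1 - (s : ℂ)) = -s + 1 by ring, add_pow]
      refine Finset.sum_congr rfl fun k _ => ?_
      rw [neg_pow, one_pow]; ring
    rw [h1, Finset.sum_mul, Finset.sum_mul]
    refine Finset.sum_congr rfl fun k _ => ?_
    rw [show (n : ℂ) + μ + 1 + k - 1 = n + μ + k by ring, Complex.cpow_add ((n : ℂ) + μ) k hs0,
      Complex.cpow_natCast]
    ring
  rw [laplaceInt, setIntegral_congr_fun measurableSet_Ioi hexp, integral_finsetSum _ fun k _ =>
    ((hsub k).integrable hx).const_mul _, genBesselY_eq, Finset.mul_sum]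
  refine Finset.sum_congr rfl fun k _ => ?_
  have h := laplaceInt_cpow (hre k) hx
  have e1 := Complex.Gamma_add_nat_div_Gamma_eq (n := k) _ hbm
  rw [div_eq_iff hGb] at e1
  rw [integral_const_mul, ← laplaceInt, h, e1, neg_add, Complex.cpow_add _ _ hx0,
    Complex.cpow_neg x k, Complex.cpow_natCast, besselCoeff]
  rw [inv_pow]
  ring

lemma genBesselF_eq (n : ℕ) (μ ζ : ℂ) :
    genBesselF n μ ζ = n.factorial * (2 / ζ) ^ ((n : ℂ) + μ + 1) * Complex.exp (-(2 / ζ))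
    / Complex.Gamma (n + 1 + (n + μ + 1)) * kummerM (n + 1) (n + 1 + (n + μ + 1)) (2 / ζ) := by
  rw [genBesselF, show 2 * (n : ℂ) + μ + 2 = n + 1 + (n + μ + 1) by ring]

/-- The integral over (0,∞) is split at s = 1: the substitution u = 1 − s gives Euler's integral,
the shift s = t + 1 gives Tricomi's, with the sign (−1)ⁿ coming from (1−s)ⁿ. -/
lemma connection_of_one_le_re (n : ℕ) (μ : ℂ) (hb : 1 ≤ ((n : ℂ) + μ + 1).re) {x : ℂ}
    (hx : 0 < x.re) :
    genBesselY n μ (-(2 / x)) = genBesselF n μ (2 / x) + genBesselU n μ (2 / x) := by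
  have hx0 := ne_zero_of_re_pos hx
  have hGb : Complex.Gamma (n + μ + 1) ≠ 0 := Complex.Gamma_ne_zero_of_re_pos (by linarith)
  have e22 : 2 / (2 / x) = x := by field_simp
  have hY := integral_bessel n μ hb hx
  have hsub := subExp_beta n (a := (n : ℂ) + μ) (by simpa using hb)
  set f : ℝ → ℂ := fun s => (1 - (s : ℂ)) ^ n * (s : ℂ) ^ ((n : ℂ) + μ) * Complex.exp (-(x * s))
    with hf
  have hi : IntegrableOn f (Ioi 0) := hsub.integrable hx
  have hsplit : laplaceInt (fun s : ℝ => (1 - (s : ℂ)) ^ n * (s : ℂ) ^ ((n : ℂ) + μ)) x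
      = (∫ s in (0 : ℝ)..1, f s) + ∫ s in Ioi (1 : ℝ), f s := by
    rw [← intervalIntegral.integral_Ioi_sub_Ioi hi zero_le_one]
    simp only [laplaceInt, hf]
    ring
  have hF : ∫ s in (0 : ℝ)..1, f s = Complex.exp (-x) * (n.factorial * Complex.Gamma (n + μ + 1)
      / Complex.Gamma (n + 1 + (n + μ + 1)) * kummerM (n + 1) (n + 1 + (n + μ + 1)) x) := by
    rw [← euler_integral_kummerM n hb x, ← intervalIntegral.integral_const_mul]
    have h := intervalIntegral.integral_comp_sub_left (a := 0) (b := 1) f 1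
    rw [sub_self, sub_zero] at h
    rw [← h]
    congr 1
    ext u
    simp only [hf]
    push_cast
    rw [show -(x * (1 - (u : ℂ))) = -x + x * u by ring, Complex.exp_add,
      show (n : ℂ) + μ + 1 - 1 = n + μ by ring]
    ring
  have hU : ∫ s in Ioi (1 : ℝ), f s
      = (-1) ^ n * Complex.exp (-x) * tricomiInt n (n + μ) x := by
    have h := (measurePreserving_add_right volume (1 : ℝ)).setIntegral_preimage_emb
      (measurableEmbedding_addRight 1) f (Ioi 1)
    rw [← h, tricomiInt, laplaceInt, ← integral_const_mul]
    have hpre : (fun x : ℝ => x + 1) ⁻¹' Ioi 1 = Ioi 0 := by ext t; simp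
    rw [hpre]
    congr 1
    ext t
    simp only [hf]
    push_cast
    rw [show -(x * ((t : ℂ) + 1)) = -x + -(x * t) by ring, Complex.exp_add,
      show 1 - ((t : ℂ) + 1) = -t by ring, neg_pow, add_comm (t : ℂ) 1]
    ring
  rw [hsplit, hF, hU] at hY
  have hxb : x ^ ((n : ℂ) + μ + 1) ≠ 0 := by
    rw [Complex.cpow_def_of_ne_zero hx0]; exact Complex.exp_ne_zero _
  rw [Complex.cpow_neg] at hY
  rw [genBesselF_eq, genBesselU_eq, e22]
  field_simp at hY ⊢
  linear_combination -hY

/-- The vanishing coefficient of index n + 1 is appended, so that shifted and unshifted sums in the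
recurrence share one range. -/
lemma genBesselY_eq_one_add (n : ℕ) (μ x : ℂ) : genBesselY n μ (-(2 / x))
    = 1 + ∑ k ∈ Finset.range (n + 1), besselCoeff n μ (k + 1) * (x⁻¹) ^ (k + 1) := by
  have h : besselCoeff n μ (n + 1) = 0 := by simp [besselCoeff]
  have h0 : besselCoeff n μ 0 = 1 := by simp [besselCoeff]
  rw [Finset.sum_range_succ, h, genBesselY_eq, Finset.sum_range_succ', h0]
  ring

lemma besselCoeff_contiguous (n : ℕ) (μ : ℂ) {k : ℕ} (hk : k ≤ n) :
    besselCoeff n μ (k + 1) = besselCoeff n (μ + 1) (k + 1)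
      + (n + 1 + (n + μ + 1)) * besselCoeff n (μ + 1) k
      - (n + μ + 1 + 1) * besselCoeff n (μ + 1 + 1) k := by
  have h : ((n.choose (k + 1) : ℂ)) * (k + 1) = n.choose k * (n - k) := by
    have := Nat.choose_succ_right_eq n k
    rw [← Nat.cast_sub hk]
    exact_mod_cast this
  have e1 : (n : ℂ) + (μ + 1) + 1 = n + μ + 1 + 1 := by ring
  have e2 : (n : ℂ) + (μ + 1 + 1) + 1 = n + μ + 1 + 1 + 1 := by ring
  have h3 : (n + μ + 1 + 1 : ℂ) * (ascPochhammer ℂ k).eval (n + μ + 1 + 1 + 1)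
      = (ascPochhammer ℂ k).eval (n + μ + 1 + 1) * (n + μ + 1 + 1 + k) := by
    rw [← ascPochhammer_eval_succ_left, ascPochhammer_succ_eval]
  simp only [besselCoeff]
  rw [e1, e2, ascPochhammer_eval_succ_left k ((n : ℂ) + μ + 1), ascPochhammer_succ_eval]
  linear_combination ((ascPochhammer ℂ k).eval ((n : ℂ) + μ + 1 + 1) * (-1) ^ k) * h
    + ((n.choose k : ℂ) * (-1) ^ k) * h3

/-- The recurrence `x G(μ) = (2n+μ+2+x) G(μ+1) - (n+μ+2) G(μ+2)` shared by `Y`, `F` and `U`. -/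
def ParameterRecurrence (n : ℕ) (x : ℂ) (G : ℂ → ℂ) : Prop :=
  ∀ μ : ℂ, (∀ m : ℕ, (n : ℂ) + μ + 1 ≠ -(m : ℂ)) →
    x * G μ = (n + 1 + (n + μ + 1) + x) * G (μ + 1) - (n + μ + 1 + 1) * G (μ + 1 + 1)

lemma parameterRecurrence_genBesselY (n : ℕ) {x : ℂ} (hx : x ≠ 0) :
    ParameterRecurrence n x (fun μ => genBesselY n μ (-(2 / x))) := by
  intro μ _
  have h : ∑ k ∈ Finset.range (n + 1), besselCoeff n μ (k + 1) * (x⁻¹) ^ (k + 1)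
      = ∑ k ∈ Finset.range (n + 1), besselCoeff n (μ + 1) (k + 1) * (x⁻¹) ^ (k + 1)
      + (n + 1 + (n + μ + 1)) * x⁻¹ * ∑ k ∈ Finset.range (n + 1),
        besselCoeff n (μ + 1) k * (x⁻¹) ^ k
      - (n + μ + 1 + 1) * x⁻¹ * ∑ k ∈ Finset.range (n + 1),
        besselCoeff n (μ + 1 + 1) k * (x⁻¹) ^ k := by
    rw [Finset.mul_sum, Finset.mul_sum, ← Finset.sum_add_distrib, ← Finset.sum_sub_distrib]
    refine Finset.sum_congr rfl fun k hk => ?_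
    rw [besselCoeff_contiguous n μ (Nat.lt_succ_iff.1 (Finset.mem_range.1 hk)), pow_succ]
    ring
  have e : ∀ G₁ G₂ G₃ : ℂ, G₁ = G₂ + (n + 1 + (n + μ + 1)) * x⁻¹ * G₂
      - (n + μ + 1 + 1) * x⁻¹ * G₃ →
      x * G₁ = (n + 1 + (n + μ + 1) + x) * G₂ - (n + μ + 1 + 1) * G₃ := by
    rintro G₁ G₂ G₃ rfl
    field_simp
    ring
  apply e
  beta_reduce
  rw [← genBesselY_eq, ← genBesselY_eq] at h
  rw [genBesselY_eq_one_add n μ, h]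
  linear_combination -genBesselY_eq_one_add n (μ + 1) x

lemma parameterRecurrence_genBesselU (n : ℕ) {x : ℂ} (hx : 0 < x.re) :
    ParameterRecurrence n x (fun μ => genBesselU n μ (2 / x)) := by
  intro μ hb
  have hx0 := ne_zero_of_re_pos hx
  have e22 : 2 / (2 / x) = x := by field_simp
  have hb1 := not_neg_nat_add_one hb
  have hb0 : (n : ℂ) + μ + 1 ≠ 0 := by simpa using hb 0
  have hb10 : (n : ℂ) + μ + 1 + 1 ≠ 0 := by simpa using hb1 0
  have hG := Complex.Gamma_ne_zero hb
  have e1 : (n : ℂ) + (μ + 1) + 1 = n + μ + 1 + 1 := by ring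
  have e2 : (n : ℂ) + (μ + 1 + 1) + 1 = n + μ + 1 + 1 + 1 := by ring
  have h := tricomiInt_parts n (n + μ) hx
  have h1 := tricomiInt_add_one n (n + μ) hx
  have h2 := tricomiInt_add_one n (n + μ + 1) hx
  simp only [genBesselU_eq, e22, e1, e2]
  rw [Complex.Gamma_add_one _ hb10, Complex.Gamma_add_one _ hb0,
    Complex.cpow_add (n + μ + 1 + 1) 1 hx0, Complex.cpow_add (n + μ + 1) 1 hx0, Complex.cpow_one,
    show (n : ℂ) + (μ + 1) = n + μ + 1 by ring, show (n : ℂ) + (μ + 1 + 1) = n + μ + 1 + 1 by ring]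
  field_simp
  rw [h2]
  linear_combination (-(x ^ ((n : ℂ) + μ + 1))) * h
    - (x ^ ((n : ℂ) + μ + 1) * (n + μ + 1)) * h1

lemma parameterRecurrence_genBesselF (n : ℕ) {x : ℂ} (hx : x ≠ 0) :
    ParameterRecurrence n x (fun μ => genBesselF n μ (2 / x)) := by
  intro μ hb
  have e22 : 2 / (2 / x) = x := by field_simp
  have hc : ∀ m : ℕ, (n + 1 + (n + μ + 1) : ℂ) ≠ -m := by
    intro m h
    apply hb (m + n + 1)
    push_cast
    linear_combination h
  have hc1 := not_neg_nat_add_one hc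
  have hc0 : (n + 1 + (n + μ + 1) : ℂ) ≠ 0 := by simpa using hc 0
  have hc10 : (n + 1 + (n + μ + 1) + 1 : ℂ) ≠ 0 := by simpa using hc1 0
  have hG := Complex.Gamma_ne_zero hc
  have e1 : (n : ℂ) + (μ + 1) + 1 = n + μ + 1 + 1 := by ring
  have e2 : (n : ℂ) + (μ + 1 + 1) + 1 = n + μ + 1 + 1 + 1 := by ring
  have h := kummerM_contiguous n hc x
  simp only [genBesselF_eq, e22, e1, e2]
  rw [show (n : ℂ) + 1 + (n + μ + 1 + 1) = n + 1 + (n + μ + 1) + 1 by ring,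
    show (n : ℂ) + 1 + (n + μ + 1 + 1 + 1) = n + 1 + (n + μ + 1) + 1 + 1 by ring,
    Complex.Gamma_add_one _ hc10, Complex.Gamma_add_one _ hc0,
    Complex.cpow_add (n + μ + 1 + 1) 1 hx, Complex.cpow_add (n + μ + 1) 1 hx, Complex.cpow_one]
  generalize kummerM _ _ _ = A at *
  generalize kummerM _ _ _ = B at *
  generalize kummerM _ _ _ = C at *
  field_simp
  linear_combination ((n.factorial : ℂ) * x ^ ((n : ℂ) + μ + 1)) * h

/-- The connection formula `Y = F + U`. -/
lemma connection (n : ℕ) (μ : ℂ) (hb : ∀ m : ℕ, (n : ℂ) + μ + 1 ≠ -(m : ℂ)) {x : ℂ}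
    (hx : 0 < x.re) :
    genBesselY n μ (-(2 / x)) = genBesselF n μ (2 / x) + genBesselU n μ (2 / x) := by
  have hx0 := ne_zero_of_re_pos hx
  -- Induction downwards in Re μ: the values at μ + 1 and μ + 2 determine the one at μ because x ≠
  -- 0.
  have key : ∀ j : ℕ, ∀ μ : ℂ, (∀ m : ℕ, (n : ℂ) + μ + 1 ≠ -(m : ℂ)) →
      1 - (j : ℝ) ≤ ((n : ℂ) + μ + 1).re →
      genBesselY n μ (-(2 / x)) = genBesselF n μ (2 / x) + genBesselU n μ (2 / x) := by
    intro j
    induction j with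
    | zero => exact fun μ _ h => connection_of_one_le_re n μ (by simpa using h) hx
    | succ j ih =>
      intro μ hb h
      have e1 : (n : ℂ) + (μ + 1) + 1 = n + μ + 1 + 1 := by ring
      have e2 : (n : ℂ) + (μ + 1 + 1) + 1 = n + μ + 1 + 1 + 1 := by ring
      have hb1 := not_neg_nat_add_one hb
      have hb2 := not_neg_nat_add_one hb1
      push_cast at h
      have i1 := ih (μ + 1) (by rwa [e1]) (by rw [e1, Complex.add_re _ 1, Complex.one_re]; linarith)
      have i2 := ih (μ + 1 + 1) (by rwa [e2])
        (by rw [e2, Complex.add_re _ 1, Complex.add_re _ 1, Complex.one_re]; linarith)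
      have rY := parameterRecurrence_genBesselY n hx0 μ hb
      have rF := parameterRecurrence_genBesselF n hx0 μ hb
      have rU := parameterRecurrence_genBesselU n hx μ hb
      simp only at rY rF rU
      rw [i1, i2] at rY
      exact mul_left_cancel₀ hx0 (by linear_combination rY - rF - rU)
  obtain ⟨j, hj⟩ := exists_nat_ge (1 - ((n : ℂ) + μ + 1).re)
  exact key j μ hb (by linarith)

/-! ### The asymptotic expansion of a ratio of Gamma functions -/

lemma AnalyticAt.exists_eq_mul {f : ℂ → ℂ} (hf : AnalyticAt ℂ f 0) (h0 : f 0 = 0) :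
    ∃ g : ℂ → ℂ, AnalyticAt ℂ g 0 ∧ (∀ x, f x = x * g x) ∧ g 0 = deriv f 0 := by
  obtain ⟨p, hp⟩ := hf
  refine ⟨dslope f 0, hp.has_fpower_series_dslope_fslope.analyticAt, fun x => ?_, dslope_same f 0⟩
  have := sub_smul_dslope f 0 x
  rw [h0, sub_zero, sub_zero, smul_eq_mul] at this
  exact this.symm

/-- The quotient of consecutive terms of `ν^μ Γ(ν+1/2)/Γ(ν+1/2+μ)` as a function of `1/ν`. -/
def gammaStep (μ x : ℂ) : ℂ := (1 + x) ^ μ * (1 + x / 2) / (1 + x / 2 + μ * x)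

lemma analyticAt_gammaStep (μ : ℂ) : AnalyticAt ℂ (gammaStep μ) 0 := by
  unfold gammaStep
  have h1 : AnalyticAt ℂ (fun x : ℂ => 1 + x) 0 := by fun_prop
  have h2 : AnalyticAt ℂ (fun x : ℂ => (1 + x) ^ μ) 0 :=
    h1.cpow analyticAt_const (by simp)
  have h3 : AnalyticAt ℂ (fun x : ℂ => 1 + x / 2) 0 := by fun_prop
  have h4 : AnalyticAt ℂ (fun x : ℂ => 1 + x / 2 + μ * x) 0 := by fun_prop
  exact (h2.mul h3).div h4 (by simp)

/-- The linear terms of numerator and denominator are both ½ + μ and cancel; the quadratic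
coefficient fixes d₁. -/
lemma gammaStep_expand (μ : ℂ) : ∃ ψ : ℂ → ℂ, AnalyticAt ℂ ψ 0 ∧
    (∀ᶠ x in 𝓝 (0 : ℂ), 1 - gammaStep μ x = x ^ 2 * ψ x) ∧ ψ 0 = -μ ^ 2 / 2 := by
  have h1 : AnalyticAt ℂ (fun x : ℂ => 1 + x) 0 := by fun_prop
  have h2 : AnalyticAt ℂ (fun x : ℂ => (1 + x) ^ μ - 1) 0 :=
    (h1.cpow analyticAt_const (by simp)).sub analyticAt_const
  have hd : ∀ m : ℂ, ∀ᶠ x in 𝓝 (0 : ℂ), HasDerivAt (fun x : ℂ => (1 + x) ^ m - 1)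
      (m * (1 + x) ^ (m - 1)) x := by
    intro m
    have : ∀ᶠ x in 𝓝 (0 : ℂ), 1 + x ∈ Complex.slitPlane :=
      h1.continuousAt.eventually_mem (Complex.isOpen_slitPlane.mem_nhds (by simp))
    filter_upwards [this] with x hx
    simpa using (((hasDerivAt_id x).const_add 1).cpow_const (c := m) hx).sub_const 1
  obtain ⟨g, hg, hfg, hg0⟩ := h2.exists_eq_mul (by simp)
  have hg0' : g 0 = μ := by rw [hg0, (hd μ).self_of_nhds.deriv]; simp
  -- Differentiating (1+x)^μ − 1 = x g(x) twice at 0.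
  have hg1 : 2 * deriv g 0 = μ * (μ - 1) := by
    have e1 : (fun x : ℂ => g x + x * deriv g x) =ᶠ[𝓝 0] fun x => μ * (1 + x) ^ (μ - 1) := by
      filter_upwards [hd μ, hg.eventually_analyticAt] with x hx hgx
      have e2 : (fun x : ℂ => (1 + x) ^ μ - 1) = fun x => x * g x := funext hfg
      rw [e2] at hx
      have := (hasDerivAt_id x).mul hgx.differentiableAt.hasDerivAt
      have := hx.unique this
      simp only [id, one_mul] at this
      exact this.symm
    have h3 : HasDerivAt (fun x : ℂ => g x + x * deriv g x)
        (deriv g 0 + (1 * deriv g 0 + 0 * deriv (deriv g) 0)) 0 :=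
      hg.differentiableAt.hasDerivAt.add
        ((hasDerivAt_id 0).mul hg.deriv.differentiableAt.hasDerivAt)
    have h4 : HasDerivAt (fun x : ℂ => μ * (1 + x) ^ (μ - 1)) (μ * (μ - 1)) 0 := by
      have := ((hd (μ - 1)).self_of_nhds.add_const 1).const_mul μ
      simpa using this
    have := h3.unique (h4.congr_of_eventuallyEq e1)
    linear_combination this
  obtain ⟨χ, hχ, hgχ, hχ0⟩ := (hg.sub (analyticAt_const (v := μ))).exists_eq_mul
    (by simp [hg0'])
  have hχ0' : χ 0 = μ * (μ - 1) / 2 := by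
    rw [hχ0]
    have : deriv (g - fun _ => μ) 0 = deriv g 0 := by
      rw [show (g - fun _ => μ) = fun x => g x - μ from rfl, deriv_sub_const]
    rw [this]
    linear_combination hg1 / 2
  have h3 : AnalyticAt ℂ (fun x : ℂ => 1 + x / 2) 0 := by fun_prop
  have h4 : AnalyticAt ℂ (fun x : ℂ => 1 + x / 2 + μ * x) 0 := by fun_prop
  refine ⟨fun x => -(χ x * (1 + x / 2) + μ / 2) / (1 + x / 2 + μ * x),
    (((hχ.mul h3).add analyticAt_const).neg).div h4 (by simp), ?_, ?_⟩
  · have : ∀ᶠ x in 𝓝 (0 : ℂ), 1 + x / 2 + μ * x ≠ 0 :=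
      h4.continuousAt.eventually_ne (by simp)
    filter_upwards [this] with x hx
    have e1 : (1 + x) ^ μ = 1 + μ * x + x ^ 2 * χ x := by
      have a1 := hfg x
      have a2 := hgχ x
      simp only [Pi.sub_apply] at a2
      linear_combination a1 + x * a2
    rw [gammaStep, e1, ← mul_div_assoc, eq_div_iff hx, sub_mul, div_mul_cancel₀ _ hx]
    ring
  · beta_reduce
    rw [hχ0']
    simp
    ring

/-- The formal recursion for the coefficients of the Gamma ratio. -/
lemma exists_gammaCoeff (μ : ℂ) : ∃ d : ℕ → ℂ, d 0 = 1 ∧ d 1 = -μ ^ 2 / 2 ∧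
    ∀ N, 1 ≤ N → ∃ ψ : ℂ → ℂ, AnalyticAt ℂ ψ 0 ∧ ∀ᶠ x in 𝓝 (0 : ℂ),
      ∑ k ∈ Finset.range N, d k * (x / (1 + x)) ^ k
        - gammaStep μ x * ∑ k ∈ Finset.range N, d k * x ^ k = x ^ (N + 1) * ψ x := by
  obtain ⟨ψ₁, hψ₁, he₁, h0₁⟩ := gammaStep_expand μ
  have hr0 : gammaStep μ 0 = 1 := by simp [gammaStep]
  have hr1 : deriv (gammaStep μ) 0 = 0 := by
    have h1 : HasDerivAt (fun x : ℂ => 1 - x ^ 2 * ψ₁ x) 0 0 := by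
      have := ((hasDerivAt_pow 2 (0 : ℂ)).mul hψ₁.differentiableAt.hasDerivAt).const_sub 1
      simpa using this
    refine (h1.congr_of_eventuallyEq ?_).deriv
    filter_upwards [he₁] with x hx
    linear_combination -hx
  -- Since the step is 1 + O(x²), a new term d_N x^N changes the defect by −N d_N x^{N+1} to leading
  -- order; this is solvable for d_N when N ≥ 1.
  have hk : ∀ N : ℕ, ∃ k : ℂ → ℂ, AnalyticAt ℂ k 0 ∧
      (∀ x, ((1 + x)⁻¹) ^ N - gammaStep μ x = x * k x) ∧ k 0 = -N := by
    intro N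
    have h1 : AnalyticAt ℂ (fun x : ℂ => 1 + x) 0 := by fun_prop
    have h2 : AnalyticAt ℂ (fun x : ℂ => ((1 + x)⁻¹) ^ N) 0 := (h1.inv (by simp)).pow N
    have hd : HasDerivAt (fun x : ℂ => ((1 + x)⁻¹) ^ N) (-N) 0 := by
      have := (((hasDerivAt_id (0 : ℂ)).const_add 1).inv (by simp)).fun_pow N
      refine this.congr_deriv ?_
      simp
    obtain ⟨k, hk, hk1, hk2⟩ := (h2.sub (analyticAt_gammaStep μ)).exists_eq_mul (by simp [hr0])
    refine ⟨k, hk, hk1, ?_⟩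
    have := (hd.sub (analyticAt_gammaStep μ).differentiableAt.hasDerivAt).deriv
    rw [hk2, this, hr1, sub_zero]
  choose κ hκ hκ1 hκ2 using hk
  -- one step of the recursion
  have hstep : ∀ (N : ℕ) (ψ : {ψ : ℂ → ℂ // AnalyticAt ℂ ψ 0}),
      ∃ ψ' : {ψ : ℂ → ℂ // AnalyticAt ℂ ψ 0},
        ∀ x, ψ.1 x + ψ.1 0 / (N + 1) * κ (N + 1) x = x * ψ'.1 x := by
    rintro N ⟨ψ, hψ⟩
    have hN : (N : ℂ) + 1 ≠ 0 := by exact_mod_cast N.succ_ne_zero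
    obtain ⟨g, hg, hg1, -⟩ := (hψ.add ((analyticAt_const (v := ψ 0 / (N + 1))).mul
      (hκ (N + 1)))).exists_eq_mul (by
        simp only [Pi.add_apply, Pi.mul_apply, hκ2]; push_cast; field_simp; ring)
    exact ⟨⟨g, hg⟩, hg1⟩
  choose F hF using hstep
  let S : ℕ → {ψ : ℂ → ℂ // AnalyticAt ℂ ψ 0} := fun k => Nat.rec ⟨ψ₁, hψ₁⟩ F k
  -- The value of d_{j+1} is the one that cancels the leading coefficient S_j(0) of the current
  -- defect.
  let d : ℕ → ℂ := fun k => Nat.casesOn k 1 fun j => (S j).1 0 / (j + 1)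
  have hd1 : ∀ j, d (j + 1) = (S j).1 0 / (j + 1) := fun j => rfl
  refine ⟨d, rfl, ?_, fun N hN => ?_⟩
  · have h1 := hd1 0
    rw [zero_add] at h1
    rw [h1, show (S 0).1 0 = -μ ^ 2 / 2 from h0₁]
    simp
  · obtain ⟨j, rfl⟩ := Nat.exists_eq_add_of_le' hN
    refine ⟨(S j).1, (S j).2, ?_⟩
    clear hN
    induction j with
    | zero =>
      filter_upwards [he₁] with x hx
      have e0 : d 0 = 1 := rfl
      have e1 : (S 0).1 x = ψ₁ x := rfl
      simp [e0, e1, hx]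
    | succ j ih =>
      filter_upwards [ih] with x hx
      have h1 : (S j).1 x + (S j).1 0 / (j + 1) * κ (j + 1) x = x * (S (j + 1)).1 x :=
        hF j (S j) x
      rw [Finset.sum_range_succ, Finset.sum_range_succ _ (j + 1), hd1 j]
      have h2 := hκ1 (j + 1) x
      have h3 : (x / (1 + x)) ^ (j + 1) = x ^ (j + 1) * ((1 + x)⁻¹) ^ (j + 1) := by
        rw [div_eq_mul_inv, mul_pow]
      rw [h3]
      linear_combination hx + (x ^ (j + 1) * ((S j).1 0 / (j + 1))) * h2 + x ^ (j + 2) * h1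

/-- For Re s > 0 this is Gauss's product for Γ(s). Passing from s + 1 to s multiplies by (n+s+1)/n →
1, which reaches all s. -/
lemma tendsto_cpow_mul_factorial_div_Gamma (s : ℂ) :
    Tendsto (fun n : ℕ => (n : ℂ) ^ s * n.factorial / Complex.Gamma (n + s + 1)) atTop (𝓝 1) := by
  have key : ∀ j : ℕ, ∀ s : ℂ, 0 < (s + j).re →
      Tendsto (fun n : ℕ => (n : ℂ) ^ s * n.factorial / Complex.Gamma (n + s + 1))
        atTop (𝓝 1) := by
    intro j
    induction j with
    | zero =>
      intro s hs
      rw [Nat.cast_zero, add_zero] at hs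
      have hG := Complex.Gamma_ne_zero_of_re_pos hs
      have h := (Complex.GammaSeq_tendsto_Gamma s).div_const (Complex.Gamma s)
      rw [div_self hG] at h
      refine h.congr fun n => ?_
      have hs0 : ∀ k : ℕ, s ≠ -k := by
        rintro k rfl
        have : (0 : ℝ) ≤ k := k.cast_nonneg
        simp at hs
        linarith
      have h2 := Complex.Gamma_add_nat_div_Gamma_eq (n := n + 1) s hs0
      have h3 : (ascPochhammer ℂ (n + 1)).eval s = ∏ k ∈ Finset.range (n + 1), (s + k) := by
        generalize n + 1 = m
        induction m with
        | zero => simp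
        | succ m ih => rw [ascPochhammer_succ_eval, Finset.prod_range_succ, ih]
      rw [h3] at h2
      rw [Complex.GammaSeq, ← h2, show s + ((n + 1 : ℕ) : ℂ) = n + s + 1 by push_cast; ring,
        div_div, div_mul_cancel₀ _ hG]
    | succ j ih =>
      intro s hs
      have h := ih (s + 1) (by push_cast at hs ⊢; rwa [add_assoc, add_comm (1 : ℂ)])
      have h3 : Tendsto (fun n : ℕ => 1 + (s + 1) * ((n : ℂ))⁻¹) atTop (𝓝 (1 + (s + 1) * 0)) :=
        (tendsto_inv_atTop_nhds_zero_nat (𝕜 := ℂ)).const_mul _ |>.const_add 1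
      rw [mul_zero, add_zero] at h3
      have h4 := h.mul h3
      rw [mul_one] at h4
      refine h4.congr' ?_
      have hne : ∀ᶠ n : ℕ in atTop, 1 + (s + 1) * ((n : ℂ))⁻¹ ≠ 0 :=
        h3.eventually_ne one_ne_zero
      filter_upwards [hne, eventually_ne_atTop 0] with n hn hn0
      have hnc : (n : ℂ) ≠ 0 := by exact_mod_cast hn0
      have e1 : (n : ℂ) + s + 1 = n * (1 + (s + 1) * (n : ℂ)⁻¹) := by
        field_simp; ring
      have h5 : (n : ℂ) + s + 1 ≠ 0 := by rw [e1]; exact mul_ne_zero hnc hn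
      rw [show (n : ℂ) + (s + 1) + 1 = (n + s + 1) + 1 by ring, Complex.Gamma_add_one _ h5,
        Complex.cpow_add _ _ hnc, Complex.cpow_one]
      have e2 : 1 + (s + 1) * (n : ℂ)⁻¹ = (n + s + 1) / n := by rw [e1]; field_simp
      rw [e2]
      by_cases hG : Complex.Gamma (n + s + 1) = 0
      · simp [hG]
      · field_simp
  obtain ⟨j, hj⟩ := exists_nat_gt (-s.re)
  exact key j s (by simp; linarith)

/-- The ratio `ν^μ n! / Γ(n+μ+1)`. -/
def gammaRatio (μ : ℂ) (n : ℕ) : ℂ :=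
  (nuN n : ℂ) ^ μ * n.factorial / Complex.Gamma (n + μ + 1)

lemma tendsto_inv_nuN : Tendsto (fun n => (nuN n)⁻¹) atTop (𝓝 0) := by
  refine tendsto_inv_atTop_zero.comp ?_
  exact tendsto_atTop_add_const_right _ _ tendsto_natCast_atTop_atTop

lemma tendsto_inv_nuN_complex : Tendsto (fun n => (nuN n : ℂ)⁻¹) atTop (𝓝 0) := by
  have := (Complex.continuous_ofReal.tendsto 0).comp tendsto_inv_nuN
  simpa [Function.comp_def] using this

lemma tendsto_gammaRatio (μ : ℂ) : Tendsto (gammaRatio μ) atTop (𝓝 1) := by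
  have h1 : Tendsto (fun n : ℕ => (1 + (1 / 2) * (n : ℂ)⁻¹) ^ μ) atTop (𝓝 1) := by
    have h3 : Tendsto (fun n : ℕ => 1 + (1 / 2) * ((n : ℂ))⁻¹) atTop (𝓝 (1 + (1 / 2) * 0)) :=
      (tendsto_inv_atTop_nhds_zero_nat (𝕜 := ℂ)).const_mul _ |>.const_add 1
    rw [mul_zero, add_zero] at h3
    have h4 : ContinuousAt (fun x : ℂ => x ^ μ) 1 :=
      continuousAt_id.cpow continuousAt_const (by simp)
    have := h4.tendsto.comp h3
    simpa [Function.comp_def] using this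
  have h2 := h1.mul (tendsto_cpow_mul_factorial_div_Gamma μ)
  rw [mul_one] at h2
  refine h2.congr' ?_
  filter_upwards [eventually_gt_atTop 0] with n hn
  have hn' : (0 : ℝ) < n := by exact_mod_cast hn
  have e : (nuN n : ℂ) ^ μ = (1 + (1 / 2) * (n : ℂ)⁻¹) ^ μ * (n : ℂ) ^ μ := by
    have := Complex.mul_cpow_ofReal_nonneg (a := 1 + (1 / 2) * (n : ℝ)⁻¹) (b := n)
      (by positivity) hn'.le μ
    push_cast at this
    rw [← this, nuN]
    congr 1
    push_cast
    have : (n : ℂ) ≠ 0 := by exact_mod_cast hn.ne'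
    field_simp
  rw [gammaRatio, e]
  ring

lemma eventually_gammaRatio_succ (μ : ℂ) : ∀ᶠ n in atTop,
    gammaRatio μ (n + 1) = gammaStep μ (nuN n : ℂ)⁻¹ * gammaRatio μ n := by
  obtain ⟨j, hj⟩ := exists_nat_gt (-μ.re)
  filter_upwards [eventually_ge_atTop j] with n hn
  have hν := nuN_pos n
  have hνc : (nuN n : ℂ) ≠ 0 := by exact_mod_cast hν.ne'
  have h0 : (n : ℂ) + μ + 1 ≠ 0 := by
    intro h
    have h1 := congrArg Complex.re h
    have : (j : ℝ) ≤ n := by exact_mod_cast hn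
    simp at h1
    linarith
  have e1 : (nuN (n + 1) : ℂ) ^ μ = (1 + (nuN n : ℂ)⁻¹) ^ μ * (nuN n : ℂ) ^ μ := by
    have := Complex.mul_cpow_ofReal_nonneg (a := 1 + (nuN n)⁻¹) (b := nuN n)
      (by positivity) hν.le μ
    push_cast at this
    rw [← this]
    congr 1
    rw [add_mul, inv_mul_cancel₀ hνc, one_mul, nuN, nuN]
    push_cast
    ring
  have e3 : (n : ℂ) = nuN n - 1 / 2 := by rw [nuN]; push_cast; ring
  have e4 : 1 + (nuN n : ℂ)⁻¹ / 2 + μ * (nuN n : ℂ)⁻¹ = (n + μ + 1) * (nuN n : ℂ)⁻¹ := by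
    rw [e3]; field_simp; ring
  have e5 : 1 + (nuN n : ℂ)⁻¹ / 2 = (n + 1) * (nuN n : ℂ)⁻¹ := by
    rw [e3]; field_simp; ring
  rw [gammaRatio, gammaRatio, gammaStep, e1, e4, e5, Nat.factorial_succ,
    show ((n + 1 : ℕ) : ℂ) + μ + 1 = (n + μ + 1) + 1 by push_cast; ring,
    Complex.Gamma_add_one _ h0]
  generalize (1 + (nuN n : ℂ)⁻¹) ^ μ = p
  generalize (nuN n : ℂ) ^ μ = q
  push_cast
  by_cases hG : Complex.Gamma (n + μ + 1) = 0
  · simp [hG]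
  · field_simp

/-- Increments bounded by those of a null sequence b sum to a tail of at most b n. -/
lemma norm_sub_le_of_telescoping {e : ℕ → ℂ} {L : ℂ} {b : ℕ → ℝ} (he : Tendsto e atTop (𝓝 L))
    (hb : Tendsto b atTop (𝓝 0)) {n₀ : ℕ} (h : ∀ n, n₀ ≤ n → ‖e (n + 1) - e n‖ ≤ b n - b (n + 1))
    {n : ℕ} (hn : n₀ ≤ n) : ‖e n - L‖ ≤ b n := by
  have h1 : ∀ k, ‖e n - e (n + k)‖ ≤ b n - b (n + k) := by
    intro k
    induction k with
    | zero => simp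
    | succ k ih =>
      have h2 := h (n + k) (by omega)
      have h3 : e n - e (n + (k + 1)) = (e n - e (n + k)) - (e (n + k + 1) - e (n + k)) := by
        rw [← add_assoc]; ring
      rw [h3]
      refine (norm_sub_le _ _).trans ?_
      rw [← add_assoc]
      linarith
  have h2 : Tendsto (fun k => n + k) atTop atTop :=
    tendsto_atTop_mono (fun k => Nat.le_add_left k n) tendsto_id
  have h3 := (tendsto_const_nhds (x := e n)).sub (he.comp h2) |>.norm
  have h4 := (tendsto_const_nhds (x := b n)).sub (hb.comp h2)
  rw [sub_zero] at h4
  exact le_of_tendsto_of_tendsto' h3 h4 h1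

/-- With y = 1/ν one has y/(1+y) = 1/(ν+1): ν^{−N−2} is dominated by the increment of ν^{−N−1},
ready for telescoping. The range y ≤ 2 reflects ν ≥ ½. -/
lemma pow_succ_le_three_mul_sub {y : ℝ} (hy : 0 < y) (hy2 : y ≤ 2) (N : ℕ) :
    y ^ (N + 2) ≤ 3 * (y ^ (N + 1) - (y / (1 + y)) ^ (N + 1)) := by
  have hw0 : 0 ≤ y / (1 + y) := by positivity
  have hwy : y / (1 + y) ≤ y := div_le_self hy.le (by linarith)
  have h1 : (y / (1 + y)) ^ N ≤ y ^ N := pow_le_pow_left₀ hw0 hwy N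
  have h2 : (y / (1 + y)) ^ (N + 1) ≤ y ^ N * (y / (1 + y)) := by
    rw [pow_succ]; gcongr
  have h3 : y ^ 2 ≤ 3 * (y - y / (1 + y)) := by
    have : y - y / (1 + y) = y ^ 2 / (1 + y) := by field_simp; ring
    rw [this, ← mul_div_assoc, le_div_iff₀ (by positivity)]
    nlinarith [sq_nonneg y]
  calc y ^ (N + 2) = y ^ N * y ^ 2 := by ring
    _ ≤ y ^ N * (3 * (y - y / (1 + y))) := by gcongr
    _ = 3 * (y ^ (N + 1) - y ^ N * (y / (1 + y))) := by ring
    _ ≤ _ := by linarith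

/-- The asymptotic expansion of `ν^μ n! / Γ(n+μ+1)` in powers of `1/ν`. -/
lemma exists_gammaRatio_expansion (μ : ℂ) : ∃ d : ℕ → ℂ, d 0 = 1 ∧ d 1 = -μ ^ 2 / 2 ∧
    ∀ N, ∃ K : ℝ, ∃ n₀ : ℕ, ∀ n, n₀ ≤ n →
      ‖gammaRatio μ n - ∑ k ∈ Finset.range N, d k / (nuN n : ℂ) ^ k‖ ≤ K / nuN n ^ N := by
  obtain ⟨d, hd0, hd1, hd⟩ := exists_gammaCoeff μ
  refine ⟨d, hd0, hd1, fun N => ?_⟩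
  have hg := tendsto_gammaRatio μ
  have hgn : ∀ᶠ n in atTop, ‖gammaRatio μ n‖ ≤ 2 :=
    (hg.norm.eventually_le_const (by simp : ‖(1 : ℂ)‖ < 2))
  have hgn' : ∀ᶠ n in atTop, 1 / 2 ≤ ‖gammaRatio μ n‖ :=
    hg.norm.eventually_const_le (by norm_num : (1 / 2 : ℝ) < ‖(1 : ℂ)‖)
  rcases N with _ | N
  · obtain ⟨n₀, hn₀⟩ := eventually_atTop.1 hgn
    exact ⟨2, n₀, fun n hn => by simpa using hn₀ n hn⟩
  obtain ⟨ψ, hψ, hev⟩ := hd (N + 1) (by omega)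
  set P : ℂ → ℂ := fun x => ∑ k ∈ Finset.range (N + 1), d k * x ^ k with hP
  have hP1 : Tendsto (fun n => P (nuN n : ℂ)⁻¹) atTop (𝓝 1) := by
    have h1 : Continuous P := by fun_prop
    have h2 := (h1.tendsto 0).comp tendsto_inv_nuN_complex
    have h3 : P 0 = 1 := by simp [hP, Finset.sum_range_succ', hd0]
    rw [h3] at h2
    exact h2
  -- Partial sum over ratio tends to 1, and the defect equation makes its increments O(ν^{−N−2});
  -- summing them gives the error O(ν^{−N−1}).
  have he : Tendsto (fun n => P (nuN n : ℂ)⁻¹ / gammaRatio μ n) atTop (𝓝 1) := by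
    simpa [Pi.div_def] using hP1.div hg one_ne_zero
  have hψb : ∀ᶠ x in 𝓝 (0 : ℂ), ‖ψ x‖ ≤ ‖ψ 0‖ + 1 :=
    hψ.continuousAt.norm.eventually_le_const (by linarith)
  set K := ‖ψ 0‖ + 1 with hK
  have hb : Tendsto (fun n => 6 * K * (nuN n)⁻¹ ^ (N + 1)) atTop (𝓝 0) := by
    simpa using (tendsto_inv_nuN.pow (N + 1)).const_mul (6 * K)
  obtain ⟨n₀, hn₀⟩ := eventually_atTop.1 (hgn.and (hgn'.and ((eventually_gammaRatio_succ μ).and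
    ((tendsto_inv_nuN_complex.eventually hev).and (tendsto_inv_nuN_complex.eventually hψb)))))
  refine ⟨2 * (6 * K), n₀, fun n hn => ?_⟩
  have htel : ∀ n, n₀ ≤ n →
      ‖P (nuN (n + 1) : ℂ)⁻¹ / gammaRatio μ (n + 1) - P (nuN n : ℂ)⁻¹ / gammaRatio μ n‖
        ≤ 6 * K * (nuN n)⁻¹ ^ (N + 1) - 6 * K * (nuN (n + 1))⁻¹ ^ (N + 1) := by
    intro n hn
    obtain ⟨-, h2, h3, h4, h5⟩ := hn₀ n hn
    have h6 := (hn₀ (n + 1) (by omega)).2.1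
    have hν := nuN_pos n
    have hg0 : gammaRatio μ n ≠ 0 := fun h => by rw [h, norm_zero] at h2; norm_num at h2
    have hg1 : gammaRatio μ (n + 1) ≠ 0 := fun h => by rw [h, norm_zero] at h6; norm_num at h6
    have hx : (nuN (n + 1) : ℂ)⁻¹ = (nuN n : ℂ)⁻¹ / (1 + (nuN n : ℂ)⁻¹) := by
      have a1 : (nuN n : ℂ) ≠ 0 := by exact_mod_cast hν.ne'
      have a2 : nuN (n + 1) = nuN n + 1 := by simp only [nuN]; push_cast; ring
      have a3 : (nuN n : ℂ) + 1 ≠ 0 := by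
        exact_mod_cast (by linarith : (0 : ℝ) < nuN n + 1).ne'
      rw [a2]; push_cast; field_simp
    have hxr : (nuN (n + 1))⁻¹ = (nuN n)⁻¹ / (1 + (nuN n)⁻¹) := by
      exact_mod_cast hx
    have h7 : P (nuN (n + 1) : ℂ)⁻¹ / gammaRatio μ (n + 1) - P (nuN n : ℂ)⁻¹ / gammaRatio μ n
        = (nuN n : ℂ)⁻¹ ^ (N + 1 + 1) * ψ (nuN n : ℂ)⁻¹ / gammaRatio μ (n + 1) := by
      rw [← h4, ← hx, eq_div_iff hg1, sub_mul, div_mul_cancel₀ _ hg1]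
      congr 1
      rw [h3, div_mul_eq_mul_div, mul_comm (gammaStep _ _) (gammaRatio μ n),
        mul_div_assoc, mul_div_cancel_left₀ _ hg0, mul_comm]
    rw [h7, norm_div, norm_mul, norm_pow, norm_inv, Complex.norm_real, Real.norm_of_nonneg hν.le,
      div_le_iff₀ (by linarith), hxr]
    have hy2 : (nuN n)⁻¹ ≤ 2 := by
      rw [inv_le_comm₀ hν two_pos, nuN]
      have : (0 : ℝ) ≤ n := n.cast_nonneg
      linarith
    have h8 := pow_succ_le_three_mul_sub (inv_pos.2 hν) hy2 N
    have hK0 : 0 ≤ K := by positivity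
    have h9 : 0 ≤ (nuN n)⁻¹ ^ (N + 2) := by positivity
    calc (nuN n)⁻¹ ^ (N + 2) * ‖ψ (nuN n : ℂ)⁻¹‖ ≤ (nuN n)⁻¹ ^ (N + 2) * K := by gcongr
      _ ≤ 3 * ((nuN n)⁻¹ ^ (N + 1) - ((nuN n)⁻¹ / (1 + (nuN n)⁻¹)) ^ (N + 1)) * K := by gcongr
      _ = (6 * K * (nuN n)⁻¹ ^ (N + 1)
          - 6 * K * ((nuN n)⁻¹ / (1 + (nuN n)⁻¹)) ^ (N + 1)) * (1 / 2) := by ring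
      _ ≤ _ := by
        refine mul_le_mul_of_nonneg_left h6 ?_
        have : 0 ≤ 2 * K * (3 * ((nuN n)⁻¹ ^ (N + 1)
          - ((nuN n)⁻¹ / (1 + (nuN n)⁻¹)) ^ (N + 1))) :=
          mul_nonneg (by positivity) (h9.trans h8)
        linarith
  have h1 := norm_sub_le_of_telescoping he hb htel hn
  obtain ⟨h2, h3, -⟩ := hn₀ n hn
  have hg0 : gammaRatio μ n ≠ 0 := fun h => by rw [h, norm_zero] at h3; norm_num at h3
  have e1 : ∑ k ∈ Finset.range (N + 1), d k / (nuN n : ℂ) ^ k = P (nuN n : ℂ)⁻¹ :=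
    Finset.sum_congr rfl fun k _ => by rw [inv_pow, div_eq_mul_inv]
  have e2 : gammaRatio μ n - P (nuN n : ℂ)⁻¹
      = -(gammaRatio μ n * (P (nuN n : ℂ)⁻¹ / gammaRatio μ n - 1)) := by field_simp; ring
  rw [e1, e2, norm_neg, norm_mul]
  calc _ ≤ 2 * (6 * K * (nuN n)⁻¹ ^ (N + 1)) := by gcongr
    _ = _ := by rw [inv_pow, div_eq_mul_inv]; ring

/-! ### Boundary behaviour of the two solutions and the expansions -/

lemma exists_bound_of_tendsto_coneAt {f : ℂ → ℂ} {L : ℂ} {M : ℝ}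
    (h : Tendsto f (coneAt M) (𝓝 L)) :
    ∃ C, ∃ r₀ : ℝ, 0 < r₀ ∧ ∀ z ∈ cone M, ‖z‖ ^ (-1 : ℝ) ≤ r₀ → ‖f z‖ ≤ C := by
  have h1 : ∀ᶠ z in coneAt M, ‖f z‖ ≤ ‖L‖ + 1 := h.norm.eventually_le_const (by linarith)
  rw [coneAt, eventually_inf_principal] at h1
  obtain ⟨r, -, hr⟩ := (hasBasis_cobounded_norm (E := ℂ)).eventually_iff.1 h1
  refine ⟨‖L‖ + 1, (max r 1)⁻¹, by positivity, fun z hz hz' => hr ?_ hz⟩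
  have hz0 : 0 < ‖z‖ := norm_pos_iff.2 (ne_zero_of_re_pos hz.1)
  rw [Real.rpow_neg_one, inv_le_inv₀ hz0 (by positivity)] at hz'
  exact (le_max_left _ _).trans hz'

lemma tendsto_smul_coneAt {c : ℝ} (hc : 0 < c) (M : ℝ) :
    Tendsto (fun z : ℂ => (c : ℂ) * z) (coneAt M) (coneAt M) := by
  refine tendsto_inf.2 ⟨?_, tendsto_principal.2 ?_⟩
  · rw [← tendsto_norm_atTop_iff_cobounded]
    simp only [norm_mul, Complex.norm_real, Real.norm_of_nonneg hc.le]
    exact (tendsto_norm_coneAt M).const_mul_atTop hc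
  · filter_upwards [eventually_mem_cone M] with z hz using smul_mem_cone hz hc

lemma tendsto_two_mul_nuN_mul (n : ℕ) (M : ℝ) :
    Tendsto (fun z : ℂ => 2 * (nuN n : ℂ) * z) (coneAt M) (coneAt M) := by
  have h := tendsto_smul_coneAt (c := 2 * nuN n) (by have := nuN_pos n; positivity) M
  simpa using h

/-- On the cone Re z ≥ |z|/(|M|+1), so the exponential beats the power; the argument contributes at
most e^{π|Im μ|}. -/
lemma tendsto_cpow_mul_exp_coneAt (μ : ℂ) {ν : ℝ} (hν : 0 < ν) (M : ℝ) :
    Tendsto (fun z => (2 * z) ^ μ * Complex.exp (-(2 * ν * z))) (coneAt M) (𝓝 0) := by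
  set b : ℝ := ν / (|M| + 1) with hb
  have hb0 : 0 < b := by positivity
  have h1 := (tendsto_rpow_mul_exp_neg_mul_atTop_nhds_zero μ.re b hb0).comp
    ((tendsto_norm_coneAt M).const_mul_atTop (two_pos))
  have h2 := h1.const_mul (Real.exp (Real.pi * |μ.im|))
  rw [mul_zero] at h2
  refine squeeze_zero_norm' ?_ h2
  filter_upwards [eventually_mem_cone M] with z hz
  have hz0 : (2 * z : ℂ) ≠ 0 := mul_ne_zero two_ne_zero (ne_zero_of_re_pos hz.1)
  have h3 : -((2 * z : ℂ).arg * μ.im) ≤ Real.pi * |μ.im| := by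
    refine (neg_le_abs _).trans ?_
    rw [abs_mul]
    exact mul_le_mul_of_nonneg_right (Complex.abs_arg_le_pi _) (abs_nonneg _)
  have h4 : b * (2 * ‖z‖) ≤ 2 * ν * z.re := by
    have h5 : ‖z‖ ≤ (|M| + 1) * z.re :=
      hz.2.trans (mul_le_mul_of_nonneg_right (by linarith [le_abs_self M]) hz.1.le)
    rw [hb, div_mul_eq_mul_div, div_le_iff₀ (by positivity)]
    nlinarith
  have h6 : (-(2 * (ν : ℂ) * z)).re = -(2 * ν * z.re) := by
    simp [Complex.mul_re]
  rw [norm_mul, Complex.norm_cpow_of_ne_zero hz0, Complex.norm_exp, h6, div_eq_mul_inv,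
    ← Real.exp_neg, norm_mul, Complex.norm_two]
  calc (2 * ‖z‖) ^ μ.re * Real.exp (-((2 * z : ℂ).arg * μ.im)) * Real.exp (-(2 * ν * z.re))
      ≤ (2 * ‖z‖) ^ μ.re * Real.exp (Real.pi * |μ.im|) * Real.exp (-b * (2 * ‖z‖)) := by
        gcongr
        linarith
    _ = _ := by simp only [Function.comp_apply]; ring

/-- `(-1)^n U_n^μ(1/(νz))` as a multiple of the Tricomi solution. -/
def recessive (n : ℕ) (μ z : ℂ) : ℂ :=
  (Complex.Gamma (n + μ + 1))⁻¹ * ((2 * nuN n * z) ^ ((n : ℂ) + μ + 1)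
    * Complex.exp (-(2 * nuN n * z)) * tricomiInt n (n + μ) (2 * nuN n * z))

lemma exists_besselSolution_recessive (n : ℕ) (μ : ℂ) :
    ∃ G₁, BesselSolution μ (nuN n) (recessive n μ) G₁ :=
  ⟨_, (kummerSolution_tricomi n μ).besselSolution.const_mul (Complex.Gamma (n + μ + 1))⁻¹⟩

lemma genBesselU_eq_recessive (n : ℕ) (μ z : ℂ) :
    genBesselU n μ (2 / (2 * nuN n * z)) = (-1) ^ n * recessive n μ z := by
  have h : (2 : ℂ) / (2 / (2 * nuN n * z)) = 2 * nuN n * z := by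
    rw [div_div_eq_mul_div, mul_div_cancel_left₀ _ two_ne_zero]
  rw [genBesselU_eq, h, recessive]
  ring

lemma one_div_eq_two_div (a : ℂ) : 1 / a = 2 / (2 * a) :=
  (mul_div_mul_left (1 : ℂ) a two_ne_zero ▸ by rw [mul_one] : 2 / (2 * a) = 1 / a).symm

lemma log_two_mul_nuN_mul (n : ℕ) {z : ℂ} (hz : z ≠ 0) :
    Complex.log (2 * nuN n * z) = Complex.log (nuN n) + Complex.log (2 * z) := by
  have h := Complex.log_ofReal_mul (nuN_pos n) (mul_ne_zero two_ne_zero hz)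
  rw [Complex.ofReal_log (nuN_pos n).le] at h
  rw [← h]
  congr 1
  ring

/-- Writing x = 2νz, the factor x^{n+1} is consumed by Watson's limit n!, while x^μ = ν^μ(2z)^μ
cancels the growth of the front factor up to ν^μ. -/
lemma tendsto_recessive_mul_exp (n : ℕ) (μ : ℂ) (M : ℝ) :
    Tendsto (fun z => recessive n μ z * Complex.exp (-logFront (-1) μ (nuN n) z)) (coneAt M)
      (𝓝 (gammaRatio μ n)) := by
  have h1 := (tendsto_tricomiInt n (n + μ) M).comp (tendsto_two_mul_nuN_mul n M)
  have h2 := (tendsto_logFront_neg_one μ (nuN n) M).neg.cexp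
  rw [neg_zero, Complex.exp_zero] at h2
  have h3 := (h1.mul h2).const_mul ((Complex.Gamma (n + μ + 1))⁻¹ * (nuN n : ℂ) ^ μ)
  have e : (Complex.Gamma (n + μ + 1))⁻¹ * (nuN n : ℂ) ^ μ * ((n.factorial : ℂ) * 1)
      = gammaRatio μ n := by rw [gammaRatio]; ring
  rw [e] at h3
  refine h3.congr' ?_
  filter_upwards [eventually_mem_cone M] with z hz
  have hz0 := ne_zero_of_re_pos hz.1
  have hx0 := ne_zero_of_re_pos (re_two_mul_nuN_mul_pos n hz.1)
  have hν0 : (nuN n : ℂ) ≠ 0 := by exact_mod_cast (nuN_pos n).ne'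
  have e1 : (2 * nuN n * z : ℂ) ^ ((n : ℂ) + μ + 1)
      = (2 * nuN n * z) ^ (n + 1) * ((nuN n : ℂ) ^ μ * Complex.exp (μ * Complex.log (2 * z))) := by
    rw [show (n : ℂ) + μ + 1 = ((n + 1 : ℕ) : ℂ) + μ by push_cast; ring, Complex.cpow_add _ _ hx0,
      Complex.cpow_natCast, Complex.cpow_def_of_ne_zero hx0 μ, Complex.cpow_def_of_ne_zero hν0,
      log_two_mul_nuN_mul n hz0, ← Complex.exp_add]
    congr 2
    ring
  have e2 : Complex.exp (-(logFront (-1) μ (nuN n) z + 2 * nuN n * z - μ * Complex.log (2 * z)))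
      = Complex.exp (μ * Complex.log (2 * z)) * Complex.exp (-(2 * nuN n * z))
        * Complex.exp (-logFront (-1) μ (nuN n) z) := by
    rw [← Complex.exp_add, ← Complex.exp_add]
    congr 1
    ring
  rw [recessive, e1, e2, Function.comp_apply]
  ring

/-- It holds for every n: where Γ(n+μ+1) has a pole, its value in Lean is 0 and both U and
`gammaRatio` vanish. -/
lemma exists_amplitude_genBesselU (n : ℕ) (μ : ℂ) :
    ∃ A D, Amplitude (-1) μ (nuN n) A D ∧
      (∀ z, 0 < z.re → genBesselU n μ (1 / (nuN n * z)) = frontU n μ z * A z) ∧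
      ∀ M, Tendsto A (coneAt M) (𝓝 (gammaRatio μ n)) := by
  obtain ⟨G₁, hG⟩ := exists_besselSolution_recessive n μ
  refine ⟨_, _, hG.amplitude (Or.inr rfl) fun M =>
    exists_bound_of_tendsto_coneAt (tendsto_recessive_mul_exp n μ M), fun z hz => ?_,
    tendsto_recessive_mul_exp n μ⟩
  rw [one_div_eq_two_div, ← mul_assoc, genBesselU_eq_recessive, frontU_eq_exp n μ hz,
    Complex.exp_neg]
  field_simp [Complex.exp_ne_zero]

/-- For n + 1 ≤ Re c each factor satisfies |n + 1 + j| ≤ |c + j|, so the series is dominated by that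
of the exponential. -/
lemma norm_kummerM_le (n : ℕ) {c : ℂ} (hc : (n : ℝ) + 1 ≤ c.re) (x : ℂ) :
    ‖kummerM (n + 1) c x‖ ≤ Real.exp ‖x‖ := by
  have hp : ∀ k : ℕ, ‖(ascPochhammer ℂ k).eval ((n : ℂ) + 1) / (ascPochhammer ℂ k).eval c‖ ≤ 1 := by
    intro k
    rw [norm_div]
    refine div_le_one_of_le₀ ?_ (norm_nonneg _)
    induction k with
    | zero => simp
    | succ k ih =>
      rw [ascPochhammer_succ_eval, ascPochhammer_succ_eval, norm_mul, norm_mul]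
      refine mul_le_mul ih ?_ (norm_nonneg _) (norm_nonneg _)
      have h1 : ((n : ℂ) + 1 + k) = ((n + 1 + k : ℕ) : ℂ) := by push_cast; ring
      rw [h1, Complex.norm_natCast]
      refine le_trans ?_ (Complex.re_le_norm _)
      push_cast
      simpa using hc
  have hs : HasSum (fun k : ℕ => ‖x‖ ^ k / (k.factorial : ℝ)) (Real.exp ‖x‖) := by
    have := NormedSpace.expSeries_div_hasSum_exp (𝔸 := ℝ) ‖x‖
    rwa [← Real.exp_eq_exp_ℝ] at this
  refine tsum_of_norm_bounded hs fun k => ?_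
  rw [norm_mul, norm_div (x ^ k), norm_pow, Complex.norm_natCast]
  exact mul_le_of_le_one_left (by positivity) (hp k)

/-- Near 0 both F and its front factor behave like z^{n+μ+1}, and n = ν − ½ matches the exponent in
`exists_bound_front_near_zero`. -/
lemma exists_bound_genBesselF (n : ℕ) {μ : ℂ} (hb : 0 < ((n : ℂ) + μ + 1).re) :
    ∃ C r₀ : ℝ, 0 < r₀ ∧ ∀ z : ℂ, 0 < z.re → ‖z‖ ≤ r₀ →
      ‖genBesselF n μ (2 / (2 * nuN n * z)) * Complex.exp (-logFront 1 μ (nuN n) z)‖ ≤ C := by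
  obtain ⟨C, r₀, hr₀, hC⟩ := exists_bound_front_near_zero μ (nuN n)
  set Q : ℂ := n.factorial / Complex.Gamma (n + 1 + (n + μ + 1))
    * Complex.exp ((nuN n + 1 / 2 + μ) * Complex.log ((2 * nuN n : ℝ) : ℂ)) with hQ
  refine ⟨‖Q‖ * C * Real.exp (2 * nuN n * r₀), r₀, hr₀, fun z hz hzr => ?_⟩
  have hν := nuN_pos n
  have hx := re_two_mul_nuN_mul_pos n hz
  have hz0 := ne_zero_of_re_pos hz
  have h : (2 : ℂ) / (2 / (2 * nuN n * z)) = 2 * nuN n * z := by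
    rw [div_div_eq_mul_div, mul_div_cancel_left₀ _ two_ne_zero]
  have e1 : (2 * nuN n * z : ℂ) ^ ((n : ℂ) + μ + 1)
      = Complex.exp ((nuN n + 1 / 2 + μ) * Complex.log ((2 * nuN n : ℝ) : ℂ))
        * Complex.exp ((nuN n + 1 / 2 + μ) * Complex.log z) := by
    have h2 : (0 : ℝ) < 2 * nuN n := by positivity
    have h1 := Complex.log_ofReal_mul h2 hz0
    rw [Complex.ofReal_log h2.le] at h1
    rw [Complex.cpow_def_of_ne_zero (ne_zero_of_re_pos hx), ← Complex.exp_add,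
      show (2 * nuN n * z : ℂ) = ((2 * nuN n : ℝ) : ℂ) * z by push_cast; ring, h1,
      show (n : ℂ) = nuN n - 1 / 2 by rw [nuN]; push_cast; ring]
    congr 1
    ring
  have e2 : genBesselF n μ (2 / (2 * nuN n * z)) * Complex.exp (-logFront 1 μ (nuN n) z)
      = Q * Complex.exp ((nuN n + 1 / 2 + μ) * Complex.log z - logFront 1 μ (nuN n) z)
        * (Complex.exp (-(2 * nuN n * z))
          * kummerM (n + 1) (n + 1 + (n + μ + 1)) (2 * nuN n * z)) := by
    rw [genBesselF_eq, h, e1, hQ, sub_eq_add_neg, Complex.exp_add]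
    ring
  have h3 : ‖Complex.exp (-(2 * nuN n * z))‖ ≤ 1 := by
    rw [Complex.norm_exp, Complex.neg_re]
    exact Real.exp_le_one_iff.2 (by linarith)
  have h4 : ‖kummerM (n + 1) (n + 1 + (n + μ + 1)) (2 * nuN n * z)‖
      ≤ Real.exp (2 * nuN n * r₀) := by
    refine (norm_kummerM_le n (by simpa [add_assoc] using hb.le) _).trans ?_
    rw [norm_mul, norm_mul, Complex.norm_two, Complex.norm_real, Real.norm_of_nonneg hν.le]
    gcongr
  have h5 := hC z hz hzr
  rw [e2, norm_mul, norm_mul Q, norm_mul (Complex.exp _)]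
  have h6 : ‖Complex.exp (-(2 * nuN n * z))‖
      * ‖kummerM (n + 1) (n + 1 + (n + μ + 1)) (2 * nuN n * z)‖ ≤ Real.exp (2 * nuN n * r₀) :=
    (mul_le_of_le_one_left (norm_nonneg _) h3).trans h4
  have h7 : 0 ≤ C := (norm_nonneg _).trans h5
  gcongr

/-- Writing F as Y − U gives the differential equation and the limit 1 at infinity; the
hypergeometric form gives boundedness at 0. -/
lemma exists_amplitude_genBesselF (n : ℕ) {μ : ℂ} (hb : 0 < ((n : ℂ) + μ + 1).re) :
    ∃ A D, Amplitude 1 μ (nuN n) A D ∧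
      (∀ z, 0 < z.re → genBesselF n μ (1 / (nuN n * z)) = frontF n μ z * A z) ∧
      ∀ M, Tendsto A (coneAt M) (𝓝 1) := by
  obtain ⟨G₁, hG⟩ := exists_besselSolution_recessive n μ
  have hS := (kummerSolution_bessel n μ).besselSolution.sub (hG.const_mul ((-1) ^ n))
  have hbm : ∀ m : ℕ, (n : ℂ) + μ + 1 ≠ -(m : ℂ) := by
    intro m h
    rw [h] at hb
    have : (0 : ℝ) ≤ m := m.cast_nonneg
    simp at hb
    linarith
  have hF : ∀ z : ℂ, 0 < z.re → genBesselY n μ (-(2 / (2 * nuN n * z)))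
      - (-1) ^ n * recessive n μ z = genBesselF n μ (2 / (2 * nuN n * z)) := by
    intro z hz
    rw [connection n μ hbm (re_two_mul_nuN_mul_pos n hz), genBesselU_eq_recessive]
    ring
  refine ⟨_, _, hS.amplitude (Or.inl rfl) fun M => ?_, fun z hz => ?_, fun M => ?_⟩
  · obtain ⟨C, r₀, hr₀, hC⟩ := exists_bound_genBesselF n hb
    refine ⟨C, r₀, hr₀, fun z hz hzr => ?_⟩
    rw [Real.rpow_one] at hzr
    rw [hF z hz.1]
    exact hC z hz.1 hzr
  · rw [hF z hz, frontF_eq_exp n μ hz, Complex.exp_neg, one_div_eq_two_div, ← mul_assoc]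
    field_simp [Complex.exp_ne_zero]
  · have h1 := (tendsto_genBesselY n μ M).comp (tendsto_two_mul_nuN_mul n M)
    have h2 := (tendsto_logFront_one μ (nuN n) M).neg.cexp
    rw [neg_zero, Complex.exp_zero] at h2
    have h3 := (tendsto_recessive_mul_exp n μ M).mul
      ((tendsto_logFront_neg_one μ (nuN n) M).cexp.mul
        (tendsto_cpow_mul_exp_coneAt μ (nuN_pos n) M))
    rw [mul_zero, mul_zero] at h3
    have h4 : Tendsto (recessive n μ) (coneAt M) (𝓝 0) := by
      refine h3.congr' ?_
      filter_upwards [eventually_mem_cone M] with z hz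
      have hz0 : (2 * z : ℂ) ≠ 0 := mul_ne_zero two_ne_zero (ne_zero_of_re_pos hz.1)
      rw [Complex.cpow_def_of_ne_zero hz0, mul_assoc, ← Complex.exp_add, ← Complex.exp_add,
        ← Complex.exp_add]
      convert mul_one (recessive n μ z) using 2
      rw [Complex.exp_eq_one_iff]
      exact ⟨0, by push_cast; ring⟩
    have h5 := (h1.sub (h4.const_mul ((-1) ^ n))).mul h2
    simpa [Function.comp_def] using h5

/-- For both signs the amplitude is normalized at infinity, so letting u → ∞ in
`FormalSolution.error_le` reduces the claim to the expansion of the constants L n. -/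
theorem hasUniformExpansion_of_amplitude {σ : ℝ} (hσ : σ = 1 ∨ σ = -1) {μ : ℂ} {d : ℕ → ℂ}
    {a g : ℕ → ℂ → ℂ} (h : FormalSolution σ μ d a g) {f p : ℕ → ℂ → ℂ} {L : ℕ → ℂ}
    (hA : ∀ᶠ n in atTop, ∃ A D, Amplitude σ μ (nuN n) A D ∧
      (∀ z, 0 < z.re → f n z = p n z * A z) ∧ ∀ M, Tendsto A (coneAt M) (𝓝 (L n)))
    (hL : ∀ N, ∃ K : ℝ, ∃ n₀ : ℕ, ∀ n, n₀ ≤ n →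
      ‖L n - ∑ k ∈ Finset.range N, d k / (nuN n : ℂ) ^ k‖ ≤ K / nuN n ^ N)
    {δ : ℝ} (hδ : 0 < δ) : HasUniformExpansion f p a (sector δ) := by
  intro N
  obtain ⟨M, hM⟩ := sector_subset_cone hδ
  obtain ⟨K, ν₀, hK⟩ := h.error_le hσ M N
  obtain ⟨K', n₁, hK'⟩ := hL N
  obtain ⟨n₂, hn₂⟩ := eventually_atTop.1 hA
  refine ⟨2 * K' + K, max (max n₁ n₂) ⌈ν₀⌉₊, fun n hn z hz => ?_⟩
  obtain ⟨hn1, hn2, hn3⟩ : n₁ ≤ n ∧ n₂ ≤ n ∧ ν₀ ≤ n := by simpa [and_assoc] using hn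
  have hzc := hM hz
  obtain ⟨A, D, hAD, hf, hlim⟩ := hn₂ n hn2
  have hν : ν₀ ≤ nuN n := by
    rw [nuN]
    linarith
  have h1 : Tendsto (fun u : ℝ => 2 * ‖A (u * z)
      - ∑ k ∈ Finset.range N, a k (u * z) / (nuN n : ℂ) ^ k‖ + K / nuN n ^ N) atTop
      (𝓝 (2 * ‖L n - ∑ k ∈ Finset.range N, d k / (nuN n : ℂ) ^ k‖ + K / nuN n ^ N)) := by
    refine ((Tendsto.norm ?_).const_mul 2).add_const _
    exact ((hlim M).comp (tendsto_ray hzc)).sub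
      (tendsto_finsetSum _ fun k _ => (h.lim k z hzc.1).div_const _)
  have h2 := ge_of_tendsto h1 ((eventually_gt_atTop 0).mono fun u hu =>
    hK (nuN n) hν A D hAD z hzc u hu)
  have h3 : ‖A z - ∑ k ∈ Finset.range N, a k z / (nuN n : ℂ) ^ k‖
      ≤ (2 * K' + K) / nuN n ^ N := by
    refine h2.trans ?_
    have := hK' n hn1
    rw [add_div, mul_div_assoc]
    linarith
  rw [hf z hzc.1, ← mul_sub, norm_mul]
  calc _ ≤ ‖p n z‖ * ((2 * K' + K) / nuN n ^ N) := by gcongr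
    _ = _ := by ring

end

/-! ### The connection formula and the two expansions assembled. -/

theorem theorem3 (μ : ℂ) :
    (∀ n : ℕ, (∀ m : ℕ, (n : ℂ) + μ + 1 ≠ -(m : ℂ)) → ∀ z : ℂ, 0 < z.re →
      genBesselY n μ (-1 / z) = genBesselF n μ (1 / z) + genBesselU n μ (1 / z)) ∧
    ∃ B C : ℕ → ℂ → ℂ,
      (∀ z : ℂ, 0 < z.re →
        B 0 z = 1 ∧ C 0 z = 1 ∧
        B 1 z = tZ z * (5 * tZ z ^ 2 - 3) / 24 + μ * tZ z ^ 2 * (z - 1) / 4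
          - μ ^ 2 * (z * tZ z + 1) / 4 ∧
        C 1 z = -(tZ z * (5 * tZ z ^ 2 - 3) / 24) + μ * tZ z ^ 2 * (z - 1) / 4
          + μ ^ 2 * (z * tZ z - 1) / 4) ∧
      ∀ δ : ℝ, 0 < δ →
        HasUniformExpansion (fun n z => genBesselU n μ (1 / ((nuN n : ℂ) * z)))
          (fun n z => frontU n μ z) B (sector δ) ∧
        HasUniformExpansion (fun n z => genBesselF n μ (1 / ((nuN n : ℂ) * z)))
          (fun n z => frontF n μ z) C (sector δ) := by
  refine ⟨fun n hb z hz => ?_, ?_⟩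
  · have h := connection n μ hb (x := 2 * z) (by simpa using hz)
    rwa [← one_div_eq_two_div, ← neg_div] at h
  · obtain ⟨d, hd0, hd1, hd⟩ := exists_gammaRatio_expansion μ
    obtain ⟨B, gB, hB, hB1⟩ := exists_formalSolution (σ := ((-1 : ℝ) : ℂ)) (by norm_num) μ hd0
      (by rw [hd1]; push_cast; ring)
    -- The amplitude of F tends to exactly 1, so every coefficient after the zeroth has limit 0.
    obtain ⟨C, gC, hC, hC1⟩ := exists_formalSolution (σ := ((1 : ℝ) : ℂ)) (by norm_num) μ
      (d := fun k => if k = 0 then 1 else 0) (by simp) (by simp)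
    refine ⟨B, C, fun z hz => ⟨hB.zero z, hC.zero z, ?_, ?_⟩, fun δ hδ => ⟨?_, ?_⟩⟩
    · rw [hB1 z hz, firstCoeff, betaZ]
      push_cast
      ring
    · rw [hC1 z hz, firstCoeff, betaZ]
      push_cast
      ring
    · exact hasUniformExpansion_of_amplitude (Or.inr rfl) hB
        (Filter.Eventually.of_forall fun n => exists_amplitude_genBesselU n μ) hd hδ
    -- Only large n is available here: the bound near 0 needs Re(n+μ+1) > 0.
    · refine hasUniformExpansion_of_amplitude (L := fun _ => 1) (Or.inl rfl) hC ?_ (fun N => ?_) hδ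
      · obtain ⟨j, hj⟩ := exists_nat_gt (-μ.re)
        filter_upwards [Filter.eventually_ge_atTop j] with n hn
        have : (j : ℝ) ≤ n := by exact_mod_cast hn
        exact exists_amplitude_genBesselF n (by simp; linarith)
      · refine ⟨1, 0, fun n _ => ?_⟩
        have hν := nuN_pos n
        rcases N with _ | N
        · simp
        · rw [Finset.sum_range_succ']
          simp
          positivity
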